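/- **Setting.** Let $V_0=\mathbb R^4$ with the standard inner product, $a=(\sqrt5+1)/4$, $b=(\sqrt5-1)/4$, and let $R\subset V_0$ be the root system of type $H_4$: the 120 vectors obtained from $\sqrt2(1,0,0,0)$, $\sqrt2(\tfrac12,\tfrac12,\tfrac12,\tfrac12)$, $\sqrt2(a,\tfrac12,b,0)$ by even permutations of coordinates and arbitrary sign changes. The simple roots are $$\alpha_1=\sqrt2(-\tfrac12,-a,0,b),\quad \alpha_2=\sqrt2(\tfrac12,b,-a,0),\quad \alpha_3=\sqrt2(-a,\tfrac12,b,0),\quad \alpha_4=\sqrt2(a,-\tfrac12,b,0),$$ $R^+$ (resp. $R^-=-R^+$) is the set of positive (resp. negative) roots, $\alpha^\vee=2\langle\alpha,\cdot\rangle/\langle\alpha,\alpha\rangle$, $s_\alpha(v)=v-\alpha^\vee(v)\alpha$, $s_i=s_{\alpha_i}$, $W$ is the group generated by the $s_\alpha$ ($\alpha\in R$), and $\varpi_1,\dots,\varpi_4\in V_0$ are the fundamental weights, $\alpha_j^\vee(\varpi_i)=\delta_{ij}$. Let $V=\mathbb C\otimes_{\mathbb R}V_0$, $V^\vee=\mathrm{Hom}_{\mathbb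 C}(V,\mathbb C)$, and $(w\chi)(v)=\chi(w^{-1}v)$ for $w\in W$, $\chi\in V^\vee$. Call $\chi$ regular if its stabilizer in $W$ is trivial. Let $c=\tfrac12$. The graded Hecke algebra $\mathbb H$ is the unital associative $\mathbb C$-algebra generated by $t_w$ ($w\in W$) and $v\in V$, where the $t_w$ multiply as in $\mathbb C[W]$, the $v$ as in $S(V)$, and $t_{s_i}v-s_i(v)t_{s_i}=c\,\alpha_i^\vee(v)$ for all $i$ and all $v\in V$. A weight of an $\mathbb H$-module $M$ is a $\chi\in V^\vee$ for which there is $0\ne m\in M$ such that each $v-\chi(v)$, $v\in V$, has a power killing $m$. A discrete series is an irreducible $\mathbb H$-module all of whose weights $\chi$ satisfy $\mathrm{Re}\,\chi(\varpi_i)<0$ for $i=1,\dots,4$. For $\chi\in V^\vee$ put $Z(\chi)=\{\alpha\in R^+:\chi(\alpha)=0\}$, $P(\chi)=\{\alpha\in R:\chi(\alpha)=c\}$, and for $J\subseteq P(\chi)$ let $\mathcal F^{(\chi,J)}$ be the set of $w\in W$ such that no $\alpha\in Z(\chi)$ has $w\alpha\in R^-$, $w\beta\in R^-$ for $\beta\in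 J$, and $w\beta\in R^+$ for $\beta\in P(\chi)\setminus J$. The pair $(\chi,J)$ is a local region if $\mathcal F^{(\chi,J)}\neq\emptyset$. It is skew if for all $w\in\mathcal F^{(\chi,J)}$: (1) $(w\chi)(\alpha_i)\ne0$ for all $i$; (2) for all $i\neq k$, writing $R_{ik}=R\cap\mathrm{span}(\alpha_i,\alpha_k)$, if $(w\chi)(\gamma)=0$ for some $\gamma\in R_{ik}$, then more than two $\gamma\in R_{ik}$ satisfy $(w\chi)(\gamma)=\pm c$. For $P(\chi)=\{\beta^1,\dots,\beta^4\}$ in this order, $\mathcal F^{(\chi,J)}$ has the sign $(\sigma_1,\dots,\sigma_4)$ if $w\beta^k\in R^{\sigma_k}$ for all $k$ and all $w\in\mathcal F^{(\chi,J)}$. For a skew local region, $\mathbb H^{(\chi,J)}$ denotes the $\mathbb H$-module with $\mathbb C$-basis $\{v_w:w\in\mathcal F^{(\chi,J)}\}$ and action $$p\,v_w=(w\chi)(p)\,v_w\ (p\in V),\qquad t_{s_i}v_w=\frac{c}{(w\chi)(\alpha_i)}v_w+\Bigl(1+\frac{c}{(w\chi)(\alpha_i)}\Bigr)v_{s_iw},$$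 where $v_{s_iw}=0$ if $s_iw\notin\mathcal F^{(\chi,J)}$. **Theorem.** Write $[x_1,x_2,x_3,x_4]=\sum_i x_i\alpha_i$, $\phi=2a$, $\varepsilon_1=\sqrt2(1,0,0,0)$, $\varepsilon_2=\sqrt2(0,1,0,0)$, $\varepsilon_3=\sqrt2(0,0,1,0)$. For each $j=1,\dots,12$ there is exactly one $\chi_j\in V^\vee$ with $P(\chi_j)$ equal to the set in row $j$ below; it is regular. There is $J_j\subseteq P(\chi_j)$ such that $(\chi_j,J_j)$ is a skew local region and $\mathcal F^{(\chi_j,J_j)}$ has the sign in row $j$. Moreover the module $\mathbb H^{(\chi_j,J_j)}$ exists (the formulas above do define an $\mathbb H$-module), is a discrete series, and has the dimension in row $j$. | $j$ | $P(\chi_j)$ (ordered) | sign | dim | |---|---|---|---| | 1 | $[1,0,0,0],\ [0,1,0,0],\ [0,0,1,0],\ [0,0,0,1]$ | $(-,-,-,-)$ | 1 | | 2 | $[1,1,0,0],\ [0,1,1,0],\ [0,0,1,\phi],\ [0,0,\phi,1]$ | $(-,-,-,-)$ | 14 | | 3 | $[1,0,0,0],\ [0,1,1,0],\ [0,0,1,\phi],\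 [0,0,\phi,1]$ | $(-,-,-,+)$ | 4 | | 4 | $[1,0,0,0],\ [0,1,0,0],\ [0,0,1,\phi],\ [0,0,\phi,1]$ | $(-,-,-,-)$ | 5 | | 5 | $[1,1,1,0],\ \varepsilon_1,\ [0,\phi,\phi,1],\ \varepsilon_3$ | $(-,-,-,-)$ | 55 | | 6 | $[1,1,0,0],\ \varepsilon_1,\ [0,\phi,\phi,1],\ \varepsilon_3$ | $(-,+,-,-)$ | 20 | | 7 | $[1,0,0,0],\ \varepsilon_1,\ [0,\phi,\phi,1],\ \varepsilon_3$ | $(-,-,-,-)$ | 30 | | 8 | $[1,1,1,\phi],\ [0,\phi,\phi,\phi],\ [\phi,\phi,\phi,1],\ [0,1,\phi+1,\phi]$ | $(-,-,-,-)$ | 115 | | 9 | $[\phi,\phi,\phi,\phi],\ [1,1,\phi+1,\phi],\ [0,1,\phi+1,\phi+1],\ \varepsilon_2$ | $(-,-,-,-)$ | 240 | | 10 | $[\phi,\phi,\phi,1],\ [0,1,\phi+1,\phi+1],\ \varepsilon_2,\ [1,1,\phi+1,\phi]$ | $(-,-,-,+)$ | 86 | | 11 | $[\phi,\phi,\phi+1,\phi],\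 [1,\phi+1,\phi+1,\phi],\ [1,1,\phi+1,\phi+1],\ [0,\phi,2\phi,\phi+1]$ | $(+,-,-,-)$ | 284 | | 12 | $[\phi,\phi+1,\phi+1,\phi],\ [\phi,\phi,\phi+1,\phi+1],\ [1,\phi+1,\phi+1,\phi+1],\ [0,\phi,2\phi,\phi+1]$ | $(-,-,-,-)$ | 409 | -/

import Mathlib

open scoped TensorProduct

namespace HeckeH4

noncomputable section

/-! ### The root system of type `H₄` in `ℝ⁴` -/

/-- The real space `V₀ = ℝ⁴`, used with the standard dot product. -/
abbrev V₀ : Type := Fin 4 → ℝ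

/-- The constant `a = (√5 + 1) / 4`. -/
def ca : ℝ := (√5 + 1) / 4

/-- The constant `b = (√5 - 1) / 4`. -/
def cb : ℝ := (√5 - 1) / 4

/-- The root system `R`: all vectors obtained from `√2 (1,0,0,0)`, `√2 (1/2,1/2,1/2,1/2)` and
`√2 (a,1/2,b,0)` by even permutations of the coordinates and arbitrary sign changes. -/
def roots : Set V₀ :=
  {x | ∃ p ∈ ({![1, 0, 0, 0], ![1/2, 1/2, 1/2, 1/2], ![ca, 1/2, cb, 0]} : Set V₀),
    ∃ σ ∈ alternatingGroup (Fin 4), ∃ ε : Fin 4 → ℝ, (∀ i, ε i = 1 ∨ ε i = -1) ∧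
      ∀ i, x i = √2 * (ε i * p (σ i))}

/-- The simple roots `α₁, α₂, α₃, α₄` (indexed by `0, 1, 2, 3`). -/
def simpleRoot : Fin 4 → V₀ :=
  ![√2 • ![-1/2, -ca, 0, cb], √2 • ![1/2, cb, -ca, 0],
    √2 • ![-ca, 1/2, cb, 0], √2 • ![ca, -1/2, cb, 0]]

/-- Positive roots: roots that are combinations of simple roots with nonnegative coefficients. -/
def posRoots : Set V₀ :=
  {γ | γ ∈ roots ∧ ∃ x : Fin 4 → ℝ, (∀ i, 0 ≤ x i) ∧ γ = ∑ i, x i • simpleRoot i}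

/-- Negative roots: the roots whose opposite is a positive root. -/
def negRoots : Set V₀ := {γ | γ ∈ roots ∧ -γ ∈ posRoots}

/-- The coroot `α^∨ = 2 ⟨α, ·⟩ / ⟨α, α⟩` as a linear form on `V₀`. -/
def coroot (α : V₀) : V₀ →ₗ[ℝ] ℝ := (2 / (α ⬝ᵥ α)) • dotProductBilin ℝ ℝ α

/-- The fundamental weights `ϖ₁, ϖ₂, ϖ₃, ϖ₄` (see `coroot_simpleRoot_fundWeight`). -/
def fundWeight : Fin 4 → V₀ :=
  ![√2 • ![0, 0, 0, 2 * ca], √2 • ![1/2, ca, 0, 3 * ca + 1/2],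
    √2 • ![1/2, ca + 1/2, ca, 4 * ca + 1], √2 • ![ca, ca, ca, 3 * ca + 1]]

/-! ### The reflection group -/

lemma ca_sq : ca ^ 2 = ca / 2 + 1 / 4 := by
  have h : √5 ^ 2 = 5 := Real.sq_sqrt (by norm_num)
  unfold ca; linear_combination h / 16

lemma cb_eq : cb = ca - 1 / 2 := by unfold ca cb; ring

lemma sqrt_two_sq : √2 ^ 2 = 2 := Real.sq_sqrt (by norm_num)

lemma simpleRoot_dot_self (i : Fin 4) : simpleRoot i ⬝ᵥ simpleRoot i = 2 := by
  have h1 := ca_sq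
  have h2 := sqrt_two_sq
  fin_cases i <;> simp [simpleRoot, dotProduct, Fin.sum_univ_four, cb_eq] <;> ring_nf <;>
    simp only [h1, h2] <;> ring

/-- The fundamental weights are dual to the simple coroots. -/
lemma coroot_simpleRoot_fundWeight (i j : Fin 4) :
    coroot (simpleRoot j) (fundWeight i) = if i = j then 1 else 0 := by
  have h1 := ca_sq
  have h2 := sqrt_two_sq
  simp only [coroot, simpleRoot_dot_self]
  fin_cases i <;> fin_cases j <;>
    simp [simpleRoot, fundWeight, dotProduct, Fin.sum_univ_four, cb_eq] <;> ring_nf <;>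
    simp only [h1, h2] <;> ring

lemma simpleRoot_mem_roots (i : Fin 4) : simpleRoot i ∈ roots := by
  have m : (![ca, 1/2, cb, 0] : V₀) ∈
    ({![1, 0, 0, 0], ![1/2, 1/2, 1/2, 1/2], ![ca, 1/2, cb, 0]} : Set V₀) := by simp
  have key : ∀ (σ : Equiv.Perm (Fin 4)) (ε : Fin 4 → ℝ), Equiv.Perm.sign σ = 1 →
      (∀ i, ε i = 1 ∨ ε i = -1) →
      (∀ k, simpleRoot i k = √2 * (ε k * (![ca, 1/2, cb, 0] : V₀) (σ k))) →
      simpleRoot i ∈ roots := fun σ ε h1 h2 h3 =>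
    ⟨_, m, σ, Equiv.Perm.mem_alternatingGroup.2 h1, ε, h2, h3⟩
  fin_cases i
  · refine key (Equiv.swap 0 1 * Equiv.swap 2 3) ![-1, -1, 1, 1] (by decide) ?_ ?_
    · intro k; fin_cases k <;> simp
    · intro k
      fin_cases k <;> simp [simpleRoot, Equiv.swap_apply_def] <;> ring
  · refine key (Equiv.swap 0 1 * Equiv.swap 1 2) ![1, 1, -1, 1] (by decide) ?_ ?_
    · intro k; fin_cases k <;> simp
    · intro k
      fin_cases k <;> simp [simpleRoot, Equiv.swap_apply_def]
  · refine key 1 ![-1, 1, 1, 1] (by decide) ?_ ?_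
    · intro k; fin_cases k <;> simp
    · intro k
      fin_cases k <;> simp [simpleRoot]
  · refine key 1 ![1, -1, 1, 1] (by decide) ?_ ?_
    · intro k; fin_cases k <;> simp
    · intro k
      fin_cases k <;> simp [simpleRoot] <;> ring

/-- The reflection group `W`, generated by the reflections `s_α`, `α ∈ R`. -/
def reflGroup : Subgroup (V₀ ≃ₗ[ℝ] V₀) :=
  Subgroup.closure {g | ∃ α ∈ roots, ∀ v, g v = v - coroot α v • α}

/-- `W` as a type. -/
abbrev W : Type := reflGroup

lemma coroot_simpleRoot_self (i : Fin 4) : coroot (simpleRoot i) (simpleRoot i) = 2 := by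
  simp [coroot, simpleRoot_dot_self]

/-- The simple reflection `s_i : v ↦ v - α_i^∨(v) α_i`, as an element of `W`. -/
def simpleRefl (i : Fin 4) : W :=
  ⟨Module.reflection (coroot_simpleRoot_self i),
    Subgroup.subset_closure ⟨simpleRoot i, simpleRoot_mem_roots i, fun v =>
      Module.reflection_apply v (coroot_simpleRoot_self i)⟩⟩

/-! ### Complexification -/

/-- `V = ℂ ⊗ V₀`. -/
abbrev V : Type := ℂ ⊗[ℝ] V₀

/-- The inclusion `V₀ → V`, `v ↦ 1 ⊗ v`. -/
def incl (v : V₀) : V := (1 : ℂ) ⊗ₜ[ℝ] v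

/-- The action of `w ∈ W` on `V`. -/
def actV (w : W) : V →ₗ[ℂ] V := LinearMap.baseChange ℂ (w : V₀ ≃ₗ[ℝ] V₀).toLinearMap

/-- The coroot `α^∨` as a complex linear form on `V`. -/
def corootC (α : V₀) : Module.Dual ℂ V := Module.Dual.baseChange ℂ (coroot α)

/-- The action of `W` on characters of `V`: `(w χ)(v) = χ(w⁻¹ v)`. -/
def actChar (w : W) (χ : Module.Dual ℂ V) : Module.Dual ℂ V := χ ∘ₗ actV w⁻¹

/-- `χ` is regular if its stabilizer in `W` is trivial. -/
def IsRegularChar (χ : Module.Dual ℂ V) : Prop := ∀ w : W, actChar w χ = χ → w = 1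

/-! ### The graded Hecke algebra -/

/-- Generators `t_w` (`w ∈ W`) and `f_v` (`v ∈ V`). -/
abbrev HeckeGen : Type := W ⊕ V

/-- The generator `t_w` in the free algebra. -/
def preT (w : W) : FreeAlgebra ℂ HeckeGen := FreeAlgebra.ι ℂ (Sum.inl w)

/-- The generator `f_v` in the free algebra. -/
def preF (v : V) : FreeAlgebra ℂ HeckeGen := FreeAlgebra.ι ℂ (Sum.inr v)

/-- Defining relations of the graded Hecke algebra with constant parameter `c`: the `t_w` multiply
as in `ℂ[W]`, the `f_v` as in `S(V)`, and `t_s v - s(v) t_s = c ⟨v, α^∨⟩` for `s = s_α`,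
`α` simple. -/
inductive HeckeRel (c : ℂ) : FreeAlgebra ℂ HeckeGen → FreeAlgebra ℂ HeckeGen → Prop
  | t_one : HeckeRel c (preT 1) 1
  | t_mul (w w' : W) : HeckeRel c (preT (w * w')) (preT w * preT w')
  | f_add (v v' : V) : HeckeRel c (preF (v + v')) (preF v + preF v')
  | f_smul (z : ℂ) (v : V) : HeckeRel c (preF (z • v)) (z • preF v)
  | f_comm (v v' : V) : HeckeRel c (preF v * preF v') (preF v' * preF v)
  | cross (i : Fin 4) (v : V) :
      HeckeRel c (preT (simpleRefl i) * preF v - preF (actV (simpleRefl i) v) * preT (simpleRefl i))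
        (algebraMap ℂ _ (c * corootC (simpleRoot i) v))

/-- The graded Hecke algebra of type `H₄` with constant parameter `c`. -/
abbrev HeckeAlgebra (c : ℂ) : Type := RingQuot (HeckeRel c)

/-- The element `t_w` of the graded Hecke algebra. -/
def heckeT (c : ℂ) (w : W) : HeckeAlgebra c := RingQuot.mkAlgHom ℂ (HeckeRel c) (preT w)

/-- The element `v ∈ V` of the graded Hecke algebra. -/
def heckeF (c : ℂ) (v : V) : HeckeAlgebra c := RingQuot.mkAlgHom ℂ (HeckeRel c) (preF v)

/-- `χ` is a weight of `M`: the generalized `χ`-weight space of `M` is nonzero. -/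
def IsWeight (c : ℂ) (M : Type) [AddCommGroup M] [Module (HeckeAlgebra c) M]
    (χ : Module.Dual ℂ V) : Prop :=
  ∃ m : M, m ≠ 0 ∧ ∀ v : V, ∃ k : ℕ,
    (heckeF c v - algebraMap ℂ (HeckeAlgebra c) (χ v)) ^ k • m = 0

/-- Discrete series: irreducible modules all of whose weights `χ` satisfy `Re χ(ϖ_i) < 0` for
every fundamental weight `ϖ_i`. -/
def IsDiscreteSeries (c : ℂ) (M : Type) [AddCommGroup M] [Module (HeckeAlgebra c) M] : Prop :=
  IsSimpleModule (HeckeAlgebra c) M ∧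
    ∀ χ : Module.Dual ℂ V, IsWeight c M χ → ∀ i : Fin 4, (χ (incl (fundWeight i))).re < 0

/-! ### Local regions and calibrated modules -/

/-- `Z(χ) = {α ∈ R⁺ : χ(α) = 0}`. -/
def zeroSet (χ : Module.Dual ℂ V) : Set V₀ := {α | α ∈ posRoots ∧ χ (incl α) = 0}

/-- `P(χ) = {α ∈ R : χ(α) = c}`. -/
def poleSet (c : ℂ) (χ : Module.Dual ℂ V) : Set V₀ := {α | α ∈ roots ∧ χ (incl α) = c}

/-- The inversion set `R(w) = {α ∈ R⁺ : w α ∈ R⁻}`. -/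
def inversionSet (w : W) : Set V₀ :=
  {α | α ∈ posRoots ∧ (w : V₀ ≃ₗ[ℝ] V₀) α ∈ negRoots}

/-- The set `F^{(χ,J)}`. -/
def regionSet (c : ℂ) (χ : Module.Dual ℂ V) (J : Set V₀) : Set W :=
  {w | inversionSet w ∩ zeroSet χ = ∅ ∧
    (∀ β ∈ J, (w : V₀ ≃ₗ[ℝ] V₀) β ∈ negRoots) ∧
    ∀ β ∈ poleSet c χ \ J, (w : V₀ ≃ₗ[ℝ] V₀) β ∈ posRoots}

/-- `(χ, J)` is a local region. -/
def IsLocalRegion (c : ℂ) (χ : Module.Dual ℂ V) (J : Set V₀) : Prop :=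
  J ⊆ poleSet c χ ∧ (regionSet c χ J).Nonempty

/-- The rank two root subsystem `R_{ij}` of `R` generated by the simple roots `α_i`, `α_j`. -/
def rankTwoRoots (i j : Fin 4) : Set V₀ :=
  {γ | γ ∈ roots ∧ γ ∈ Submodule.span ℝ {simpleRoot i, simpleRoot j}}

/-- `(χ, J)` is a skew local region. -/
def IsSkewLocalRegion (c : ℂ) (χ : Module.Dual ℂ V) (J : Set V₀) : Prop :=
  IsLocalRegion c χ J ∧
  (∀ w ∈ regionSet c χ J, ∀ i : Fin 4, actChar w χ (incl (simpleRoot i)) ≠ 0) ∧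
  ∀ w ∈ regionSet c χ J, ∀ i j : Fin 4, i ≠ j →
    {γ | γ ∈ rankTwoRoots i j ∧ actChar w χ (incl γ) = 0}.Nonempty →
    2 < {γ | γ ∈ rankTwoRoots i j ∧
      (actChar w χ (incl γ) = c ∨ actChar w χ (incl γ) = -c)}.encard

open Classical in
/-- The sign of a root: `1` on `R⁺`, `-1` on `R⁻` (and `0` off `R`). -/
def rootSign (γ : V₀) : SignType :=
  if γ ∈ posRoots then 1 else if γ ∈ negRoots then -1 else 0

/-- `F^{(χ,J)}` has the sign `σ` with respect to the ordering `β` of `P(χ)`. -/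
def HasSign (c : ℂ) (χ : Module.Dual ℂ V) (J : Set V₀) (β : Fin 4 → V₀) (σ : Fin 4 → SignType) :
    Prop :=
  ∀ w ∈ regionSet c χ J, ∀ k, rootSign ((w : V₀ ≃ₗ[ℝ] V₀) (β k)) = σ k

open Classical in
/-- `M` is (a model of) the calibrated module `H^{(χ,J)}`: it has a `ℂ`-basis `v_w`,
`w ∈ F^{(χ,J)}`, with `p v_w = (wχ)(p) v_w` for `p ∈ V` and
`t_{s_i} v_w = (c / (wχ)(α_i)) v_w + (1 + c / (wχ)(α_i)) v_{s_i w}`,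
where `v_{s_i w} = 0` if `s_i w ∉ F^{(χ,J)}`. -/
def IsCalibratedModule (c : ℂ) (χ : Module.Dual ℂ V) (J : Set V₀) (M : Type) [AddCommGroup M]
    [Module ℂ M] [Module (HeckeAlgebra c) M] : Prop :=
  ∃ b : Module.Basis (regionSet c χ J) ℂ M, ∀ w : regionSet c χ J,
    (∀ p : V, heckeF c p • b w = (actChar (w : W) χ p) • b w) ∧
    ∀ i : Fin 4, heckeT c (simpleRefl i) • b w =
      (c / actChar (w : W) χ (incl (simpleRoot i))) • b w +
      (1 + c / actChar (w : W) χ (incl (simpleRoot i))) •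
        (if h : simpleRefl i * (w : W) ∈ regionSet c χ J
          then b ⟨simpleRefl i * (w : W), h⟩ else 0)

/-! ### The table -/

/-- The combination `x₁ α₁ + x₂ α₂ + x₃ α₃ + x₄ α₄` of the simple roots. -/
def comb (x₁ x₂ x₃ x₄ : ℝ) : V₀ :=
  x₁ • simpleRoot 0 + x₂ • simpleRoot 1 + x₃ • simpleRoot 2 + x₄ • simpleRoot 3

/-- `ε₁ = √2 (1,0,0,0)`. -/
def eps1 : V₀ := √2 • ![1, 0, 0, 0]

/-- `ε₂ = √2 (0,1,0,0)`. -/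
def eps2 : V₀ := √2 • ![0, 1, 0, 0]

/-- `ε₃ = √2 (0,0,1,0)`. -/
def eps3 : V₀ := √2 • ![0, 0, 1, 0]

/-- The ordered lists `β_j^1, β_j^2, β_j^3, β_j^4` of the elements of `P(χ_j)`, `j = 1, …, 12`
(row `j` has index `j - 1`). -/
def tableRoots : Fin 12 → Fin 4 → V₀ :=
  ![![comb 1 0 0 0, comb 0 1 0 0, comb 0 0 1 0, comb 0 0 0 1],
    ![comb 1 1 0 0, comb 0 1 1 0, comb 0 0 1 (2 * ca), comb 0 0 (2 * ca) 1],
    ![comb 1 0 0 0, comb 0 1 1 0, comb 0 0 1 (2 * ca), comb 0 0 (2 * ca) 1],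
    ![comb 1 0 0 0, comb 0 1 0 0, comb 0 0 1 (2 * ca), comb 0 0 (2 * ca) 1],
    ![comb 1 1 1 0, eps1, comb 0 (2 * ca) (2 * ca) 1, eps3],
    ![comb 1 1 0 0, eps1, comb 0 (2 * ca) (2 * ca) 1, eps3],
    ![comb 1 0 0 0, eps1, comb 0 (2 * ca) (2 * ca) 1, eps3],
    ![comb 1 1 1 (2 * ca), comb 0 (2 * ca) (2 * ca) (2 * ca),
      comb (2 * ca) (2 * ca) (2 * ca) 1, comb 0 1 (2 * ca + 1) (2 * ca)],
    ![comb (2 * ca) (2 * ca) (2 * ca) (2 * ca), comb 1 1 (2 * ca + 1) (2 * ca),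
      comb 0 1 (2 * ca + 1) (2 * ca + 1), eps2],
    ![comb (2 * ca) (2 * ca) (2 * ca) 1, comb 0 1 (2 * ca + 1) (2 * ca + 1),
      eps2, comb 1 1 (2 * ca + 1) (2 * ca)],
    ![comb (2 * ca) (2 * ca) (2 * ca + 1) (2 * ca),
      comb 1 (2 * ca + 1) (2 * ca + 1) (2 * ca),
      comb 1 1 (2 * ca + 1) (2 * ca + 1),
      comb 0 (2 * ca) (4 * ca) (2 * ca + 1)],
    ![comb (2 * ca) (2 * ca + 1) (2 * ca + 1) (2 * ca),
      comb (2 * ca) (2 * ca) (2 * ca + 1) (2 * ca + 1),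
      comb 1 (2 * ca + 1) (2 * ca + 1) (2 * ca + 1),
      comb 0 (2 * ca) (4 * ca) (2 * ca + 1)]]

/-- The prescribed sign patterns. -/
def tableSigns : Fin 12 → Fin 4 → SignType :=
  ![![-1, -1, -1, -1], ![-1, -1, -1, -1], ![-1, -1, -1, 1], ![-1, -1, -1, -1],
    ![-1, -1, -1, -1], ![-1, 1, -1, -1], ![-1, -1, -1, -1], ![-1, -1, -1, -1],
    ![-1, -1, -1, -1], ![-1, -1, -1, 1], ![1, -1, -1, -1], ![-1, -1, -1, -1]]

/-- The prescribed dimensions. -/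
def tableDims : Fin 12 → ℕ := ![1, 14, 4, 5, 55, 20, 30, 115, 240, 86, 284, 409]

end

end HeckeH4

open HeckeH4

/-! Each χ_j is nonzero on every root, and all roots where it equals c are positive. Both facts are
finite checks in ℤ[φ] (`pair_charVec`), exact because φ is irrational. So Z(χ_j) is empty, the
second skewness condition has nothing to test, and χ_j is regular, because a real form without zeros
on the roots is conjugate to one positive on the positive roots (`eq_one_of_form_fixed`). The four
roots of a row are linearly independent (`detVec_rowVec`), so they determine χ_j.

Existence of the module would normally require checking braid relations; here they come for free
from the left regular representation of W. Operators of Dunkl type, triangular for the length,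
satisfy the cross relation with left multiplication (`leftMul_dunkl`). Starting from the identity,
intertwiners produce for every u an eigenvector of weight uχ, unique by regularity, and these
vectors form a basis. In it a simple reflection has diagonal entry r = c/(uχ)(α_i) and off-diagonal
entry 1 going up, 1 - r² going down (`weightRep_simpleRefl`). The latter vanishes on a downward step
across a wall of P(χ), so {u : uJ < 0} and its part outside F span nested W-stable subspaces
(`isClosedSet_neg`, `isClosedSet_diff`), and F indexes a basis of the quotient. Rescaling by a
product over inversions gives the stated formulas (`scale_offDiag`). Letting V act diagonally, only
a rank one cross relation is left to check (`exists_heckeHom`).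

Irreducibility: the weights wχ are distinct, so a nonzero submodule contains a basis vector; F is
connected under simple reflections (`region_connected`), and the coefficients along its edges do not
vanish. The dimension is |F| and the weights are the wχ with w in F, so one computation settles both
the dimension and the discrete series condition. Seen from a base point, F is closed under removing
a descent, so removing the first descent turns it into a rooted tree (`exists_parent`). The kernel
walks this tree, counts its vertices and tests the weight at each one (`treeCount_spec`,
`treeCount_charVec`). -/

namespace HeckeH4
noncomputable section

/-! ### Exact arithmetic in `ℤ[φ]`, in a form that the kernel evaluates quickly -/

/-- The element `re + im * φ` of `ℤ[φ]`, where `φ = 2 * ca` is the golden ratio. -/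
structure GInt where
  re : ℤ
  im : ℤ

namespace GInt

@[ext] lemma ext {x y : GInt} (h : x.re = y.re) (h' : x.im = y.im) : x = y := by
  cases x; cases y; simp_all

def add (x y : GInt) : GInt := ⟨x.re + y.re, x.im + y.im⟩
def neg (x : GInt) : GInt := ⟨-x.re, -x.im⟩
/-- Multiplication by `φ`. -/
def phi (x : GInt) : GInt := ⟨x.im, x.re + x.im⟩
/-- Multiplication by `φ - 1 = φ⁻¹`. -/
def phiInv (x : GInt) : GInt := ⟨x.im - x.re, x.re⟩
def mul (x y : GInt) : GInt := ⟨x.re * y.re + x.im * y.im, x.re * y.im + x.im * y.re + x.im * y.im⟩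
def beq (x y : GInt) : Bool := x.re.beq' y.re && x.im.beq' y.im

lemma beq_iff {x y : GInt} : x.beq y = true ↔ x = y := by
  simp [beq, GInt.ext_iff]

/-- The embedding `ℤ[φ] → ℝ`. -/
def ev (x : GInt) : ℝ := x.re + x.im * (2 * ca)

@[simp] lemma ev_mk (m n : ℤ) : ev ⟨m, n⟩ = m + n * (2 * ca) := rfl

@[simp] lemma ev_add (x y : GInt) : ev (add x y) = ev x + ev y := by
  simp [ev, add]; ring

@[simp] lemma ev_neg (x : GInt) : ev (neg x) = -ev x := by
  simp [ev, neg]; ring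

@[simp] lemma ev_phi (x : GInt) : ev (phi x) = 2 * ca * ev x := by
  simp only [ev, phi]; push_cast; linear_combination (-4 * (x.im : ℝ)) * ca_sq

@[simp] lemma ev_phiInv (x : GInt) : ev (phiInv x) = (2 * ca - 1) * ev x := by
  simp only [ev, phiInv]; push_cast; linear_combination (-4 * (x.im : ℝ)) * ca_sq

@[simp] lemma ev_mul (x y : GInt) : ev (mul x y) = ev x * ev y := by
  simp only [ev, mul]; push_cast; linear_combination (-4 * (x.im * y.im : ℝ)) * ca_sq

lemma two_mul_ca : 2 * ca = Real.goldenRatio := by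
  unfold ca Real.goldenRatio; ring

lemma ca_pos : 0 < ca := by unfold ca; positivity

/-- Irrationality of the golden ratio. It turns equalities of real values into equalities of integer
pairs, which the kernel decides. -/
lemma ev_injective : Function.Injective ev := by
  have key : ∀ m n : ℤ, (m : ℝ) + n * Real.goldenRatio = 0 → m = 0 ∧ n = 0 := by
    intro m n h
    have hn : n = 0 := by
      by_contra hn
      have hn' : (n : ℝ) ≠ 0 := by exact_mod_cast hn
      refine Real.goldenRatio_irrational ⟨-m / n, ?_⟩
      push_cast
      rw [div_eq_iff hn']
      linarith
    subst hn
    simp at h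
    exact ⟨h, rfl⟩
  intro x y h
  simp only [ev, two_mul_ca] at h
  have := key (x.re - y.re) (x.im - y.im) (by push_cast; linarith)
  ext <;> omega

end GInt

open GInt

/-- Vectors in `ℤ[φ]⁴`. -/
structure GVec where
  x0 : GInt
  x1 : GInt
  x2 : GInt
  x3 : GInt

namespace GVec

def coord (x : GVec) : Fin 4 → GInt := ![x.x0, x.x1, x.x2, x.x3]

@[ext] lemma ext {x y : GVec} (h0 : x.x0 = y.x0) (h1 : x.x1 = y.x1) (h2 : x.x2 = y.x2)
    (h3 : x.x3 = y.x3) : x = y := by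
  cases x; cases y; simp_all

def neg (x : GVec) : GVec := ⟨x.x0.neg, x.x1.neg, x.x2.neg, x.x3.neg⟩

def beq (x y : GVec) : Bool :=
  x.x0.beq y.x0 && (x.x1.beq y.x1 && (x.x2.beq y.x2 && x.x3.beq y.x3))

lemma beq_iff {x y : GVec} : x.beq y = true ↔ x = y := by
  simp [beq, GVec.ext_iff, GInt.beq_iff]

def mem (x : GVec) (l : List GVec) : Bool := l.any fun y => x.beq y

lemma mem_iff {x : GVec} {l : List GVec} : x.mem l = true ↔ x ∈ l := by
  simp [mem, beq_iff]

/-- The vector of `V₀` with coordinates `x` in the basis of simple roots. -/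
def toV (x : GVec) : V₀ :=
  ev x.x0 • simpleRoot 0 + ev x.x1 • simpleRoot 1 + ev x.x2 • simpleRoot 2 + ev x.x3 • simpleRoot 3

lemma toV_neg (x : GVec) : x.neg.toV = -x.toV := by
  simp only [toV, neg, ev_neg]; module

/-- Coordinates of `toV x` with respect to the orthogonal basis of vectors `(√2/2) e_i`. -/
def std (x : GVec) : GVec :=
  ⟨(x.x1.add x.x0.neg).add (x.x3.add x.x2.neg).phi,
   (x.x0.phi.neg.add x.x1.phiInv).add (x.x2.add x.x3.neg),
   x.x1.phi.neg.add (x.x2.add x.x3).phiInv,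
   x.x0.phiInv⟩

lemma toV_apply (x : GVec) (i : Fin 4) : x.toV i = √2 * (ev (x.std.coord i) / 2) := by
  fin_cases i <;> simp [toV, std, coord, simpleRoot, cb_eq] <;> ring

/-- Coordinates in the basis of simple roots from the coordinates `std`. -/
def ofStd (v : GVec) : GVec :=
  let h : GInt → GInt := fun x => ⟨x.re / 2, x.im / 2⟩
  ⟨v.x3.phi,
   h ((v.x0.add v.x1.phi).add (mul ⟨1, 3⟩ v.x3)),
   h ((v.x0.add (mul ⟨1, 1⟩ v.x1)).add (v.x2.phi.add (mul ⟨2, 4⟩ v.x3))),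
   h ((v.x0.add (v.x1.add v.x2)).phi.add (mul ⟨2, 3⟩ v.x3))⟩

end GVec

open GVec

/-- The vector with nonnegative coordinates read off from eight decimal digits. -/
def ofDigits (n : ℕ) : GVec :=
  ⟨⟨.ofNat (n / 10000000 % 10), .ofNat (n / 1000000 % 10)⟩,
   ⟨.ofNat (n / 100000 % 10), .ofNat (n / 10000 % 10)⟩,
   ⟨.ofNat (n / 1000 % 10), .ofNat (n / 100 % 10)⟩,
   ⟨.ofNat (n / 10 % 10), .ofNat (n % 10)⟩⟩

/-- The coordinates of the positive roots. -/
def posList : List GVec :=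
  [10, 101, 110, 1000, 1001, 10101, 10110, 10211, 11101, 11111, 100000, 101000, 101001, 101101,
   101111, 1010101, 1010110, 1010211, 1011101, 1011111, 1020211, 1021211, 1021212, 1021312,
   1021322, 1111101, 1111111, 1111211, 1111212, 1112212, 1121312, 1121322, 1122212, 1122313,
   1122322, 2132423, 10000000, 10100000, 10101000, 10101001, 10101101, 10101111, 10111101,
   10111111, 10111211, 10111212, 10112212, 10212212, 11121312, 11121322, 11122212, 11122313,
   11122322, 11132423, 11212212, 11222313, 11222322, 11222423, 11223313, 11223323].map ofDigits

/-- The even permutations of four letters. -/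
def evenPerms : List (Equiv.Perm (Fin 4)) :=
  -- The identity, a 3-cycle and its inverse represent the cosets of the Klein four-group.
  [1, Equiv.swap 0 1 * Equiv.swap 1 2, Equiv.swap 1 2 * Equiv.swap 0 1].flatMap fun c =>
    [c, c * (Equiv.swap 0 1 * Equiv.swap 2 3), c * (Equiv.swap 0 2 * Equiv.swap 1 3),
      c * (Equiv.swap 0 3 * Equiv.swap 1 2)]

lemma mem_evenPerms : ∀ σ : Equiv.Perm (Fin 4), Equiv.Perm.sign σ = 1 → σ ∈ evenPerms := by
  decide +kernel

lemma sign_evenPerms : ∀ σ ∈ evenPerms, Equiv.Perm.sign σ = 1 := by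
  decide +kernel

/-- The three vectors generating the root system, doubled. -/
def shapes : List GVec :=
  [⟨⟨2, 0⟩, ⟨0, 0⟩, ⟨0, 0⟩, ⟨0, 0⟩⟩, ⟨⟨1, 0⟩, ⟨1, 0⟩, ⟨1, 0⟩, ⟨1, 0⟩⟩,
    ⟨⟨0, 1⟩, ⟨1, 0⟩, ⟨-1, 1⟩, ⟨0, 0⟩⟩]

lemma ev_shape (p : V₀) :
    p ∈ ({![1, 0, 0, 0], ![1/2, 1/2, 1/2, 1/2], ![ca, 1/2, cb, 0]} : Set V₀) ↔
      ∃ s ∈ shapes, ∀ i, p i = ev (s.coord i) / 2 := by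
  constructor
  · rintro (rfl | rfl | rfl)
    · exact ⟨_, List.mem_cons_self, fun i => by fin_cases i <;> simp [coord, ev]⟩
    · refine ⟨_, List.mem_cons_of_mem _ List.mem_cons_self, fun i => ?_⟩
      fin_cases i <;> simp [coord, ev]
    · refine ⟨_, List.mem_cons_of_mem _ (List.mem_cons_of_mem _ List.mem_cons_self), fun i => ?_⟩
      fin_cases i <;> simp [coord, ev, cb_eq] <;> ring
  · rintro ⟨s, hs, h⟩
    have e : p = fun i => ev (s.coord i) / 2 := funext h
    simp only [shapes, List.mem_cons, List.not_mem_nil, or_false] at hs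
    rcases hs with rfl | rfl | rfl
    · left; rw [e]; ext i; fin_cases i <;> simp [coord, ev]
    · right; left; rw [e]; ext i; fin_cases i <;> simp [coord, ev]
    · right; right; rw [e]; ext i; fin_cases i <;> simp [coord, ev, cb_eq] <;> ring

def sgnMul (b : Bool) (x : GInt) : GInt := bif b then x else x.neg

lemma posList_shape : (posList.all fun x => shapes.any fun s => evenPerms.any fun σ =>
    [0, 1, 2, 3].all fun i => (x.std.coord i).beq (s.coord (σ i)) ||
      (x.std.coord i).beq (s.coord (σ i)).neg) = true := by
  decide +kernel

/-- The comparison of `v.ofStd.std` with `v` is part of the check, so the integer divisions in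
`ofStd` need no justification of their own. -/
lemma shape_posList : (shapes.all fun s => evenPerms.all fun σ =>
    [true, false].all fun b0 => [true, false].all fun b1 => [true, false].all fun b2 =>
    [true, false].all fun b3 =>
      let v : GVec := ⟨sgnMul b0 (s.coord (σ 0)), sgnMul b1 (s.coord (σ 1)), sgnMul b2 (s.coord (σ 2)),
        sgnMul b3 (s.coord (σ 3))⟩
      v.ofStd.std.beq v && (v.ofStd.mem posList || v.ofStd.neg.mem posList)) = true := by
  decide +kernel

/-! ### Explicit description of the roots -/

lemma toV_mem_roots_iff (v : V₀) :
    v ∈ roots ↔ ∃ x ∈ posList, v = x.toV ∨ v = -x.toV := by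
  constructor
  · rintro ⟨p, hp, σ, hσ, ε, hε, hv⟩
    obtain ⟨s, hs, hps⟩ := (ev_shape p).1 hp
    have hchk := shape_posList
    simp only [List.all_eq_true] at hchk
    have hb : ∀ i, ∃ b : Bool, ∀ x : GInt, ev (sgnMul b x) = ε i * ev x := fun i => by
      rcases hε i with h | h
      · exact ⟨true, fun x => by simp [sgnMul, h]⟩
      · exact ⟨false, fun x => by simp [sgnMul, h]⟩
    choose b hb using hb
    have mb : ∀ i, b i ∈ [true, false] := fun i => by cases b i <;> simp
    have := hchk s hs σ (mem_evenPerms σ (Equiv.Perm.mem_alternatingGroup.1 hσ)) (b 0) (mb 0)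
      (b 1) (mb 1) (b 2) (mb 2) (b 3) (mb 3)
    simp only [Bool.and_eq_true, Bool.or_eq_true, GVec.beq_iff, GVec.mem_iff] at this
    obtain ⟨h1, h2⟩ := this
    set w : GVec := ⟨sgnMul (b 0) (s.coord (σ 0)), sgnMul (b 1) (s.coord (σ 1)),
      sgnMul (b 2) (s.coord (σ 2)), sgnMul (b 3) (s.coord (σ 3))⟩ with hw
    have hvw : v = w.ofStd.toV := by
      ext i
      rw [toV_apply, h1, hv i, hps]
      fin_cases i <;> simp [hw, GVec.coord, hb] <;> ring
    rcases h2 with h2 | h2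
    · exact ⟨_, h2, Or.inl hvw⟩
    · exact ⟨_, h2, Or.inr (by rw [toV_neg, neg_neg, hvw])⟩
  · have key : ∀ x ∈ posList, ∀ τ : ℝ, (τ = 1 ∨ τ = -1) → τ • x.toV ∈ roots := by
      intro x hx τ hτ
      have hchk := posList_shape
      simp only [List.all_eq_true, List.any_eq_true, Bool.or_eq_true, GInt.beq_iff] at hchk
      obtain ⟨s, hs, σ, hσ, h⟩ := hchk x hx
      have h' : ∀ i : Fin 4, ∃ ε : ℝ, (ε = 1 ∨ ε = -1) ∧
          ev (x.std.coord i) = ε * ev (s.coord (σ i)) := fun i => by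
        rcases h i (by fin_cases i <;> simp) with h | h
        · exact ⟨1, Or.inl rfl, by rw [h, one_mul]⟩
        · exact ⟨-1, Or.inr rfl, by rw [h, ev_neg]; ring⟩
      choose ε hε h' using h'
      refine ⟨fun i => ev (s.coord i) / 2, (ev_shape _).2 ⟨s, hs, fun _ => rfl⟩, σ,
        Equiv.Perm.mem_alternatingGroup.2 (sign_evenPerms σ hσ), fun i => τ * ε i, fun i => ?_,
        fun i => ?_⟩
      · rcases hτ with rfl | rfl <;> rcases hε i with h | h <;> simp [h]
      · rw [Pi.smul_apply, toV_apply, h', smul_eq_mul]; ring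
    rintro ⟨x, hx, rfl | rfl⟩
    · simpa using key x hx 1 (Or.inl rfl)
    · simpa using key x hx (-1) (Or.inr rfl)

/-- The Gram matrix of the simple roots. -/
def cartanGInt (i j : Fin 4) : GInt :=
  (![![⟨2, 0⟩, ⟨-1, 0⟩, ⟨0, 0⟩, ⟨0, 0⟩], ![⟨-1, 0⟩, ⟨2, 0⟩, ⟨-1, 0⟩, ⟨0, 0⟩],
    ![⟨0, 0⟩, ⟨-1, 0⟩, ⟨2, 0⟩, ⟨0, -1⟩], ![⟨0, 0⟩, ⟨0, 0⟩, ⟨0, -1⟩, ⟨2, 0⟩]] :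
      Fin 4 → Fin 4 → GInt) i j

lemma simpleRoot_dot (i j : Fin 4) :
    simpleRoot i ⬝ᵥ simpleRoot j = ev (cartanGInt i j) := by
  have h1 := ca_sq
  have h2 := sqrt_two_sq
  have h3 : ca ^ 3 = ca / 2 + 1 / 8 := by linear_combination (ca + 1 / 2) * h1
  fin_cases i <;> fin_cases j <;>
    simp [simpleRoot, cartanGInt, ev, dotProduct, Fin.sum_univ_four, cb_eq] <;> ring_nf <;>
    simp only [h1, h2] <;> ring

lemma coroot_simpleRoot (i : Fin 4) (v : V₀) : coroot (simpleRoot i) v = simpleRoot i ⬝ᵥ v := by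
  simp [coroot, simpleRoot_dot_self]

lemma simpleRoot_dot_fundWeight (i j : Fin 4) :
    simpleRoot j ⬝ᵥ fundWeight i = if i = j then 1 else 0 := by
  rw [← coroot_simpleRoot, coroot_simpleRoot_fundWeight]

lemma toV_dot_fundWeight (x : GVec) (k : Fin 4) : x.toV ⬝ᵥ fundWeight k = ev (x.coord k) := by
  simp only [toV, add_dotProduct, smul_dotProduct, simpleRoot_dot_fundWeight]
  fin_cases k <;> simp [GVec.coord]

lemma sum_simpleRoot_dot_fundWeight (x : Fin 4 → ℝ) (k : Fin 4) :
    (∑ i, x i • simpleRoot i) ⬝ᵥ fundWeight k = x k := by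
  simp only [Fin.sum_univ_four, add_dotProduct, smul_dotProduct, simpleRoot_dot_fundWeight]
  fin_cases k <;> simp

/-- The sum of the fundamental weights. -/
def rho : V₀ := ∑ i, fundWeight i

lemma simpleRoot_dot_rho (i : Fin 4) : simpleRoot i ⬝ᵥ rho = 1 := by
  simp [rho, dotProduct_sum, simpleRoot_dot_fundWeight]

/-! ### Positivity of roots -/

def isNonneg (n : ℤ) : Bool := Int.ble' 0 n

/-- Stronger than nonnegativity of the real value. It suffices because the coordinates of positive
roots, hence also their heights, have both integer parts nonnegative. -/
def GInt.isNonneg (x : GInt) : Bool := HeckeH4.isNonneg x.re && HeckeH4.isNonneg x.im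

lemma GInt.isNonneg_iff {x : GInt} : x.isNonneg = true ↔ 0 ≤ x.re ∧ 0 ≤ x.im := by
  simp [GInt.isNonneg, HeckeH4.isNonneg]

lemma GInt.ev_nonneg {x : GInt} (h : 0 ≤ x.re ∧ 0 ≤ x.im) : 0 ≤ ev x := by
  have h1 : (0 : ℝ) ≤ x.re := by exact_mod_cast h.1
  have h2 : (0 : ℝ) ≤ x.im := by exact_mod_cast h.2
  have := ca_pos
  unfold ev; positivity

/-- The reflection `s_i` in the coordinates of the simple roots. -/
def rootReflect (i : Fin 4) (x : GVec) : GVec :=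
  (![⟨x.x0.neg.add x.x1, x.x1, x.x2, x.x3⟩, ⟨x.x0, x.x1.neg.add (x.x0.add x.x2), x.x2, x.x3⟩,
    ⟨x.x0, x.x1, x.x2.neg.add (x.x1.add x.x3.phi), x.x3⟩,
    ⟨x.x0, x.x1, x.x2, x.x3.neg.add x.x2.phi⟩] : Fin 4 → GVec) i

def simpleVec (i : Fin 4) : GVec :=
  (![⟨⟨1, 0⟩, ⟨0, 0⟩, ⟨0, 0⟩, ⟨0, 0⟩⟩, ⟨⟨0, 0⟩, ⟨1, 0⟩, ⟨0, 0⟩, ⟨0, 0⟩⟩,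
    ⟨⟨0, 0⟩, ⟨0, 0⟩, ⟨1, 0⟩, ⟨0, 0⟩⟩, ⟨⟨0, 0⟩, ⟨0, 0⟩, ⟨0, 0⟩, ⟨1, 0⟩⟩] : Fin 4 → GVec) i

lemma toV_simpleVec (i : Fin 4) : (simpleVec i).toV = simpleRoot i := by
  fin_cases i <;> simp [simpleVec, toV]

/-- The finite check behind `simpleRefl_pos`, on which the theory of inversions and length rests. -/
lemma posList_rootReflect : (posList.all fun x => [0, 1, 2, 3].all fun i =>
    x.beq (simpleVec i) || (rootReflect i x).mem posList) = true := by
  decide +kernel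

lemma posList_nonneg : (posList.all fun x => x.x0.isNonneg && x.x1.isNonneg && x.x2.isNonneg &&
    x.x3.isNonneg && Int.blt' 0 (x.x0.re + x.x0.im + x.x1.re + x.x1.im +
      x.x2.re + x.x2.im + x.x3.re + x.x3.im)) = true := by
  decide +kernel

lemma simpleVec_mem_posList : ([0, 1, 2, 3].all fun i => (simpleVec i).mem posList) = true := by
  decide +kernel

lemma coord_nonneg_of_mem {x : GVec} (hx : x ∈ posList) (k : Fin 4) :
    0 ≤ (x.coord k).re ∧ 0 ≤ (x.coord k).im := by
  have := posList_nonneg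
  simp only [List.all_eq_true, Bool.and_eq_true, GInt.isNonneg_iff] at this
  obtain ⟨⟨⟨⟨h0, h1⟩, h2⟩, h3⟩, -⟩ := this x hx
  fin_cases k <;> simpa [GVec.coord]

lemma toV_ne_zero_of_mem {x : GVec} (hx : x ∈ posList) : x.toV ≠ 0 := by
  intro h
  have hz : ∀ k, x.coord k = ⟨0, 0⟩ := fun k => ev_injective (by
    rw [← toV_dot_fundWeight, h]; simp)
  have := posList_nonneg
  simp only [List.all_eq_true, Bool.and_eq_true, Int.blt'_eq_true] at this
  have h' := (this x hx).2
  have h0 := hz 0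
  have h1 := hz 1
  have h2 := hz 2
  have h3 := hz 3
  simp only [GVec.coord] at h0 h1 h2 h3
  simp at h0 h1 h2 h3
  simp [h0, h1, h2, h3] at h'

lemma posRoots_iff (v : V₀) : v ∈ posRoots ↔ ∃ x ∈ posList, v = x.toV := by
  constructor
  · rintro ⟨hv, y, hy, hvy⟩
    obtain ⟨x, hx, rfl | rfl⟩ := (toV_mem_roots_iff v).1 hv
    · exact ⟨x, hx, rfl⟩
    · exfalso
      refine toV_ne_zero_of_mem hx ?_
      have : ∀ k, y k = 0 := fun k => by
        have h1 : y k = -ev (x.coord k) := by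
          rw [← sum_simpleRoot_dot_fundWeight y k, ← hvy, neg_dotProduct, toV_dot_fundWeight]
        have := ev_nonneg (coord_nonneg_of_mem hx k)
        linarith [hy k]
      simpa [this] using hvy
  · rintro ⟨x, hx, rfl⟩
    refine ⟨(toV_mem_roots_iff _).2 ⟨x, hx, Or.inl rfl⟩, fun k => ev (x.coord k),
      fun k => ev_nonneg (coord_nonneg_of_mem hx k), ?_⟩
    simp [Fin.sum_univ_four, toV, GVec.coord]

lemma posRoots_subset_roots {v : V₀} (h : v ∈ posRoots) : v ∈ roots := h.1

lemma neg_mem_roots {v : V₀} (h : v ∈ roots) : -v ∈ roots := by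
  obtain ⟨x, hx, rfl | rfl⟩ := (toV_mem_roots_iff v).1 h
  · exact (toV_mem_roots_iff _).2 ⟨x, hx, Or.inr rfl⟩
  · exact (toV_mem_roots_iff _).2 ⟨x, hx, Or.inl (neg_neg _)⟩

lemma negRoots_iff (v : V₀) : v ∈ negRoots ↔ -v ∈ posRoots :=
  ⟨fun h => h.2, fun h => ⟨by simpa using neg_mem_roots h.1, h⟩⟩

lemma pos_or_neg {v : V₀} (h : v ∈ roots) : v ∈ posRoots ∨ -v ∈ posRoots := by
  obtain ⟨x, hx, rfl | rfl⟩ := (toV_mem_roots_iff v).1 h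
  · exact Or.inl ((posRoots_iff _).2 ⟨x, hx, rfl⟩)
  · exact Or.inr ((posRoots_iff _).2 ⟨x, hx, neg_neg _⟩)

lemma ne_zero_of_mem_roots {v : V₀} (h : v ∈ roots) : v ≠ 0 := by
  obtain ⟨x, hx, rfl | rfl⟩ := (toV_mem_roots_iff v).1 h
  · exact toV_ne_zero_of_mem hx
  · exact neg_ne_zero.2 (toV_ne_zero_of_mem hx)

lemma dot_fundWeight_nonneg {v : V₀} (h : v ∈ posRoots) (k : Fin 4) : 0 ≤ v ⬝ᵥ fundWeight k := by
  obtain ⟨x, hx, rfl⟩ := (posRoots_iff v).1 h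
  rw [toV_dot_fundWeight]
  exact ev_nonneg (coord_nonneg_of_mem hx k)

lemma eq_sum_fundWeight (v : V₀) (hv : ∃ x : Fin 4 → ℝ, v = ∑ i, x i • simpleRoot i) :
    v = ∑ i, (v ⬝ᵥ fundWeight i) • simpleRoot i := by
  obtain ⟨x, rfl⟩ := hv
  simp only [sum_simpleRoot_dot_fundWeight]

lemma posRoots_eq_sum {v : V₀} (h : v ∈ posRoots) :
    v = ∑ i, (v ⬝ᵥ fundWeight i) • simpleRoot i := by
  obtain ⟨x, -, hx⟩ := h.2
  exact eq_sum_fundWeight v ⟨x, hx⟩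

lemma neg_notMem_posRoots {v : V₀} (h : v ∈ posRoots) : -v ∉ posRoots := by
  intro h'
  refine ne_zero_of_mem_roots h.1 ?_
  rw [posRoots_eq_sum h]
  refine Finset.sum_eq_zero fun i _ => ?_
  have h1 := dot_fundWeight_nonneg h i
  have h2 := dot_fundWeight_nonneg h' i
  rw [neg_dotProduct] at h2
  rw [le_antisymm (by linarith) h1, zero_smul]

lemma roots_finite : roots.Finite := by
  have : roots ⊆ (GVec.toV '' {x | x ∈ posList}) ∪ ((fun x => -GVec.toV x) '' {x | x ∈ posList}) := by
    intro v hv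
    obtain ⟨x, hx, rfl | rfl⟩ := (toV_mem_roots_iff v).1 hv
    · exact Or.inl ⟨x, hx, rfl⟩
    · exact Or.inr ⟨x, hx, rfl⟩
  refine Set.Finite.subset ?_ this
  have hf : {x | x ∈ posList}.Finite := posList.finite_toSet
  exact (hf.image _).union (hf.image _)

lemma simpleRoot_mem_posRoots (i : Fin 4) : simpleRoot i ∈ posRoots := by
  refine (posRoots_iff _).2 ⟨simpleVec i, ?_, (toV_simpleVec i).symm⟩
  have := simpleVec_mem_posList
  simp only [List.all_eq_true, GVec.mem_iff] at this
  exact this i (by fin_cases i <;> simp)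

lemma simpleRefl_apply (i : Fin 4) (v : V₀) :
    (simpleRefl i : V₀ ≃ₗ[ℝ] V₀) v = v - (simpleRoot i ⬝ᵥ v) • simpleRoot i := by
  rw [← coroot_simpleRoot]
  exact Module.reflection_apply v (coroot_simpleRoot_self i)

lemma simpleRefl_toV (i : Fin 4) (x : GVec) :
    (simpleRefl i : V₀ ≃ₗ[ℝ] V₀) x.toV = (rootReflect i x).toV := by
  rw [simpleRefl_apply]
  simp only [toV, dotProduct_add, dotProduct_smul, simpleRoot_dot, smul_eq_mul]
  fin_cases i <;> simp [rootReflect, cartanGInt] <;> module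

lemma simpleRefl_pos {v : V₀} (h : v ∈ posRoots) (i : Fin 4) (hv : v ≠ simpleRoot i) :
    (simpleRefl i : V₀ ≃ₗ[ℝ] V₀) v ∈ posRoots := by
  obtain ⟨x, hx, rfl⟩ := (posRoots_iff v).1 h
  have := posList_rootReflect
  simp only [List.all_eq_true, Bool.or_eq_true, GVec.mem_iff, GVec.beq_iff] at this
  rcases this x hx i (by fin_cases i <;> simp) with h | h
  · exact absurd (by rw [h, toV_simpleVec]) hv
  · exact (posRoots_iff _).2 ⟨_, h, simpleRefl_toV i x⟩

lemma simpleRefl_simpleRoot (i : Fin 4) :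
    (simpleRefl i : V₀ ≃ₗ[ℝ] V₀) (simpleRoot i) = -simpleRoot i := by
  rw [simpleRefl_apply, simpleRoot_dot_self]; module

lemma mem_span_simpleRoot (v : V₀) : v = ∑ i, (v ⬝ᵥ fundWeight i) • simpleRoot i := by
  refine eq_sum_fundWeight v ?_
  have hli : LinearIndependent ℝ simpleRoot := by
    rw [Fintype.linearIndependent_iff]
    intro g hg i
    rw [← sum_simpleRoot_dot_fundWeight g i, hg, zero_dotProduct]
  have hs := hli.span_eq_top_of_card_eq_finrank (by simp)
  have : v ∈ Submodule.span ℝ (Set.range simpleRoot) := by rw [hs]; trivial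
  obtain ⟨c, hc⟩ := (Submodule.mem_span_range_iff_exists_fun ℝ).1 this
  exact ⟨c, hc.symm⟩


/-! ### The reflection group and its length function -/

lemma smul_eq_apply (w : W) (v : V₀) : (w : V₀ ≃ₗ[ℝ] V₀) v = w • v := rfl

lemma W_smul_smul (w : W) (r : ℝ) (v : V₀) : w • (r • v) = r • (w • v) := smul_comm w r v

lemma W_smul_sub (w : W) (u v : V₀) : w • (u - v) = w • u - w • v := smul_sub w u v

lemma simpleRefl_smul (i : Fin 4) (v : V₀) :
    simpleRefl i • v = v - (simpleRoot i ⬝ᵥ v) • simpleRoot i := simpleRefl_apply i v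

lemma dot_smul_smul (w : W) (u v : V₀) : (w • u) ⬝ᵥ (w • v) = u ⬝ᵥ v := by
  obtain ⟨g, hg⟩ := w
  change (g u) ⬝ᵥ (g v) = u ⬝ᵥ v
  induction hg using Subgroup.closure_induction generalizing u v with
  | mem g hg =>
    obtain ⟨α, hα, h⟩ := hg
    rw [h, h]
    have h0 : α ⬝ᵥ α ≠ 0 := fun h0 => ne_zero_of_mem_roots hα (dotProduct_self_eq_zero.1 h0)
    simp only [coroot, LinearMap.smul_apply, dotProductBilin_apply_apply, smul_eq_mul,
      dotProduct_sub, sub_dotProduct, dotProduct_smul, smul_dotProduct]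
    rw [dotProduct_comm u α]
    field_simp
    ring
  | one => rfl
  | mul g h _ _ hg hh => exact (hg _ _).trans (hh _ _)
  | inv g _ hg =>
    rw [← hg (g⁻¹ u) (g⁻¹ v)]
    change (g * g⁻¹) u ⬝ᵥ (g * g⁻¹) v = u ⬝ᵥ v
    rw [mul_inv_cancel]; rfl

lemma dot_smul (w : W) (u v : V₀) : u ⬝ᵥ (w • v) = (w⁻¹ • u) ⬝ᵥ v := by
  rw [← dot_smul_smul w (w⁻¹ • u) v, smul_inv_smul]

lemma simpleRefl_mul_self (i : Fin 4) : simpleRefl i * simpleRefl i = 1 := by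
  apply Subtype.ext
  ext1 v
  change simpleRefl i • simpleRefl i • v = v
  simp only [simpleRefl_smul, dotProduct_sub, dotProduct_smul, simpleRoot_dot_self]
  module

lemma simpleRefl_inv (i : Fin 4) : (simpleRefl i)⁻¹ = simpleRefl i :=
  inv_eq_of_mul_eq_one_left (simpleRefl_mul_self i)

@[simp] lemma simpleRefl_mul_cancel (i : Fin 4) (w : W) :
    simpleRefl i * (simpleRefl i * w) = w := by
  rw [← mul_assoc, simpleRefl_mul_self, one_mul]

@[simp] lemma simpleRefl_smul_cancel (i : Fin 4) (v : V₀) :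
    simpleRefl i • simpleRefl i • v = v := by
  rw [smul_smul, simpleRefl_mul_self, one_smul]

lemma simpleRefl_smul_mem_roots {v : V₀} (h : v ∈ roots) (i : Fin 4) : simpleRefl i • v ∈ roots := by
  have key : ∀ u ∈ posRoots, simpleRefl i • u ∈ roots := fun u hu => by
    by_cases hui : u = simpleRoot i
    · rw [hui, ← smul_eq_apply, simpleRefl_simpleRoot]
      exact neg_mem_roots (simpleRoot_mem_roots i)
    · exact (simpleRefl_pos hu i hui).1
  rcases pos_or_neg h with h | h
  · exact key v h
  · simpa using neg_mem_roots (key _ h)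

/-- The subgroup generated by the simple reflections. -/
def simpleGroup : Subgroup W := Subgroup.closure (Set.range simpleRefl)

lemma simpleRefl_mem (i : Fin 4) : simpleRefl i ∈ simpleGroup :=
  Subgroup.subset_closure ⟨i, rfl⟩

/-- Otherwise ⟨v, v⟩, expanded in simple roots with nonnegative coefficients, would be at most 0. -/
lemma exists_simpleRoot_dot_pos {v : V₀} (h : v ∈ posRoots) : ∃ i, 0 < simpleRoot i ⬝ᵥ v := by
  by_contra! hc
  have h1 : v ⬝ᵥ v = ∑ i, (v ⬝ᵥ fundWeight i) * (simpleRoot i ⬝ᵥ v) := by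
    conv_lhs => rw [posRoots_eq_sum h, sum_dotProduct]
    simp only [smul_dotProduct, smul_eq_mul]
    rw [← posRoots_eq_sum h]
  have h2 : v ⬝ᵥ v ≤ 0 := by
    rw [h1]
    exact Finset.sum_nonpos fun i _ => mul_nonpos_of_nonneg_of_nonpos (dot_fundWeight_nonneg h i) (hc i)
  have h3 : 0 ≤ v ⬝ᵥ v := Finset.sum_nonneg fun i _ => mul_self_nonneg _
  exact ne_zero_of_mem_roots h.1 (dotProduct_self_eq_zero.1 (le_antisymm h2 h3))

/-- Every root is conjugate to a simple root under the simple reflections. -/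
lemma exists_conj_simpleRoot {v : V₀} (hv : v ∈ roots) :
    ∃ w ∈ simpleGroup, ∃ i, v = w • simpleRoot i := by
  have key : ∀ v ∈ posRoots, ∃ w ∈ simpleGroup, ∃ i, v = w • simpleRoot i := by
    intro v hv
    -- Take a positive root of least height in the orbit. A simple reflection pairing positively
    -- with it would lower the height and stay positive, unless the root is itself simple.
    set S : Set V₀ := {u | u ∈ posRoots ∧ ∃ w ∈ simpleGroup, v = w • u} with hS
    have hfin : S.Finite := roots_finite.subset fun u hu => hu.1.1
    obtain ⟨u, hu, hmin⟩ := Set.exists_min_image S (fun u => u ⬝ᵥ rho) hfin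
      ⟨v, hv, 1, one_mem _, (one_smul _ _).symm⟩
    obtain ⟨hup, w, hw, hvw⟩ := hu
    obtain ⟨i, hi⟩ := exists_simpleRoot_dot_pos hup
    by_cases hui : u = simpleRoot i
    · exact ⟨w, hw, i, hui ▸ hvw⟩
    · exfalso
      have := hmin (simpleRefl i • u) ⟨simpleRefl_pos hup i hui, w * simpleRefl i,
        mul_mem hw (simpleRefl_mem i), by rw [mul_smul, simpleRefl_smul_cancel, hvw]⟩
      simp only [simpleRefl_smul, sub_dotProduct, smul_dotProduct, simpleRoot_dot_rho,
        smul_eq_mul] at this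
      linarith
  rcases pos_or_neg hv with h | h
  · exact key v h
  · obtain ⟨w, hw, i, h⟩ := key _ h
    refine ⟨w * simpleRefl i, mul_mem hw (simpleRefl_mem i), i, ?_⟩
    rw [mul_smul, ← smul_eq_apply, ← smul_eq_apply (simpleRefl i), simpleRefl_simpleRoot, map_neg,
      smul_eq_apply, ← h, neg_neg]

lemma dot_self_of_mem_roots {v : V₀} (hv : v ∈ roots) : v ⬝ᵥ v = 2 := by
  obtain ⟨w, -, i, rfl⟩ := exists_conj_simpleRoot hv
  rw [dot_smul_smul, simpleRoot_dot_self]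

lemma coroot_of_mem_roots {α : V₀} (hα : α ∈ roots) (v : V₀) : coroot α v = α ⬝ᵥ v := by
  simp [coroot, dot_self_of_mem_roots hα]

/-- The reflection in w α_i is w s_i w⁻¹, and every root has the form w α_i with w a product of
simple reflections. -/
lemma mem_simpleGroup (w : W) : w ∈ simpleGroup := by
  have : reflGroup ≤ simpleGroup.map reflGroup.subtype := by
    refine (Subgroup.closure_le _).2 ?_
    rintro g ⟨α, hα, hg⟩
    obtain ⟨w, hw, i, rfl⟩ := exists_conj_simpleRoot hα
    refine ⟨w * simpleRefl i * w⁻¹, mul_mem (mul_mem hw (simpleRefl_mem i)) (inv_mem hw), ?_⟩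
    ext1 v
    rw [hg, coroot_of_mem_roots hα]
    change (w * simpleRefl i * w⁻¹) • v = _
    rw [mul_smul, mul_smul, simpleRefl_smul, W_smul_sub, W_smul_smul, smul_inv_smul, dot_smul,
      inv_inv]
  obtain ⟨w', hw', h⟩ := this w.2
  exact (Subtype.ext h : w' = w) ▸ hw'

lemma W_induction {p : W → Prop} (one : p 1) (mul : ∀ i w, p w → p (simpleRefl i * w)) (w : W) :
    p w := by
  induction mem_simpleGroup w using Subgroup.closure_induction_left with
  | one => exact one
  | mul_left x hx y _ hy => obtain ⟨i, rfl⟩ := hx; exact mul i y hy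
  | inv_mul_cancel x hx y _ hy =>
    obtain ⟨i, rfl⟩ := hx; rw [simpleRefl_inv]; exact mul i y hy

lemma smul_mem_roots (w : W) {v : V₀} (h : v ∈ roots) : w • v ∈ roots := by
  induction w using W_induction with
  | one => rwa [one_smul]
  | mul i w hw => rw [mul_smul]; exact simpleRefl_smul_mem_roots hw i

lemma pos_or_neg_smul (w : W) {v : V₀} (h : v ∈ roots) : w • v ∈ posRoots ∨ -(w • v) ∈ posRoots :=
  pos_or_neg (smul_mem_roots w h)

lemma W_ext {u w : W} (h : ∀ i, u • simpleRoot i = w • simpleRoot i) : u = w := by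
  apply Subtype.ext
  ext1 v
  rw [mem_span_simpleRoot v, map_sum, map_sum]
  refine Finset.sum_congr rfl fun i _ => ?_
  rw [map_smul, map_smul]
  exact congrArg _ (h i)

instance : Finite W := by
  have : Finite roots := roots_finite
  refine Finite.of_injective
    (fun (w : W) (i : Fin 4) => (⟨w • simpleRoot i, smul_mem_roots w (simpleRoot_mem_roots i)⟩ : roots)) ?_
  intro u w h
  exact W_ext fun i => congrArg Subtype.val (congrFun h i)

/-! ### Inversions and length -/

lemma mem_inversionSet {w : W} {γ : V₀} :
    γ ∈ inversionSet w ↔ γ ∈ posRoots ∧ -(w • γ) ∈ posRoots := by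
  simp only [inversionSet, Set.mem_ofPred_eq, negRoots_iff]; rfl

lemma inversionSet_finite (w : W) : (inversionSet w).Finite :=
  roots_finite.subset fun _ h => h.1.1

/-- The length of `w`: the number of its inversions. -/
def len (w : W) : ℕ := (inversionSet w).ncard

lemma inversionSet_one : inversionSet 1 = ∅ := by
  ext γ
  simp only [mem_inversionSet, one_smul, Set.mem_empty_iff_false, iff_false, not_and]
  exact neg_notMem_posRoots

lemma len_one : len 1 = 0 := by simp [len, inversionSet_one]

lemma simpleRefl_smul_pos_iff {i : Fin 4} {v : V₀} (hv : v ∈ roots) (h1 : v ≠ simpleRoot i)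
    (h2 : v ≠ -simpleRoot i) : simpleRefl i • v ∈ posRoots ↔ v ∈ posRoots := by
  constructor
  · intro h
    rcases pos_or_neg hv with h' | h'
    · exact h'
    · exfalso
      have := simpleRefl_pos h' i (fun h => h2 (by rw [← h, neg_neg]))
      rw [smul_eq_apply, smul_neg] at this
      exact neg_notMem_posRoots h this
  · exact fun h => simpleRefl_pos h i h1

lemma inv_smul_ne {w : W} {i : Fin 4} {γ : V₀} (h : γ ≠ w⁻¹ • simpleRoot i) :
    w • γ ≠ simpleRoot i := fun h' => h (by rw [← h', inv_smul_smul])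

lemma inv_smul_ne_neg {w : W} {i : Fin 4} {γ : V₀} (h : γ ≠ -(w⁻¹ • simpleRoot i)) :
    w • γ ≠ -simpleRoot i := fun h' => h (by rw [← smul_neg, ← h', inv_smul_smul])

/-- Going up: the inversion set of `s_i w` if `w⁻¹ α_i` is positive. -/
lemma inversionSet_up {w : W} {i : Fin 4} (h : w⁻¹ • simpleRoot i ∈ posRoots) :
    inversionSet (simpleRefl i * w) = insert (w⁻¹ • simpleRoot i) (inversionSet w) ∧
      w⁻¹ • simpleRoot i ∉ inversionSet w := by
  refine ⟨?_, fun h' => ?_⟩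
  · ext γ
    rw [Set.mem_insert_iff, mem_inversionSet, mem_inversionSet]
    by_cases hγ : γ = w⁻¹ • simpleRoot i
    · subst hγ
      simp only [h, true_and, true_or, iff_true, mul_smul, smul_inv_smul]
      rw [← smul_eq_apply, simpleRefl_simpleRoot, neg_neg]
      exact simpleRoot_mem_posRoots i
    · simp only [hγ, false_or]
      refine and_congr_right fun hp => ?_
      have hne : γ ≠ -(w⁻¹ • simpleRoot i) := fun h' => neg_notMem_posRoots h (h' ▸ hp)
      rw [mul_smul, ← smul_neg]
      refine simpleRefl_smul_pos_iff (neg_mem_roots (smul_mem_roots w hp.1)) ?_ ?_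
      · exact fun h' => inv_smul_ne_neg hne (by rw [← h', neg_neg])
      · exact fun h' => inv_smul_ne hγ (neg_injective h')
  · rw [mem_inversionSet, smul_inv_smul] at h'
    exact neg_notMem_posRoots (simpleRoot_mem_posRoots i) h'.2

lemma len_up {w : W} {i : Fin 4} (h : w⁻¹ • simpleRoot i ∈ posRoots) :
    len (simpleRefl i * w) = len w + 1 := by
  obtain ⟨h1, h2⟩ := inversionSet_up h
  rw [len, h1, Set.ncard_insert_of_notMem h2 (inversionSet_finite w), len]

lemma mul_inv_smul_simpleRoot (w : W) (i : Fin 4) :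
    (simpleRefl i * w)⁻¹ • simpleRoot i = -(w⁻¹ • simpleRoot i) := by
  rw [mul_inv_rev, simpleRefl_inv, mul_smul, ← smul_eq_apply (simpleRefl i),
    simpleRefl_simpleRoot, smul_neg]

lemma up_of_down {w : W} {i : Fin 4} (h : -(w⁻¹ • simpleRoot i) ∈ posRoots) :
    (simpleRefl i * w)⁻¹ • simpleRoot i ∈ posRoots := by
  rwa [mul_inv_smul_simpleRoot]

lemma len_down {w : W} {i : Fin 4} (h : -(w⁻¹ • simpleRoot i) ∈ posRoots) :
    len w = len (simpleRefl i * w) + 1 := by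
  have := len_up (up_of_down h)
  rwa [simpleRefl_mul_cancel] at this

lemma len_simpleRefl_mul_le (i : Fin 4) (w : W) : len (simpleRefl i * w) ≤ len w + 1 := by
  rcases pos_or_neg_smul w⁻¹ (simpleRoot_mem_roots i) with h | h
  · exact (len_up h).le
  · have := len_down h; omega

lemma smul_pos_of_forall {w : W} (h : ∀ i, w • simpleRoot i ∈ posRoots) {γ : V₀}
    (hγ : γ ∈ posRoots) : w • γ ∈ posRoots := by
  refine ⟨smul_mem_roots w hγ.1, fun k => (w • γ) ⬝ᵥ fundWeight k, fun k => ?_,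
    mem_span_simpleRoot _⟩
  beta_reduce
  rw [posRoots_eq_sum hγ, Finset.smul_sum, sum_dotProduct]
  refine Finset.sum_nonneg fun i _ => ?_
  rw [W_smul_smul, smul_dotProduct]
  exact mul_nonneg (dot_fundWeight_nonneg hγ i) (dot_fundWeight_nonneg (h i) k)

/-- The Coxeter diagram is a path whose only label 5 sits at one end, so it has no symmetry. -/
lemma cartan_rigid : ∀ p : Fin 4 → Fin 4,
    (∀ i j, (cartanGInt (p i) (p j)).beq (cartanGInt i j) = true) → ∀ i, p i = i := by
  decide +kernel

/-- Such a w permutes the positive roots, hence the simple ones among them, and it preserves inner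
products. `cartan_rigid` then leaves only the identity. -/
lemma eq_one_of_forall_pos {w : W} (h : ∀ i, w • simpleRoot i ∈ posRoots) : w = 1 := by
  have hmaps : Set.MapsTo (fun v => w • v) posRoots posRoots := fun γ hγ => smul_pos_of_forall h hγ
  have hfin : posRoots.Finite := roots_finite.subset fun _ h => h.1
  have hsurj := ((hfin.injOn_iff_bijOn_of_mapsTo hmaps).1 (MulAction.injective w).injOn).surjOn
  have hinv : ∀ γ ∈ posRoots, w⁻¹ • γ ∈ posRoots := fun γ hγ => by
    obtain ⟨δ, hδ, rfl⟩ := hsurj hγ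
    simpa using hδ
  have hperm : ∀ i, ∃ k, w • simpleRoot i = simpleRoot k := by
    intro i
    have hx := posRoots_eq_sum (h i)
    set x : Fin 4 → ℝ := fun k => (w • simpleRoot i) ⬝ᵥ fundWeight k with hxdef
    have hx0 : ∀ k, 0 ≤ x k := dot_fundWeight_nonneg (h i)
    obtain ⟨k, hk⟩ : ∃ k, x k ≠ 0 := by
      by_contra! hc
      refine ne_zero_of_mem_roots (h i).1 ?_
      rw [hx]
      exact Finset.sum_eq_zero fun k _ => by
        change x k • _ = _
        rw [hc, zero_smul]
    refine ⟨k, ?_⟩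
    set δ := w⁻¹ • simpleRoot k with hδ
    have hδp : δ ∈ posRoots := hinv _ (simpleRoot_mem_posRoots k)
    -- In α_i = ∑ x_k w⁻¹α_k all terms have nonnegative coordinates, so a term with x_k ≠ 0 can only
    -- have its i-th coordinate nonzero.
    have hcoord : ∀ l, l ≠ i → δ ⬝ᵥ fundWeight l = 0 := by
      intro l hl
      have h1 : simpleRoot i = ∑ k, x k • (w⁻¹ • simpleRoot k) := by
        rw [← inv_smul_smul w (simpleRoot i), hx, Finset.smul_sum]
        exact Finset.sum_congr rfl fun k _ => W_smul_smul _ _ _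
      have h2 : ∑ k, x k * ((w⁻¹ • simpleRoot k) ⬝ᵥ fundWeight l) = 0 := by
        have := congrArg (· ⬝ᵥ fundWeight l) h1
        simp only [simpleRoot_dot_fundWeight, hl, if_false, sum_dotProduct, smul_dotProduct,
          smul_eq_mul] at this
        exact this.symm
      have h3 := (Finset.sum_eq_zero_iff_of_nonneg (fun k _ => mul_nonneg (hx0 k)
        (dot_fundWeight_nonneg (hinv _ (simpleRoot_mem_posRoots k)) l))).1 h2 k (Finset.mem_univ k)
      exact (mul_eq_zero.1 h3).resolve_left hk
    have hδi : δ = (δ ⬝ᵥ fundWeight i) • simpleRoot i := by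
      conv_lhs => rw [posRoots_eq_sum hδp]
      exact Finset.sum_eq_single i (fun l _ hl => by rw [hcoord l hl, zero_smul]) (by simp)
    have hnorm := dot_self_of_mem_roots hδp.1
    rw [hδi, smul_dotProduct, dotProduct_smul, simpleRoot_dot_self] at hnorm
    have hpos := dot_fundWeight_nonneg hδp i
    have hone : δ ⬝ᵥ fundWeight i = 1 := by
      simp only [smul_eq_mul] at hnorm
      nlinarith
    rw [hone, one_smul] at hδi
    rw [← hδi, hδ, smul_inv_smul]
  choose p hp using hperm
  have hpi := cartan_rigid p fun i j => by
    rw [GInt.beq_iff]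
    apply ev_injective
    rw [← simpleRoot_dot, ← simpleRoot_dot, ← hp, ← hp, dot_smul_smul]
  exact W_ext fun i => by rw [hp, hpi, one_smul]

lemma exists_down {w : W} (h : w ≠ 1) : ∃ i, -(w⁻¹ • simpleRoot i) ∈ posRoots := by
  by_contra! hc
  refine h (inv_eq_one.1 (eq_one_of_forall_pos fun i => ?_))
  exact (pos_or_neg_smul w⁻¹ (simpleRoot_mem_roots i)).resolve_right (hc i)

lemma len_eq_zero {w : W} (h : len w = 0) : w = 1 := by
  by_contra hw
  obtain ⟨i, hi⟩ := exists_down hw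
  have := len_down hi
  omega

/-- Induction along reduced words. -/
lemma len_induction {p : W → Prop} (one : p 1)
    (up : ∀ i w, w⁻¹ • simpleRoot i ∈ posRoots → p w → p (simpleRefl i * w)) (w : W) : p w := by
  induction hn : len w generalizing w with
  | zero => exact len_eq_zero hn ▸ one
  | succ n ih =>
    obtain ⟨i, hi⟩ := exists_down (w := w) (by rintro rfl; simp [len_one] at hn)
    have h1 := len_down hi
    have := up i _ (up_of_down hi) (ih (simpleRefl i * w) (by omega))
    rwa [simpleRefl_mul_cancel] at this

/-! ### Reflections in arbitrary roots -/

/-- The reflection in the root `α`, as an element of `W`. -/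
lemma exists_rootRefl {α : V₀} (hα : α ∈ roots) :
    ∃ s : W, ∀ v : V₀, s • v = v - (α ⬝ᵥ v) • α := by
  obtain ⟨w, -, i, rfl⟩ := exists_conj_simpleRoot hα
  refine ⟨w * simpleRefl i * w⁻¹, fun v => ?_⟩
  rw [mul_smul, mul_smul, simpleRefl_smul, W_smul_sub, W_smul_smul, smul_inv_smul, dot_smul,
    inv_inv]

def rootRefl (α : roots) : W := (exists_rootRefl α.2).choose

lemma rootRefl_smul (α : roots) (v : V₀) :
    rootRefl α • v = v - ((α : V₀) ⬝ᵥ v) • (α : V₀) := (exists_rootRefl α.2).choose_spec v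

/-- The action of `W` on the set of roots. -/
def actRoot (w : W) (α : roots) : roots := ⟨w • (α : V₀), smul_mem_roots w α.2⟩

lemma rootRefl_actRoot (w : W) (α : roots) : rootRefl (actRoot w α) * w = w * rootRefl α := by
  refine W_ext fun i => ?_
  rw [mul_smul, mul_smul, rootRefl_smul, rootRefl_smul, W_smul_sub, W_smul_smul]
  simp only [actRoot, dot_smul_smul]

lemma W_ext' {u w : W} (h : ∀ v : V₀, u • v = w • v) : u = w := W_ext fun _ => h _

lemma rootRefl_simpleRoot {α : roots} {i : Fin 4}
    (h : (α : V₀) = simpleRoot i ∨ (α : V₀) = -simpleRoot i) : rootRefl α = simpleRefl i := by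
  refine W_ext' fun v => ?_
  rw [rootRefl_smul, simpleRefl_smul]
  rcases h with h | h <;> rw [h]
  rw [neg_dotProduct, neg_smul_neg]

/-- The length drop in the strong exchange condition, by induction along a reduced word. For γ ≠ α_i
one has s_γ s_i = s_i s_{s_i γ}, so the hypothesis passes to s_i γ, and the outer s_i adds at most
one to the length. This makes the Dunkl operators triangular. -/
lemma len_rootRefl_mul_lt (w : W) : ∀ (γ : roots), (γ : V₀) ∈ posRoots →
    -(w⁻¹ • (γ : V₀)) ∈ posRoots → len (rootRefl γ * w) < len w := by
  induction w using len_induction with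
  | one =>
    intro γ h1 h2
    rw [inv_one, one_smul] at h2
    exact absurd h2 (neg_notMem_posRoots h1)
  | up i w hi ih =>
    intro γ h1 h2
    rw [len_up hi]
    by_cases hγ : (γ : V₀) = simpleRoot i
    · rw [rootRefl_simpleRoot (Or.inl hγ), simpleRefl_mul_cancel]
      exact Nat.lt_succ_self _
    · have h3 := ih (actRoot (simpleRefl i) γ) (simpleRefl_pos h1 i hγ) (by
        simpa [actRoot, mul_smul, simpleRefl_inv] using h2)
      have h4 : rootRefl γ * (simpleRefl i * w) =
          simpleRefl i * (rootRefl (actRoot (simpleRefl i) γ) * w) := by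
        have := rootRefl_actRoot (simpleRefl i) (actRoot (simpleRefl i) γ)
        have h5 : actRoot (simpleRefl i) (actRoot (simpleRefl i) γ) = γ := by
          ext1; simp [actRoot]
        rw [h5] at this
        rw [← mul_assoc, this, mul_assoc]
      rw [h4]
      have := len_simpleRefl_mul_le i (rootRefl (actRoot (simpleRefl i) γ) * w)
      omega

/-- A real linear form that does not vanish on any root has trivial stabilizer. -/
lemma eq_one_of_form_fixed {ψ : V₀ →ₗ[ℝ] ℝ} (hψ : ∀ γ ∈ roots, ψ γ ≠ 0) {w : W}
    (hw : ∀ v, ψ (w • v) = ψ v) : w = 1 := by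
  -- Since s_i ρ = ρ - α_i, a maximizing u moves ψ into the closed dominant chamber; as ψ vanishes
  -- on no root, into the open one.
  obtain ⟨u, hu⟩ := Finite.exists_max fun u : W => ψ (u⁻¹ • rho)
  have hpos : ∀ i, 0 < ψ (u⁻¹ • simpleRoot i) := fun i => by
    have h := hu (simpleRefl i * u)
    rw [mul_inv_rev, simpleRefl_inv, mul_smul, simpleRefl_smul, simpleRoot_dot_rho, one_smul,
      W_smul_sub, map_sub] at h
    have := hψ _ (smul_mem_roots u⁻¹ (simpleRoot_mem_roots i))
    exact lt_of_le_of_ne (by linarith) this.symm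
  have hpos' : ∀ γ ∈ posRoots, 0 ≤ ψ (u⁻¹ • γ) := fun γ hγ => by
    rw [posRoots_eq_sum hγ, Finset.smul_sum, map_sum]
    refine Finset.sum_nonneg fun i _ => ?_
    rw [W_smul_smul, map_smul]
    exact mul_nonneg (dot_fundWeight_nonneg hγ i) (hpos i).le
  have h1 : u * w * u⁻¹ = 1 := eq_one_of_forall_pos fun i => by
    refine (pos_or_neg_smul _ (simpleRoot_mem_roots i)).resolve_right fun h => ?_
    have h2 := hpos' _ h
    rw [smul_neg, map_neg, mul_smul, mul_smul, inv_smul_smul, hw] at h2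
    linarith [hpos i]
  rw [mul_inv_eq_one] at h1
  simpa using h1


/-! ### Principal series -/

instance : Fintype roots := roots_finite.fintype

open Classical in
def sgn (v : V₀) : ℂ := if v ∈ posRoots then 1 else -1

lemma sgn_pos {v : V₀} (h : v ∈ posRoots) : sgn v = 1 := if_pos h

lemma sgn_neg {v : V₀} (h : -v ∈ posRoots) : sgn v = -1 :=
  if_neg fun h' => neg_notMem_posRoots h' h

/-- The coefficient of `s_γ w` in the action of `v` on `w` in the principal series. -/
def dunklCoeff (v : V₀) (w : W) (γ : roots) : ℂ :=
  (sgn (γ : V₀) - sgn (w⁻¹ • (γ : V₀))) * (((γ : V₀) ⬝ᵥ v : ℝ) : ℂ)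

/-- The image of the basis vector `w` under the operator of `v` on the principal series. -/
def dunklBasis (c : ℂ) (f : V₀ →ₗ[ℝ] ℂ) (v : V₀) (w : W) : W →₀ ℂ :=
  f (w⁻¹ • v) • Finsupp.single w 1 +
    -- The sum runs over all roots: γ and -γ contribute equally and sign differences are 0 or ±2.
    -- The factor 1/4 thus gives c times the sum over positive γ with w⁻¹γ negative.
    (c / 4) • ∑ γ : roots, dunklCoeff v w γ • Finsupp.single (rootRefl γ * w) 1

/-- The operator of `v` on the principal series with parameter `f`. -/
def dunkl (c : ℂ) (f : V₀ →ₗ[ℝ] ℂ) (v : V₀) : (W →₀ ℂ) →ₗ[ℂ] (W →₀ ℂ) :=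
  Finsupp.linearCombination ℂ (dunklBasis c f v)

/-- Left translation by `u`. -/
def leftMul (u : W) : (W →₀ ℂ) →ₗ[ℂ] (W →₀ ℂ) := Finsupp.lmapDomain ℂ ℂ (u * ·)

@[simp] lemma leftMul_single (u w : W) (a : ℂ) :
    leftMul u (Finsupp.single w a) = Finsupp.single (u * w) a := by
  simp [leftMul]

lemma leftMul_one : leftMul 1 = LinearMap.id := by
  ext w : 2; simp

lemma leftMul_mul (u u' : W) : leftMul (u * u') = leftMul u ∘ₗ leftMul u' := by
  ext w : 2; simp [mul_assoc]

lemma leftMul_apply (u w : W) (x : W →₀ ℂ) : leftMul u x w = x (u⁻¹ * w) := by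
  have := Finsupp.mapDomain_apply (mul_right_injective u) x (u⁻¹ * w)
  rwa [mul_inv_cancel_left] at this

variable {c : ℂ} {f : V₀ →ₗ[ℝ] ℂ}

lemma dunkl_single (v : V₀) (w : W) :
    dunkl c f v (Finsupp.single w 1) = dunklBasis c f v w := by
  simp [dunkl]

lemma simpleRefl_smul_simpleRoot (i : Fin 4) :
    simpleRefl i • simpleRoot i = -simpleRoot i := simpleRefl_simpleRoot i

def actRootEquiv (w : W) : roots ≃ roots where
  toFun := actRoot w
  invFun := actRoot w⁻¹
  left_inv γ := by ext1; simp [actRoot]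
  right_inv γ := by ext1; simp [actRoot]

/-- Only γ = ±α_i contribute, each with 2⟨α_i, v⟩, because s_i preserves the sign of every other
root. -/
lemma sum_sgn_sub (i : Fin 4) (v : V₀) (w : W) :
    ∑ γ : roots, ((sgn (γ : V₀) - sgn (simpleRefl i • (γ : V₀))) * (((γ : V₀) ⬝ᵥ v : ℝ) : ℂ)) •
      Finsupp.single (simpleRefl i * (rootRefl γ * w)) (1 : ℂ) =
    (4 * ((simpleRoot i ⬝ᵥ v : ℝ) : ℂ)) • Finsupp.single w 1 := by
  set a : roots := ⟨simpleRoot i, simpleRoot_mem_roots i⟩ with ha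
  set b : roots := ⟨-simpleRoot i, neg_mem_roots (simpleRoot_mem_roots i)⟩ with hb
  have hab : a ≠ b := fun h => neg_notMem_posRoots (simpleRoot_mem_posRoots i) (by
    have e : simpleRoot i = -simpleRoot i := congrArg Subtype.val h
    rw [← e]
    exact simpleRoot_mem_posRoots i)
  have hp := simpleRoot_mem_posRoots i
  rw [Fintype.sum_eq_add a b hab]
  · rw [rootRefl_simpleRoot (α := a) (Or.inl rfl), rootRefl_simpleRoot (α := b) (Or.inr rfl),
      simpleRefl_mul_cancel, ← add_smul]
    congr 1
    simp only [ha, hb, smul_neg, simpleRefl_smul_simpleRoot, neg_neg]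
    rw [sgn_pos hp, sgn_neg (v := -simpleRoot i) (by rwa [neg_neg]), neg_dotProduct]
    push_cast
    ring
  · rintro γ ⟨h1, h2⟩
    have h1' : (γ : V₀) ≠ simpleRoot i := fun h => h1 (Subtype.ext h)
    have h2' : (γ : V₀) ≠ -simpleRoot i := fun h => h2 (Subtype.ext h)
    have : sgn (simpleRefl i • (γ : V₀)) = sgn (γ : V₀) := by
      have := simpleRefl_smul_pos_iff γ.2 h1' h2'
      unfold sgn
      split_ifs <;> first | rfl | (exfalso; tauto)
    rw [this, sub_self, zero_mul, zero_smul]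

/-- The cross relation on the principal series. -/
lemma leftMul_dunkl (i : Fin 4) (v : V₀) (x : W →₀ ℂ) :
    leftMul (simpleRefl i) (dunkl c f v x) =
      dunkl c f (simpleRefl i • v) (leftMul (simpleRefl i) x) +
        (c * ((simpleRoot i ⬝ᵥ v : ℝ) : ℂ)) • x := by
  induction x using Finsupp.induction_linear with
  | zero => simp
  | add x y hx hy => simp only [map_add, hx, hy, smul_add]; abel
  | single w r =>
    suffices h : leftMul (simpleRefl i) (dunkl c f v (Finsupp.single w 1)) =
        dunkl c f (simpleRefl i • v) (leftMul (simpleRefl i) (Finsupp.single w 1)) +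
        (c * ((simpleRoot i ⬝ᵥ v : ℝ) : ℂ)) • Finsupp.single w 1 by
      have hr : Finsupp.single w r = r • Finsupp.single w (1 : ℂ) := by simp
      rw [hr]
      simp only [map_smul, h, smul_add]
      rw [smul_comm r]
    rw [leftMul_single, dunkl_single, dunkl_single]
    simp only [dunklBasis, map_add, map_smul, map_sum, leftMul_single, mul_inv_rev, mul_smul,
      inv_smul_smul]
    -- Reindex by γ ↦ s_i γ. The result differs from the sum on the other side only by the sum
    -- evaluated in `sum_sgn_sub`.
    have hsum : ∑ γ : roots, dunklCoeff (simpleRefl i • v) (simpleRefl i * w) γ •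
          Finsupp.single (rootRefl γ * (simpleRefl i * w)) (1 : ℂ) =
        ∑ γ : roots, ((sgn (simpleRefl i • (γ : V₀)) - sgn (w⁻¹ • (γ : V₀))) *
          (((γ : V₀) ⬝ᵥ v : ℝ) : ℂ)) •
          Finsupp.single (simpleRefl i * (rootRefl γ * w)) (1 : ℂ) := by
      rw [← (actRootEquiv (simpleRefl i)).sum_comp]
      refine Finset.sum_congr rfl fun γ _ => ?_
      have h1 : rootRefl (actRootEquiv (simpleRefl i) γ) * (simpleRefl i * w) =
          simpleRefl i * (rootRefl γ * w) := by
        rw [← mul_assoc, ← mul_assoc]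
        exact congrArg (· * w) (rootRefl_actRoot (simpleRefl i) γ)
      rw [h1]
      congr 1
      simp only [dunklCoeff, actRootEquiv, Equiv.coe_fn_mk, actRoot, mul_inv_rev, mul_smul,
        inv_smul_smul, dot_smul_smul]
    have hdiff := sum_sgn_sub i v w
    rw [hsum]
    have hsplit : ∑ γ : roots, dunklCoeff v w γ •
          Finsupp.single (simpleRefl i * (rootRefl γ * w)) (1 : ℂ) =
        ∑ γ : roots, ((sgn (simpleRefl i • (γ : V₀)) - sgn (w⁻¹ • (γ : V₀))) *
          (((γ : V₀) ⬝ᵥ v : ℝ) : ℂ)) •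
          Finsupp.single (simpleRefl i * (rootRefl γ * w)) (1 : ℂ) +
        (4 * ((simpleRoot i ⬝ᵥ v : ℝ) : ℂ)) • Finsupp.single w 1 := by
      rw [← hdiff, ← Finset.sum_add_distrib]
      refine Finset.sum_congr rfl fun γ _ => ?_
      rw [← add_smul]
      congr 1
      simp only [dunklCoeff]
      ring
    have h4 : c / 4 * (4 * ((simpleRoot i ⬝ᵥ v : ℝ) : ℂ)) = c * ((simpleRoot i ⬝ᵥ v : ℝ) : ℂ) := by
      ring
    rw [hsplit, smul_add, smul_smul, add_assoc, h4, mul_smul c]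

lemma dunkl_leftMul (i : Fin 4) (v : V₀) (x : W →₀ ℂ) :
    dunkl c f v (leftMul (simpleRefl i) x) =
      leftMul (simpleRefl i) (dunkl c f (simpleRefl i • v) x) +
        (c * ((simpleRoot i ⬝ᵥ v : ℝ) : ℂ)) • x := by
  rw [leftMul_dunkl, simpleRefl_smul_cancel, dot_smul, simpleRefl_inv,
    simpleRefl_smul_simpleRoot, neg_dotProduct]
  push_cast
  module

lemma rootRefl_neg {γ δ : roots} (h : (δ : V₀) = -(γ : V₀)) : rootRefl δ = rootRefl γ := by
  refine W_ext' fun v => ?_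
  rw [rootRefl_smul, rootRefl_smul, h, neg_dotProduct, neg_smul_neg]

lemma len_lt_of_dunklCoeff_ne {v : V₀} {w : W} {γ : roots} (h : dunklCoeff v w γ ≠ 0) :
    len (rootRefl γ * w) < len w := by
  rcases pos_or_neg γ.2 with h1 | h1 <;> rcases pos_or_neg_smul w⁻¹ γ.2 with h2 | h2
  · exact absurd (by rw [dunklCoeff, sgn_pos h1, sgn_pos h2, sub_self, zero_mul]) h
  · exact len_rootRefl_mul_lt w γ h1 h2
  · have := len_rootRefl_mul_lt w ⟨-γ, h1.1⟩ h1 (by rwa [smul_neg, neg_neg])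
    rwa [rootRefl_neg (γ := γ) (δ := ⟨-γ, h1.1⟩) rfl] at this
  · exact absurd (by rw [dunklCoeff, sgn_neg h1, sgn_neg h2, sub_self, zero_mul]) h

/-- Triangularity: the off-diagonal terms sit at elements strictly shorter than w'. -/
lemma dunklBasis_apply_of_len_le {v : V₀} {w w' : W} (h : len w' ≤ len w) :
    dunklBasis c f v w' w = f (w'⁻¹ • v) * Finsupp.single w' (1 : ℂ) w := by
  simp only [dunklBasis, Finsupp.add_apply, Finsupp.smul_apply, Finsupp.finsetSum_apply,
    smul_eq_mul, add_eq_left]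
  rw [Finset.sum_eq_zero, mul_zero]
  intro γ _
  by_cases h0 : dunklCoeff v w' γ = 0
  · rw [h0, zero_mul]
  · rw [Finsupp.single_eq_of_ne, mul_zero]
    rintro rfl
    have := len_lt_of_dunklCoeff_ne h0
    omega

lemma dunkl_apply_of_max {v : V₀} {w : W} {x : W →₀ ℂ} (h : ∀ w', x w' ≠ 0 → len w' ≤ len w) :
    dunkl c f v x w = f (w⁻¹ • v) * x w := by
  rw [dunkl, Finsupp.linearCombination_apply, Finsupp.sum, Finsupp.finsetSum_apply]
  have : ∀ w' ∈ x.support, (x w' • dunklBasis c f v w') w =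
      f (w⁻¹ • v) * (x w' * Finsupp.single w' (1 : ℂ) w) := by
    intro w' hw'
    rw [Finsupp.smul_apply, dunklBasis_apply_of_len_le (h w' (Finsupp.mem_support_iff.1 hw'))]
    by_cases hw : w' = w
    · subst hw; simp; ring
    · simp [Finsupp.single_eq_of_ne' hw]
  rw [Finset.sum_congr rfl this, ← Finset.mul_sum]
  congr 1
  by_cases hw : x w = 0
  · rw [hw]
    refine Finset.sum_eq_zero fun w' hw' => ?_
    rw [Finsupp.single_eq_of_ne', mul_zero]
    rintro rfl
    exact Finsupp.mem_support_iff.1 hw' hw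
  · rw [Finset.sum_eq_single w (fun w' _ hne => by rw [Finsupp.single_eq_of_ne' hne, mul_zero])
      (fun h => absurd (Finsupp.mem_support_iff.2 hw) h)]
    simp

/-! ### Weight vectors and intertwiners -/

/-- `e` is the weight vector of weight `u f` normalized at `u`. -/
def IsWeightVec (c : ℂ) (f : V₀ →ₗ[ℝ] ℂ) (u : W) (e : W →₀ ℂ) : Prop :=
  (∀ v, dunkl c f v e = f (u⁻¹ • v) • e) ∧ e u = 1 ∧ ∀ w, e w ≠ 0 → w = u ∨ len w < len u

lemma isWeightVec_one : IsWeightVec c f 1 (Finsupp.single 1 1) := by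
  refine ⟨fun v => ?_, by simp, fun w hw => ?_⟩
  · rw [dunkl_single, dunklBasis, inv_one, one_smul, add_eq_left, Finset.sum_eq_zero, smul_zero]
    intro γ _
    rw [dunklCoeff, inv_one, one_smul, sub_self, zero_mul, zero_smul]
  · left
    by_contra h
    exact hw (Finsupp.single_eq_of_ne h)

/-- The intertwiner t_i - c/(uf)(α_i): the constant cancels the extra term of the cross relation,
and left translation makes s_i u the new leading term because the length goes up. -/
lemma IsWeightVec.up (hf : ∀ γ ∈ roots, f γ ≠ 0) {u : W} {e : W →₀ ℂ} (he : IsWeightVec c f u e)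
    {i : Fin 4} (hi : u⁻¹ • simpleRoot i ∈ posRoots) :
    IsWeightVec c f (simpleRefl i * u)
      (leftMul (simpleRefl i) e - (c / f (u⁻¹ • simpleRoot i)) • e) := by
  obtain ⟨h1, h2, h3⟩ := he
  have hne := hf _ hi.1
  have hlen := len_up hi
  refine ⟨fun v => ?_, ?_, fun w hw => ?_⟩
  · rw [map_sub, map_smul, dunkl_leftMul, h1, h1, map_smul, mul_inv_rev, simpleRefl_inv,
      mul_smul u⁻¹]
    have hv : f (u⁻¹ • v) = f (u⁻¹ • simpleRefl i • v) +
        ((simpleRoot i ⬝ᵥ v : ℝ) : ℂ) * f (u⁻¹ • simpleRoot i) := by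
      rw [simpleRefl_smul, W_smul_sub, W_smul_smul, map_sub, LinearMap.map_smul, Complex.real_smul]
      ring
    rw [hv]
    match_scalars <;> field_simp
    ring
  · rw [Finsupp.sub_apply, Finsupp.smul_apply, leftMul_apply, inv_mul_cancel_left, h2]
    have : e (simpleRefl i * u) = 0 := by
      by_contra h
      rcases h3 _ h with h | h
      · rw [h] at hlen; omega
      · omega
    simp [this]
  · rw [Finsupp.sub_apply, Finsupp.smul_apply, leftMul_apply, simpleRefl_inv] at hw
    by_cases hw1 : e (simpleRefl i * w) = 0
    · rw [hw1, zero_sub, smul_eq_mul, neg_ne_zero] at hw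
      right
      rcases h3 w (right_ne_zero_of_mul hw) with rfl | h <;> omega
    · rcases h3 _ hw1 with h | h
      · left; rw [← h, simpleRefl_mul_cancel]
      · right
        have := len_simpleRefl_mul_le i (simpleRefl i * w)
        rw [simpleRefl_mul_cancel] at this
        omega

lemma exists_isWeightVec (hf : ∀ γ ∈ roots, f γ ≠ 0) (u : W) : ∃ e, IsWeightVec c f u e := by
  induction u using len_induction with
  | one => exact ⟨_, isWeightVec_one⟩
  | up i w hi ih => obtain ⟨e, he⟩ := ih; exact ⟨_, he.up hf hi⟩

lemma exists_max_len {x : W →₀ ℂ} (hx : x ≠ 0) :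
    ∃ w, x w ≠ 0 ∧ ∀ w', x w' ≠ 0 → len w' ≤ len w := by
  obtain ⟨w, hw, hmax⟩ := x.support.exists_max_image len (Finsupp.support_nonempty_iff.2 hx)
  exact ⟨w, Finsupp.mem_support_iff.1 hw, fun w' h => hmax w' (Finsupp.mem_support_iff.2 h)⟩

/-- Only the identity fixes the form `f`. -/
def IsRegularForm (f : V₀ →ₗ[ℝ] ℂ) : Prop := ∀ w : W, (∀ v, f (w • v) = f v) → w = 1

lemma IsRegularForm.eq (hreg : IsRegularForm f) {u w : W} (h : ∀ v, f (u⁻¹ • v) = f (w⁻¹ • v)) :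
    u = w := by
  have := hreg (u⁻¹ * w) fun v => by rw [mul_smul, h, inv_smul_smul]
  exact inv_mul_eq_one.1 this

/-- At a longest w in the support of the difference, triangularity makes the weight wf. Regularity
forces w = u, where the normalization makes the difference vanish. -/
lemma IsWeightVec.unique (hreg : IsRegularForm f) {u : W} {e e' : W →₀ ℂ}
    (he : IsWeightVec c f u e) (he' : IsWeightVec c f u e') : e = e' := by
  by_contra hne
  obtain ⟨w, hw, hmax⟩ := exists_max_len (sub_ne_zero.2 hne)
  have hu : (e - e') u = 0 := by rw [Finsupp.sub_apply, he.2.1, he'.2.1, sub_self]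
  refine hw ?_
  have hwu : w = u := hreg.eq fun v => by
    have h1 := dunkl_apply_of_max (c := c) (f := f) (v := v) hmax
    rw [map_sub, he.1, he'.1, ← smul_sub, Finsupp.smul_apply, smul_eq_mul] at h1
    exact (mul_right_cancel₀ hw h1).symm
  rw [hwu, hu]

/-- The normalized weight vector of weight `u f`. -/
def weightVec (c : ℂ) (f : V₀ →ₗ[ℝ] ℂ) (hf : ∀ γ ∈ roots, f γ ≠ 0) (u : W) : W →₀ ℂ :=
  (exists_isWeightVec (c := c) hf u).choose

lemma weightVec_spec (hf : ∀ γ ∈ roots, f γ ≠ 0) (u : W) :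
    IsWeightVec c f u (weightVec c f hf u) := (exists_isWeightVec hf u).choose_spec

lemma leftMul_weightVec_up (hf : ∀ γ ∈ roots, f γ ≠ 0) (hreg : IsRegularForm f) {u : W} {i : Fin 4}
    (hi : u⁻¹ • simpleRoot i ∈ posRoots) :
    leftMul (simpleRefl i) (weightVec c f hf u) =
      (c / f (u⁻¹ • simpleRoot i)) • weightVec c f hf u + weightVec c f hf (simpleRefl i * u) := by
  rw [(weightVec_spec hf (simpleRefl i * u)).unique hreg ((weightVec_spec hf u).up hf hi)]
  abel

lemma leftMul_leftMul_simpleRefl (i : Fin 4) (x : W →₀ ℂ) :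
    leftMul (simpleRefl i) (leftMul (simpleRefl i) x) = x := by
  rw [← LinearMap.comp_apply, ← leftMul_mul, simpleRefl_mul_self, leftMul_one, LinearMap.id_apply]

/-- Apply t_i to the upward formula at s_i u and use t_i² = 1. -/
lemma leftMul_weightVec_down (hf : ∀ γ ∈ roots, f γ ≠ 0) (hreg : IsRegularForm f) {u : W}
    {i : Fin 4} (hi : -(u⁻¹ • simpleRoot i) ∈ posRoots) :
    leftMul (simpleRefl i) (weightVec c f hf u) =
      (c / f (u⁻¹ • simpleRoot i)) • weightVec c f hf u +
        (1 - (c / f (u⁻¹ • simpleRoot i)) ^ 2) • weightVec c f hf (simpleRefl i * u) := by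
  have h := leftMul_weightVec_up (c := c) hf hreg (up_of_down hi)
  rw [simpleRefl_mul_cancel, mul_inv_smul_simpleRoot, map_neg, div_neg] at h
  have h2 := congrArg (leftMul (simpleRefl i)) h
  rw [leftMul_leftMul_simpleRefl, map_add, map_smul, h] at h2
  rw [← sub_eq_iff_eq_add'.2 h2]
  module


/-! ### Diagonalization of the principal series and its truncations -/

section Calibrated
variable {c : ℂ} {f : V₀ →ₗ[ℝ] ℂ}

/-- The linear map sending the basis vector `u` to the weight vector of weight `u f`. -/
def weightMap (c : ℂ) (f : V₀ →ₗ[ℝ] ℂ) (hf : ∀ γ ∈ roots, f γ ≠ 0) : (W →₀ ℂ) →ₗ[ℂ] (W →₀ ℂ) :=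
  Finsupp.linearCombination ℂ (weightVec c f hf)

/-- The weight vectors are unitriangular with respect to the length. -/
lemma weightMap_injective (hf : ∀ γ ∈ roots, f γ ≠ 0) :
    Function.Injective (weightMap c f hf) := by
  rw [injective_iff_map_eq_zero]
  intro x hx
  by_contra hne
  obtain ⟨w, hw, hmax⟩ := exists_max_len hne
  have h := DFunLike.congr_fun hx w
  rw [weightMap, Finsupp.linearCombination_apply, Finsupp.sum, Finsupp.finsetSum_apply,
    Finset.sum_eq_single w] at h
  · rw [Finsupp.smul_apply, (weightVec_spec hf w).2.1] at h
    simp at h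
    exact hw h
  · intro u hu hne
    rw [Finsupp.smul_apply]
    by_contra h'
    rcases (weightVec_spec hf u).2.2 w (right_ne_zero_of_mul h') with h' | h'
    · exact hne h'.symm
    · have := hmax u (Finsupp.mem_support_iff.1 hu)
      omega
  · intro h'
    exact absurd (Finsupp.mem_support_iff.2 hw) h'

def weightEquiv (c : ℂ) (f : V₀ →ₗ[ℝ] ℂ) (hf : ∀ γ ∈ roots, f γ ≠ 0) : (W →₀ ℂ) ≃ₗ[ℂ] (W →₀ ℂ) :=
  LinearEquiv.ofInjectiveEndo (weightMap c f hf) (weightMap_injective hf)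

lemma weightEquiv_single (hf : ∀ γ ∈ roots, f γ ≠ 0) (u : W) :
    weightEquiv c f hf (Finsupp.single u 1) = weightVec c f hf u := by
  change weightMap c f hf _ = _
  simp [weightMap]

/-- The regular representation in the basis of weight vectors. -/
def weightRep (c : ℂ) (f : V₀ →ₗ[ℝ] ℂ) (hf : ∀ γ ∈ roots, f γ ≠ 0) (w : W) :
    (W →₀ ℂ) →ₗ[ℂ] (W →₀ ℂ) :=
  (weightEquiv c f hf).symm.toLinearMap ∘ₗ leftMul w ∘ₗ (weightEquiv c f hf).toLinearMap

lemma weightRep_one (hf : ∀ γ ∈ roots, f γ ≠ 0) : weightRep c f hf 1 = LinearMap.id := by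
  ext1 u
  simp [weightRep, leftMul_one]

lemma weightRep_mul (hf : ∀ γ ∈ roots, f γ ≠ 0) (w w' : W) (x : W →₀ ℂ) :
    weightRep c f hf (w * w') x = weightRep c f hf w (weightRep c f hf w' x) := by
  simp [weightRep, leftMul_mul]

open Classical in
/-- The off-diagonal coefficient of a simple reflection in the basis of weight vectors. -/
def offDiag (c : ℂ) (f : V₀ →ₗ[ℝ] ℂ) (u : W) (i : Fin 4) : ℂ :=
  if u⁻¹ • simpleRoot i ∈ posRoots then 1 else 1 - (c / f (u⁻¹ • simpleRoot i)) ^ 2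

lemma weightRep_simpleRefl (hf : ∀ γ ∈ roots, f γ ≠ 0) (hreg : IsRegularForm f) (u : W)
    (i : Fin 4) : weightRep c f hf (simpleRefl i) (Finsupp.single u 1) =
      (c / f (u⁻¹ • simpleRoot i)) • Finsupp.single u 1 +
        offDiag c f u i • Finsupp.single (simpleRefl i * u) 1 := by
  change (weightEquiv c f hf).symm _ = _
  rw [LinearEquiv.symm_apply_eq, map_add, LinearEquiv.map_smul, LinearEquiv.map_smul, LinearMap.comp_apply,
    LinearEquiv.coe_coe, weightEquiv_single, weightEquiv_single]
  rcases pos_or_neg_smul u⁻¹ (simpleRoot_mem_roots i) with h | h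
  · rw [leftMul_weightVec_up hf hreg h, offDiag, if_pos h, one_smul]
  · rw [leftMul_weightVec_down hf hreg h, offDiag, if_neg fun h' => neg_notMem_posRoots h' h]

lemma map_mem_supported {X : Type*} {S S' : Set X} (T : (X →₀ ℂ) →ₗ[ℂ] (X →₀ ℂ))
    (h : ∀ u ∈ S, T (Finsupp.single u 1) ∈ Finsupp.supported ℂ ℂ S') {x : X →₀ ℂ}
    (hx : x ∈ Finsupp.supported ℂ ℂ S) : T x ∈ Finsupp.supported ℂ ℂ S' := by
  have hle : Finsupp.supported ℂ ℂ S ≤ (Finsupp.supported ℂ ℂ S').comap T := by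
    conv_lhs => rw [Finsupp.supported_eq_span_single]
    rw [Submodule.span_le]
    rintro _ ⟨u, hu, rfl⟩
    exact h u hu
  exact hle hx

/-! ### Stable subspaces attached to a region -/

/-- A set of basis vectors that is closed under all nonzero off-diagonal coefficients. -/
def IsClosedSet (c : ℂ) (f : V₀ →ₗ[ℝ] ℂ) (S : Set W) : Prop :=
  ∀ u ∈ S, ∀ i, simpleRefl i * u ∉ S → offDiag c f u i = 0

lemma IsClosedSet.weightRep_mem (hf : ∀ γ ∈ roots, f γ ≠ 0) (hreg : IsRegularForm f) {S : Set W}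
    (hS : IsClosedSet c f S) (w : W) : ∀ x ∈ Finsupp.supported ℂ ℂ S,
      weightRep c f hf w x ∈ Finsupp.supported ℂ ℂ S := by
  induction w using W_induction with
  | one => intro x hx; rwa [weightRep_one]
  | mul i w ih =>
    intro x hx
    rw [weightRep_mul]
    refine map_mem_supported _ (fun u hu => ?_) (ih x hx)
    rw [weightRep_simpleRefl hf hreg]
    refine add_mem (Submodule.smul_mem _ _ (Finsupp.single_mem_supported ℂ _ hu)) ?_
    by_cases h : simpleRefl i * u ∈ S
    · exact Submodule.smul_mem _ _ (Finsupp.single_mem_supported ℂ _ h)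
    · rw [hS u hu i h, zero_smul]; exact zero_mem _

/-- The set `F^{(χ, J)}` of a form `f` without zeros on the roots. -/
def regionOf (c : ℂ) (f : V₀ →ₗ[ℝ] ℂ) (J : Set V₀) : Set W :=
  {w | (∀ β ∈ J, -(w • β) ∈ posRoots) ∧ ∀ β ∈ roots, f β = c → β ∉ J → w • β ∈ posRoots}

/-- Leaving the negative side of the wall of β forces u⁻¹α_i = -β. As the pole β is positive, the
step goes down, with ratio c/f(-β) = -1, and 1 - (-1)² = 0. -/
lemma offDiag_eq_zero (hf : ∀ γ ∈ roots, f γ ≠ 0) (hP : ∀ γ ∈ roots, f γ = c → γ ∈ posRoots)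
    {β : V₀} (hβ : β ∈ roots) (hβc : f β = c) {u : W} {i : Fin 4} (h1 : -(u • β) ∈ posRoots)
    (h2 : -((simpleRefl i * u) • β) ∉ posRoots) : offDiag c f u i = 0 := by
  have h3 : -(u • β) = simpleRoot i := by
    by_contra h
    have := simpleRefl_pos h1 i h
    rw [smul_eq_apply, smul_neg, smul_smul] at this
    exact h2 this
  have h4 : u⁻¹ • simpleRoot i = -β := by rw [← h3, smul_neg, inv_smul_smul]
  rw [offDiag, h4, if_neg (neg_notMem_posRoots (hP β hβ hβc)), map_neg, hβc]
  have := hf β hβ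
  rw [hβc] at this
  field_simp
  ring

lemma isClosedSet_neg (hf : ∀ γ ∈ roots, f γ ≠ 0) (hP : ∀ γ ∈ roots, f γ = c → γ ∈ posRoots)
    {J : Set V₀} (hJ : ∀ β ∈ J, β ∈ roots ∧ f β = c) :
    IsClosedSet c f {u | ∀ β ∈ J, -(u • β) ∈ posRoots} := by
  intro u hu i hi
  simp only [Set.mem_ofPred_eq, not_forall] at hi
  obtain ⟨β, hβ, h⟩ := hi
  exact offDiag_eq_zero hf hP (hJ β hβ).1 (hJ β hβ).2 (hu β hβ) h

/-- A step out of this set either leaves {u : uJ < 0} or enters the region. Entering turns a pole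
outside J from negative to positive, so in both cases a wall is left from its negative side. -/
lemma isClosedSet_diff (hf : ∀ γ ∈ roots, f γ ≠ 0) (hP : ∀ γ ∈ roots, f γ = c → γ ∈ posRoots)
    {J : Set V₀} (hJ : ∀ β ∈ J, β ∈ roots ∧ f β = c) :
    IsClosedSet c f ({u | ∀ β ∈ J, -(u • β) ∈ posRoots} \ regionOf c f J) := by
  rintro u ⟨hu, hu'⟩ i hi
  by_cases hA : ∀ β ∈ J, -((simpleRefl i * u) • β) ∈ posRoots
  · have hF : simpleRefl i * u ∈ regionOf c f J := by
      by_contra h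
      exact hi ⟨hA, h⟩
    have : ∃ β ∈ roots, f β = c ∧ β ∉ J ∧ u • β ∉ posRoots := by
      by_contra! h
      exact hu' ⟨hu, h⟩
    obtain ⟨β, h1, h2, h3, h4⟩ := this
    refine offDiag_eq_zero hf hP h1 h2 ((pos_or_neg_smul u h1).resolve_left h4) ?_
    exact neg_notMem_posRoots (hF.2 β h1 h2 h3)
  · exact isClosedSet_neg hf hP hJ u hu i hA

/-! ### Rescaling to the calibrated basis -/

open Classical in
-- Any nonzero value would do at a pole, since steps inside a region never cross a pole wall.
def scaleFactor (c : ℂ) (f : V₀ →ₗ[ℝ] ℂ) (γ : V₀) : ℂ := if f γ = c then 1 else (1 + c / f γ)⁻¹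

/-- The factor relating the calibrated basis to the normalized weight vectors. -/
def scale (c : ℂ) (f : V₀ →ₗ[ℝ] ℂ) (u : W) : ℂ :=
  ∏ γ ∈ (inversionSet_finite u).toFinset, scaleFactor c f γ

lemma scale_up {u : W} {i : Fin 4} (hi : u⁻¹ • simpleRoot i ∈ posRoots) :
    scale c f (simpleRefl i * u) = scaleFactor c f (u⁻¹ • simpleRoot i) * scale c f u := by
  classical
  obtain ⟨h1, h2⟩ := inversionSet_up hi
  rw [scale, scale, ← Finset.prod_insert (by simpa using h2)]
  congr 1
  ext γ
  simp [h1]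

lemma one_add_div_ne_zero (hf : ∀ γ ∈ roots, f γ ≠ 0) (hP : ∀ γ ∈ roots, f γ = c → γ ∈ posRoots)
    {γ : V₀} (hγ : γ ∈ posRoots) : 1 + c / f γ ≠ 0 := by
  intro h
  have h0 := hf γ hγ.1
  have h1 : f (-γ) = c := by
    rw [map_neg]
    field_simp at h
    linear_combination -h
  exact neg_notMem_posRoots hγ (hP _ (neg_mem_roots hγ.1) h1)

lemma scale_ne_zero (hf : ∀ γ ∈ roots, f γ ≠ 0) (hP : ∀ γ ∈ roots, f γ = c → γ ∈ posRoots) (u : W) :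
    scale c f u ≠ 0 := by
  refine Finset.prod_ne_zero_iff.2 fun γ hγ => ?_
  rw [Set.Finite.mem_toFinset] at hγ
  unfold scaleFactor
  split_ifs
  · exact one_ne_zero
  · exact inv_ne_zero (one_add_div_ne_zero hf hP hγ.1)

/-- u and s_i u give τ opposite signs, whereas a region prescribes the sign of every pole. -/
lemma notPole_of_mem_region {J : Set V₀} {u : W} {i : Fin 4} (hu : u ∈ regionOf c f J)
    (hiu : simpleRefl i * u ∈ regionOf c f J) (τ : V₀) (hτ : τ = u⁻¹ • simpleRoot i ∨
      τ = -(u⁻¹ • simpleRoot i)) : f τ ≠ c := by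
  intro hc
  have hroot : τ ∈ roots := by
    rcases hτ with rfl | rfl
    · exact smul_mem_roots _ (simpleRoot_mem_roots i)
    · exact neg_mem_roots (smul_mem_roots _ (simpleRoot_mem_roots i))
  have hflip : (simpleRefl i * u) • τ = -(u • τ) := by
    rcases hτ with rfl | rfl <;>
      simp only [smul_neg, mul_smul, smul_inv_smul, simpleRefl_smul_simpleRoot]
  by_cases hJ : τ ∈ J
  · have h1 := hu.1 τ hJ
    have h2 := hiu.1 τ hJ
    rw [hflip] at h2
    exact neg_notMem_posRoots h1 h2
  · have h1 := hu.2 τ hroot hc hJ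
    have h2 := hiu.2 τ hroot hc hJ
    rw [hflip] at h2
    exact neg_notMem_posRoots h1 h2

/-- With r = c/(uf)(α_i): going up, the ratio of scales is 1 + r itself; going down it is (1 - r)⁻¹,
which turns 1 - r² into 1 + r. -/
lemma scale_offDiag (hf : ∀ γ ∈ roots, f γ ≠ 0) (hP : ∀ γ ∈ roots, f γ = c → γ ∈ posRoots)
    {J : Set V₀} {u : W} {i : Fin 4} (hu : u ∈ regionOf c f J)
    (hiu : simpleRefl i * u ∈ regionOf c f J) :
    scale c f u * offDiag c f u i * (scale c f (simpleRefl i * u))⁻¹ =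
      1 + c / f (u⁻¹ • simpleRoot i) := by
  have hα := hf _ (smul_mem_roots u⁻¹ (simpleRoot_mem_roots i))
  rcases pos_or_neg_smul u⁻¹ (simpleRoot_mem_roots i) with h | h
  · rw [scale_up h, offDiag, if_pos h, scaleFactor,
      if_neg (notPole_of_mem_region hu hiu _ (Or.inl rfl)), mul_inv_rev, inv_inv]
    have := scale_ne_zero hf hP u
    field_simp
  · have h1 := scale_up (c := c) (f := f) (up_of_down h)
    rw [simpleRefl_mul_cancel, mul_inv_smul_simpleRoot, scaleFactor,
      if_neg (notPole_of_mem_region hu hiu _ (Or.inr rfl))] at h1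
    have h2 := one_add_div_ne_zero hf hP h
    have h3 := scale_ne_zero hf hP (simpleRefl i * u)
    rw [h1, offDiag, if_neg fun h' => neg_notMem_posRoots h' h]
    rw [map_neg, div_neg] at h2 ⊢
    set r := c / f (u⁻¹ • simpleRoot i)
    field_simp
    ring

variable (c f) in
/-- The inclusion of the calibrated space into the principal series. -/
def regionIncl (J : Set V₀) : (regionOf c f J →₀ ℂ) →ₗ[ℂ] (W →₀ ℂ) :=
  Finsupp.linearCombination ℂ fun w => scale c f w • Finsupp.single (w : W) 1

open Classical in
variable (c f) in
/-- The projection of the principal series to the calibrated space. -/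
def regionProj (J : Set V₀) : (W →₀ ℂ) →ₗ[ℂ] (regionOf c f J →₀ ℂ) :=
  Finsupp.linearCombination ℂ fun w =>
    if h : w ∈ regionOf c f J then (scale c f w)⁻¹ • Finsupp.single ⟨w, h⟩ 1 else 0

open Classical in
lemma regionProj_single {J : Set V₀} (u : W) :
    regionProj c f J (Finsupp.single u 1) =
      if h : u ∈ regionOf c f J then (scale c f u)⁻¹ • Finsupp.single ⟨u, h⟩ 1 else 0 := by
  simp [regionProj]

lemma regionIncl_single {J : Set V₀} (u : regionOf c f J) :
    regionIncl c f J (Finsupp.single u 1) = scale c f u • Finsupp.single (u : W) 1 := by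
  simp [regionIncl]

lemma regionProj_regionIncl (hf : ∀ γ ∈ roots, f γ ≠ 0)
    (hP : ∀ γ ∈ roots, f γ = c → γ ∈ posRoots) {J : Set V₀} (x : regionOf c f J →₀ ℂ) :
    regionProj c f J (regionIncl c f J x) = x := by
  have : regionProj c f J ∘ₗ regionIncl c f J = LinearMap.id := by
    ext1 u
    ext1
    simp only [LinearMap.comp_apply, Finsupp.lsingle_apply, regionIncl_single, map_smul,
      regionProj_single, u.2, dif_pos, LinearMap.id_apply]
    rw [smul_smul, mul_inv_cancel₀ (scale_ne_zero hf hP _), one_smul]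
  exact LinearMap.congr_fun this x

lemma regionIncl_mem {J : Set V₀} (x : regionOf c f J →₀ ℂ) :
    regionIncl c f J x ∈ Finsupp.supported ℂ ℂ {u : W | ∀ β ∈ J, -(u • β) ∈ posRoots} := by
  induction x using Finsupp.induction_linear with
  | zero => rw [map_zero]; exact zero_mem _
  | add x y hx hy => rw [map_add]; exact add_mem hx hy
  | single u r =>
    rw [← mul_one r, ← smul_eq_mul, ← Finsupp.smul_single, map_smul, regionIncl_single]
    exact Submodule.smul_mem _ _ (Submodule.smul_mem _ _ (Finsupp.single_mem_supported ℂ _ u.2.1))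

lemma regionProj_eq_zero {J : Set V₀} {x : W →₀ ℂ}
    (hx : x ∈ Finsupp.supported ℂ ℂ
      ({u : W | ∀ β ∈ J, -(u • β) ∈ posRoots} \ regionOf c f J)) :
    regionProj c f J x = 0 := by
  rw [regionProj, Finsupp.linearCombination_apply, Finsupp.sum]
  refine Finset.sum_eq_zero fun u hu => ?_
  rw [dif_neg ((Finsupp.mem_supported ℂ x).1 hx hu).2, smul_zero]

lemma sub_regionIncl_regionProj (hf : ∀ γ ∈ roots, f γ ≠ 0)
    (hP : ∀ γ ∈ roots, f γ = c → γ ∈ posRoots) {J : Set V₀} {x : W →₀ ℂ}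
    (hx : x ∈ Finsupp.supported ℂ ℂ {u : W | ∀ β ∈ J, -(u • β) ∈ posRoots}) :
    x - regionIncl c f J (regionProj c f J x) ∈ Finsupp.supported ℂ ℂ
      ({u : W | ∀ β ∈ J, -(u • β) ∈ posRoots} \ regionOf c f J) := by
  refine map_mem_supported (LinearMap.id - regionIncl c f J ∘ₗ regionProj c f J)
    (fun u hu => ?_) hx
  rw [LinearMap.sub_apply, LinearMap.id_apply, LinearMap.comp_apply]
  rw [regionProj_single]
  by_cases h : u ∈ regionOf c f J
  · rw [dif_pos h, map_smul, regionIncl_single, smul_smul,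
      inv_mul_cancel₀ (scale_ne_zero hf hP _), one_smul, sub_self]
    exact zero_mem _
  · rw [dif_neg h, map_zero, sub_zero]
    exact Finsupp.single_mem_supported ℂ _ ⟨hu, h⟩

/-- The operator of `w` on the calibrated module. -/
def regionRep (c : ℂ) (f : V₀ →ₗ[ℝ] ℂ) (hf : ∀ γ ∈ roots, f γ ≠ 0) (J : Set V₀) (w : W) :
    Module.End ℂ (regionOf c f J →₀ ℂ) :=
  regionProj c f J ∘ₗ weightRep c f hf w ∘ₗ regionIncl c f J

lemma regionRep_one (hf : ∀ γ ∈ roots, f γ ≠ 0) (hP : ∀ γ ∈ roots, f γ = c → γ ∈ posRoots)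
    {J : Set V₀} : regionRep c f hf J 1 = 1 := by
  ext1 x
  ext1
  simp only [regionRep, weightRep_one, LinearMap.comp_apply, LinearMap.id_apply,
    regionProj_regionIncl hf hP, Module.End.one_apply]

/-- Projecting and including again changes a vector only within the smaller stable subspace, which
the projection kills. -/
lemma regionRep_mul (hf : ∀ γ ∈ roots, f γ ≠ 0) (hP : ∀ γ ∈ roots, f γ = c → γ ∈ posRoots)
    (hreg : IsRegularForm f) {J : Set V₀} (hJ : ∀ β ∈ J, β ∈ roots ∧ f β = c) (w w' : W) :
    regionRep c f hf J (w * w') = regionRep c f hf J w * regionRep c f hf J w' := by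
  refine LinearMap.ext fun x => ?_
  simp only [regionRep, LinearMap.comp_apply, Module.End.mul_apply, weightRep_mul]
  set y := weightRep c f hf w' (regionIncl c f J x)
  have hy := (isClosedSet_neg hf hP hJ).weightRep_mem hf hreg w' _ (regionIncl_mem x)
  have h1 := sub_regionIncl_regionProj hf hP hy
  have h2 := (isClosedSet_diff hf hP hJ).weightRep_mem hf hreg w _ h1
  have h3 := regionProj_eq_zero h2
  rwa [map_sub, map_sub, sub_eq_zero] at h3

open Classical in
lemma regionRep_simpleRefl (hf : ∀ γ ∈ roots, f γ ≠ 0)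
    (hP : ∀ γ ∈ roots, f γ = c → γ ∈ posRoots) (hreg : IsRegularForm f) {J : Set V₀}
    (u : regionOf c f J) (i : Fin 4) :
    regionRep c f hf J (simpleRefl i) (Finsupp.single u 1) =
      (c / f ((u : W)⁻¹ • simpleRoot i)) • Finsupp.single u 1 +
        (1 + c / f ((u : W)⁻¹ • simpleRoot i)) •
          (if h : simpleRefl i * (u : W) ∈ regionOf c f J
            then Finsupp.single ⟨simpleRefl i * (u : W), h⟩ 1 else 0) := by
  obtain ⟨u, hu⟩ := u
  simp only [regionRep, LinearMap.comp_apply, regionIncl_single, map_smul,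
    weightRep_simpleRefl hf hreg, map_add, regionProj_single, dif_pos hu]
  have hs := scale_ne_zero hf hP u
  by_cases h : simpleRefl i * u ∈ regionOf c f J
  · rw [dif_pos h, dif_pos h, ← scale_offDiag hf hP hu h]
    match_scalars <;> field_simp
  · rw [dif_neg h, dif_neg h]
    match_scalars
    field_simp

end Calibrated

/-! ### Complex characters and the Hecke algebra -/

/-- The restriction of a character to `V₀`. -/
def formOf (χ : Module.Dual ℂ V) : V₀ →ₗ[ℝ] ℂ :=
  (χ.restrictScalars ℝ) ∘ₗ TensorProduct.mk ℝ ℂ V₀ 1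

lemma formOf_apply (χ : Module.Dual ℂ V) (v : V₀) : formOf χ v = χ (incl v) := rfl

lemma V_hom_ext {N : Type*} [AddCommGroup N] [Module ℂ N] {g h : V →ₗ[ℂ] N}
    (H : ∀ v, g (incl v) = h (incl v)) : g = h := by
  refine LinearMap.ext fun p => ?_
  induction p using TensorProduct.induction_on with
  | zero => simp
  | add p q hp hq => rw [map_add, map_add, hp, hq]
  | tmul z v =>
    have : z ⊗ₜ[ℝ] v = z • incl v := by
      rw [incl, TensorProduct.smul_tmul', smul_eq_mul, mul_one]
    rw [this, map_smul, map_smul, H]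

lemma actV_incl (w : W) (v : V₀) : actV w (incl v) = incl (w • v) := by
  rw [actV, incl, LinearMap.baseChange_tmul]; rfl

lemma corootC_incl (α v : V₀) : corootC α (incl v) = ((coroot α v : ℝ) : ℂ) := by
  rw [corootC, incl]
  simp

lemma formOf_actChar (w : W) (χ : Module.Dual ℂ V) (v : V₀) :
    actChar w χ (incl v) = formOf χ (w⁻¹ • v) := by
  rw [actChar, LinearMap.comp_apply, actV_incl, formOf_apply]

lemma actV_simpleRefl (i : Fin 4) (p : V) :
    actV (simpleRefl i) p = p - corootC (simpleRoot i) p • incl (simpleRoot i) := by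
  have : actV (simpleRefl i) = LinearMap.id -
      (corootC (simpleRoot i)).smulRight (incl (simpleRoot i)) := by
    refine V_hom_ext fun v => ?_
    rw [actV_incl, simpleRefl_smul, LinearMap.sub_apply, LinearMap.id_apply,
      LinearMap.smulRight_apply, corootC_incl, coroot_simpleRoot]
    simp only [incl, TensorProduct.tmul_sub, TensorProduct.tmul_smul, TensorProduct.smul_tmul']
    simp
  rw [this]; rfl

lemma actV_actV_simpleRefl (i : Fin 4) (p : V) :
    actV (simpleRefl i) (actV (simpleRefl i) p) = p := by
  have : actV (simpleRefl i) ∘ₗ actV (simpleRefl i) = LinearMap.id :=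
    V_hom_ext fun v => by simp [actV_incl]
  exact LinearMap.congr_fun this p

lemma actV_mul (u w : W) : actV (u * w) = actV u ∘ₗ actV w :=
  V_hom_ext fun v => by simp [actV_incl, mul_smul]

lemma actChar_simpleRefl_mul (i : Fin 4) (w : W) (χ : Module.Dual ℂ V) (p : V) :
    actChar (simpleRefl i * w) χ p = actChar w χ (actV (simpleRefl i) p) := by
  rw [actChar, actChar, mul_inv_rev, simpleRefl_inv, actV_mul]; rfl

section Module
variable {c : ℂ} {χ : Module.Dual ℂ V}

/-- The diagonal operator of `p` on the calibrated module. -/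
def diagOp (c : ℂ) (χ : Module.Dual ℂ V) (J : Set V₀) (p : V) :
    Module.End ℂ (regionOf c (formOf χ) J →₀ ℂ) :=
  Finsupp.linearCombination ℂ fun w => actChar (w : W) χ p • Finsupp.single w 1

lemma diagOp_single {J : Set V₀} (p : V) (w : regionOf c (formOf χ) J) :
    diagOp c χ J p (Finsupp.single w 1) = actChar (w : W) χ p • Finsupp.single w 1 := by
  simp [diagOp]

open Classical in
-- The off-diagonal terms cancel since (s_i w χ)(s_i p) = (wχ)(p). The diagonal term is c/(wχ)(α_i)
-- times (wχ)(p - s_i p), and p - s_i p is a multiple of α_i.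
lemma cross_relation (hf : ∀ γ ∈ roots, formOf χ γ ≠ 0)
    (hP : ∀ γ ∈ roots, formOf χ γ = c → γ ∈ posRoots) (hreg : IsRegularForm (formOf χ))
    {J : Set V₀} (i : Fin 4) (p : V) :
    regionRep c (formOf χ) hf J (simpleRefl i) * diagOp c χ J p -
      diagOp c χ J (actV (simpleRefl i) p) * regionRep c (formOf χ) hf J (simpleRefl i) =
    algebraMap ℂ _ (c * corootC (simpleRoot i) p) := by
  ext1 w
  ext1
  simp only [LinearMap.comp_apply, Finsupp.lsingle_apply, LinearMap.sub_apply,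
    Module.End.mul_apply, diagOp_single, map_smul, map_add, regionRep_simpleRefl hf hP hreg,
    Module.algebraMap_end_apply]
  have hα := hf _ (smul_mem_roots (w : W)⁻¹ (simpleRoot_mem_roots i))
  have h1 : actChar (w : W) χ (actV (simpleRefl i) p) = actChar (w : W) χ p -
      corootC (simpleRoot i) p * formOf χ ((w : W)⁻¹ • simpleRoot i) := by
    rw [actV_simpleRefl, map_sub, map_smul, formOf_actChar, smul_eq_mul]
  by_cases h : simpleRefl i * (w : W) ∈ regionOf c (formOf χ) J
  · rw [dif_pos h, diagOp_single]
    simp only [actChar_simpleRefl_mul, actV_actV_simpleRefl, h1]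
    match_scalars <;> field_simp <;> ring
  · rw [dif_neg h, map_zero, h1]
    match_scalars
    field_simp
    ring

lemma diagOp_comm {J : Set V₀} (p q : V) :
    diagOp c χ J p * diagOp c χ J q = diagOp c χ J q * diagOp c χ J p := by
  ext1 w
  ext1
  simp only [LinearMap.comp_apply, Finsupp.lsingle_apply, Module.End.mul_apply, diagOp_single,
    map_smul]
  rw [smul_comm]

variable (c χ) in
/-- The representation of the graded Hecke algebra on the calibrated space. -/
theorem exists_heckeHom (hf : ∀ γ ∈ roots, formOf χ γ ≠ 0)
    (hP : ∀ γ ∈ roots, formOf χ γ = c → γ ∈ posRoots) (hreg : IsRegularForm (formOf χ))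
    {J : Set V₀} (hJ : ∀ β ∈ J, β ∈ roots ∧ formOf χ β = c) :
    ∃ φ : HeckeAlgebra c →ₐ[ℂ] Module.End ℂ (regionOf c (formOf χ) J →₀ ℂ),
      (∀ w, φ (heckeT c w) = regionRep c (formOf χ) hf J w) ∧
      ∀ p, φ (heckeF c p) = diagOp c χ J p := by
  set g : FreeAlgebra ℂ HeckeGen →ₐ[ℂ] Module.End ℂ (regionOf c (formOf χ) J →₀ ℂ) :=
    FreeAlgebra.lift ℂ (Sum.elim (regionRep c (formOf χ) hf J) (diagOp c χ J)) with hg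
  have gT : ∀ w, g (preT w) = regionRep c (formOf χ) hf J w := fun w => by
    rw [hg, preT, FreeAlgebra.lift_ι_apply]; rfl
  have gF : ∀ p, g (preF p) = diagOp c χ J p := fun w => by
    rw [hg, preF, FreeAlgebra.lift_ι_apply]; rfl
  have hrel : ∀ ⦃x y⦄, HeckeRel c x y → g x = g y := by
    intro x y h
    induction h with
    | t_one => rw [gT, map_one, regionRep_one hf hP]
    | t_mul w w' => rw [map_mul, gT, gT, gT, regionRep_mul hf hP hreg hJ]
    | f_add v v' =>
      rw [map_add, gF, gF, gF]
      ext1 w; ext1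
      simp only [LinearMap.comp_apply, Finsupp.lsingle_apply, diagOp_single, LinearMap.add_apply,
        map_add, add_smul]
    | f_smul z v =>
      rw [map_smul, gF, gF]
      ext1 w; ext1
      simp only [LinearMap.comp_apply, Finsupp.lsingle_apply, diagOp_single, LinearMap.smul_apply,
        map_smul, smul_assoc]
    | f_comm v v' => rw [map_mul, map_mul, gF, gF, diagOp_comm]
    | cross i v =>
      rw [map_sub, map_mul, map_mul, gT, gF, gF, AlgHom.commutes, cross_relation hf hP hreg]
  refine ⟨RingQuot.liftAlgHom ℂ ⟨g, hrel⟩, fun w => ?_, fun p => ?_⟩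
  · rw [heckeT, RingQuot.liftAlgHom_mkAlgHom_apply, gT]
  · rw [heckeF, RingQuot.liftAlgHom_mkAlgHom_apply, gF]

lemma zeroSet_eq_empty (hf : ∀ γ ∈ roots, formOf χ γ ≠ 0) : zeroSet χ = ∅ := by
  ext α
  simp only [zeroSet, Set.mem_ofPred_eq, Set.mem_empty_iff_false, iff_false, not_and]
  exact fun h => hf α h.1

lemma regionSet_eq (hf : ∀ γ ∈ roots, formOf χ γ ≠ 0) (J : Set V₀) :
    regionSet c χ J = regionOf c (formOf χ) J := by
  ext w
  simp only [regionSet, regionOf, zeroSet_eq_empty hf, Set.inter_empty, Set.mem_ofPred_eq,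
    true_and, negRoots_iff, poleSet, Set.mem_sdiff, smul_eq_apply, formOf_apply, and_imp]

/-- The formulas define a module over the graded Hecke algebra. -/
theorem exists_calibratedModule (hf : ∀ γ ∈ roots, formOf χ γ ≠ 0)
    (hP : ∀ γ ∈ roots, formOf χ γ = c → γ ∈ posRoots) (hreg : IsRegularForm (formOf χ))
    {J : Set V₀} (hJ : ∀ β ∈ J, β ∈ roots ∧ formOf χ β = c) :
    ∃ (M : Type) (_ : AddCommGroup M) (_ : Module ℂ M) (_ : Module (HeckeAlgebra c) M)
      (_ : IsScalarTower ℂ (HeckeAlgebra c) M), IsCalibratedModule c χ J M := by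
  classical
  obtain ⟨φ, hT, hF⟩ := exists_heckeHom c χ hf hP hreg hJ
  let inst : Module (HeckeAlgebra c) (regionOf c (formOf χ) J →₀ ℂ) :=
    Module.compHom _ φ.toRingHom
  have hsmul : ∀ (h : HeckeAlgebra c) (m : regionOf c (formOf χ) J →₀ ℂ), h • m = φ h m :=
    fun _ _ => rfl
  refine ⟨regionOf c (formOf χ) J →₀ ℂ, inferInstance, inferInstance, inst,
    ⟨fun z h m => by rw [hsmul, hsmul, map_smul]; rfl⟩, ?_⟩
  rw [IsCalibratedModule, regionSet_eq hf]
  refine ⟨Finsupp.basisSingleOne, fun w => ⟨fun p => ?_, fun i => ?_⟩⟩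
  · rw [hsmul, hF, Finsupp.coe_basisSingleOne, diagOp_single]
  · rw [hsmul, hT, Finsupp.coe_basisSingleOne, regionRep_simpleRefl hf hP hreg, formOf_actChar]

end Module

/-! ### Structure of the calibrated modules -/

section Structure
variable {c : ℂ} {χ : Module.Dual ℂ V} {J : Set V₀}

lemma actChar_injective (hreg : IsRegularForm (formOf χ)) {u w : W}
    (h : actChar u χ = actChar w χ) : u = w :=
  hreg.eq fun v => by rw [← formOf_actChar, ← formOf_actChar, h]

/-- Regions are convex: along a reduced word of w₀ w⁻¹ a root changes sign at most once, so a sign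
shared by both ends persists on the way. -/
lemma region_connected {p : regionOf c (formOf χ) J → Prop} {w₀ : regionOf c (formOf χ) J}
    (h₀ : p w₀) (step : ∀ (w : regionOf c (formOf χ) J) (i : Fin 4)
      (h : simpleRefl i * (w : W) ∈ regionOf c (formOf χ) J), p w → p ⟨simpleRefl i * (w : W), h⟩)
    (w : regionOf c (formOf χ) J) : p w := by
  obtain ⟨w, hw⟩ := w
  obtain ⟨w₀, hw₀⟩ := w₀
  suffices H : ∀ u : W, ∀ w₀, ∀ hw₀ : w₀ ∈ regionOf c (formOf χ) J, p ⟨w₀, hw₀⟩ →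
      u⁻¹ * w₀ = w → p ⟨w, hw⟩ from H (w₀ * w⁻¹) w₀ hw₀ h₀ (by group)
  intro u
  induction u using len_induction with
  | one =>
    intro w₀ hw₀ h₀ h
    rw [inv_one, one_mul] at h
    subst h
    exact h₀
  | up i u hi ih =>
    intro w₀ hw₀ h₀ h
    have hw' : u⁻¹ * (simpleRefl i * w₀) = w := by
      rw [← h, mul_inv_rev, simpleRefl_inv, mul_assoc]
    have hmem : simpleRefl i * w₀ ∈ regionOf c (formOf χ) J := by
      have key : ∀ β, -(w₀ • β) ∈ posRoots → -(w • β) ∈ posRoots →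
          -((simpleRefl i * w₀) • β) ∈ posRoots := by
        intro β h1 h2
        rw [mul_smul, ← smul_neg]
        refine simpleRefl_pos h1 i fun h3 => ?_
        rw [← hw', mul_smul, mul_smul, ← smul_neg, ← smul_neg, h3, simpleRefl_smul_simpleRoot,
          smul_neg] at h2
        exact neg_notMem_posRoots hi h2
      refine ⟨fun β hβ => key β (hw₀.1 β hβ) (hw.1 β hβ), fun β h1 h2 h3 => ?_⟩
      have := key (-β) (by rw [smul_neg, neg_neg]; exact hw₀.2 β h1 h2 h3)
        (by rw [smul_neg, neg_neg]; exact hw.2 β h1 h2 h3)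
      rwa [smul_neg, neg_neg] at this
    exact ih _ hmem (step ⟨w₀, hw₀⟩ i hmem h₀) hw'

variable {M : Type} [AddCommGroup M] [Module ℂ M] [Module (HeckeAlgebra c) M]

lemma heckeF_smul_repr [IsScalarTower ℂ (HeckeAlgebra c) M] {ι : Type*} [Finite ι] (b : Module.Basis ι ℂ M) {θ : ι → ℂ} {p : V}
    (hb : ∀ w, heckeF c p • b w = θ w • b w) (z : ℂ) (k : ℕ) (m : M) (w : ι) :
    b.repr ((heckeF c p - algebraMap ℂ (HeckeAlgebra c) z) ^ k • m) w =
      (θ w - z) ^ k * b.repr m w := by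
  have hlin : ∀ (x : HeckeAlgebra c) (a : ℂ) (m : M), x • a • m = a • x • m := fun x a m => by
    rw [← algebraMap_smul (HeckeAlgebra c) a m, ← algebraMap_smul (HeckeAlgebra c) a (x • m),
      smul_smul, smul_smul, Algebra.commutes]
  have h1 : ∀ m : M, b.repr ((heckeF c p - algebraMap ℂ (HeckeAlgebra c) z) • m) w =
      (θ w - z) * b.repr m w := by
    intro m
    have := Fintype.ofFinite ι
    classical
    conv_lhs => rw [← b.sum_repr m, Finset.smul_sum]
    have : ∀ u, (heckeF c p - algebraMap ℂ (HeckeAlgebra c) z) • (b.repr m u • b u) =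
        ((θ u - z) * b.repr m u) • b u := fun u => by
      rw [hlin, sub_smul, hb, algebraMap_smul]
      module
    simp only [this]
    rw [b.repr_sum_self]
  induction k generalizing m with
  | zero => simp
  | succ k ih => rw [pow_succ, mul_smul, ih, h1, pow_succ]; ring

variable (c χ J) in
/-- `b` is a calibrated basis, indexed by `regionOf`. -/
def IsCalibratedBasis (b : Module.Basis (regionOf c (formOf χ) J) ℂ M) : Prop :=
  ∀ w : regionOf c (formOf χ) J,
    (∀ p : V, heckeF c p • b w = actChar (w : W) χ p • b w) ∧
    ∀ i, ∀ h : simpleRefl i * (w : W) ∈ regionOf c (formOf χ) J,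
      heckeT c (simpleRefl i) • b w = (c / formOf χ ((w : W)⁻¹ • simpleRoot i)) • b w +
        (1 + c / formOf χ ((w : W)⁻¹ • simpleRoot i)) • b ⟨simpleRefl i * (w : W), h⟩

lemma IsCalibratedModule.exists_basis (hf : ∀ γ ∈ roots, formOf χ γ ≠ 0)
    (hM : IsCalibratedModule c χ J M) :
    ∃ b : Module.Basis (regionOf c (formOf χ) J) ℂ M, IsCalibratedBasis c χ J b := by
  classical
  rw [IsCalibratedModule, regionSet_eq hf] at hM
  obtain ⟨b, hb⟩ := hM
  refine ⟨b, fun w => ⟨(hb w).1, fun i h => ?_⟩⟩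
  rw [(hb w).2 i, dif_pos h, formOf_actChar]

/-- The power of p - θ(p) multiplies the w-th coordinate by a power of (wχ)(p) - θ(p), so a nonzero
coordinate forces θ = wχ. -/
lemma IsCalibratedBasis.weight_eq [IsScalarTower ℂ (HeckeAlgebra c) M] {b : Module.Basis (regionOf c (formOf χ) J) ℂ M}
    (hb : IsCalibratedBasis c χ J b) {θ : Module.Dual ℂ V} (hθ : IsWeight c M θ) :
    ∃ w ∈ regionOf c (formOf χ) J, θ = actChar w χ := by
  obtain ⟨m, hm, h⟩ := hθ
  obtain ⟨w, hw⟩ : ∃ w, b.repr m w ≠ 0 := by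
    by_contra! hc
    exact hm (b.repr.map_eq_zero_iff.1 (Finsupp.ext hc))
  refine ⟨w, w.2, LinearMap.ext fun p => ?_⟩
  obtain ⟨k, hk⟩ := h p
  have h1 := heckeF_smul_repr b (fun w => (hb w).1 p) (θ p) k m w
  rw [hk, map_zero, Finsupp.zero_apply] at h1
  have h2 := (mul_eq_zero.1 h1.symm).resolve_right hw
  exact (sub_eq_zero.1 (eq_zero_of_pow_eq_zero h2)).symm

/-- If two coordinates of m are nonzero, p - (wχ)(p) kills one and, for suitable p, keeps the other
because the weights differ. The support shrinks to a single basis vector. -/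
lemma IsCalibratedBasis.exists_mem [IsScalarTower ℂ (HeckeAlgebra c) M] (hreg : IsRegularForm (formOf χ))
    {b : Module.Basis (regionOf c (formOf χ) J) ℂ M} (hb : IsCalibratedBasis c χ J b)
    (N : Submodule (HeckeAlgebra c) M) : ∀ (n : ℕ) (m : M), m ∈ N → m ≠ 0 →
      (b.repr m).support.card ≤ n → ∃ w, b w ∈ N := by
  intro n
  induction n with
  | zero =>
    intro m _ hm0 hcard
    rw [Nat.le_zero, Finset.card_eq_zero, Finsupp.support_eq_empty] at hcard
    exact absurd (b.repr.map_eq_zero_iff.1 hcard) hm0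
  | succ n ih =>
    intro m hm hm0 hcard
    obtain ⟨w, hw⟩ : ∃ w, b.repr m w ≠ 0 := by
      by_contra! hc
      exact hm0 (b.repr.map_eq_zero_iff.1 (Finsupp.ext hc))
    by_cases hall : ∀ u, b.repr m u ≠ 0 → u = w
    · refine ⟨w, ?_⟩
      have h1 : m = b.repr m w • b w := by
        apply b.repr.injective
        ext u
        rw [map_smul, Finsupp.smul_apply, b.repr_self, smul_eq_mul]
        by_cases hu : u = w
        · subst hu; simp
        · rw [Finsupp.single_eq_of_ne hu, mul_zero]
          exact by_contra fun h => hu (hall u h)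
      have h2 : b w = algebraMap ℂ (HeckeAlgebra c) (b.repr m w)⁻¹ • m := by
        have h3 := congrArg ((b.repr m w)⁻¹ • ·) h1
        simp only [smul_smul, inv_mul_cancel₀ hw, one_smul] at h3
        rw [algebraMap_smul, h3]
      rw [h2]
      exact N.smul_mem _ hm
    · push Not at hall
      obtain ⟨u, hu, huw⟩ := hall
      obtain ⟨p, hp⟩ : ∃ p, actChar (u : W) χ p ≠ actChar (w : W) χ p := by
        by_contra! hc
        exact huw (Subtype.ext (actChar_injective hreg (LinearMap.ext hc)))
      set m' := (heckeF c p - algebraMap ℂ (HeckeAlgebra c) (actChar (w : W) χ p)) ^ 1 • m with hm'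
      have hrepr := heckeF_smul_repr b (fun w => (hb w).1 p) (actChar (w : W) χ p) 1 m
      refine ih m' (N.smul_mem _ hm) (fun h0 => ?_) ?_
      · have := hrepr u
        rw [← hm', h0, map_zero, Finsupp.zero_apply, pow_one] at this
        exact mul_ne_zero (sub_ne_zero.2 hp) hu this.symm
      · have hss : (b.repr m').support ⊂ (b.repr m).support := by
          rw [Finset.ssubset_iff_of_subset]
          · refine ⟨w, Finsupp.mem_support_iff.2 hw, fun h => ?_⟩
            rw [Finsupp.mem_support_iff, hrepr, sub_self, pow_one, zero_mul] at h
            exact h rfl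
          · intro v hv
            rw [Finsupp.mem_support_iff, hrepr] at hv
            exact Finsupp.mem_support_iff.2 (right_ne_zero_of_mul hv)
        have := Finset.card_lt_card hss
        omega

/-- The calibrated modules are irreducible. -/
theorem IsCalibratedBasis.isSimpleModule [IsScalarTower ℂ (HeckeAlgebra c) M] (hf : ∀ γ ∈ roots, formOf χ γ ≠ 0)
    (hreg : IsRegularForm (formOf χ)) (hne : (regionOf c (formOf χ) J).Nonempty)
    {b : Module.Basis (regionOf c (formOf χ) J) ℂ M} (hb : IsCalibratedBasis c χ J b) :
    IsSimpleModule (HeckeAlgebra c) M := by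
  obtain ⟨w₀, hw₀⟩ := hne
  have hnt : Nontrivial M := ⟨b ⟨w₀, hw₀⟩, 0, b.ne_zero _⟩
  rw [isSimpleModule_iff]
  have : Nontrivial (Submodule (HeckeAlgebra c) M) := Submodule.nontrivial_iff _ |>.2 hnt
  refine ⟨fun N => ?_⟩
  by_cases hN : N = ⊥
  · exact Or.inl hN
  right
  obtain ⟨m, hm, hm0⟩ := N.ne_bot_iff.1 hN
  obtain ⟨w₁, hw₁⟩ := hb.exists_mem hreg N _ m hm hm0 le_rfl
  -- Inside the region 1 + r ≠ 0, so the formula for t_i can be solved for the neighbouring basis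
  -- vector.
  have hall : ∀ w, b w ∈ N := region_connected hw₁ fun w i h hw => by
    have h1 := (hb w).2 i h
    set r := c / formOf χ ((w : W)⁻¹ • simpleRoot i) with hr
    have hr0 : 1 + r ≠ 0 := by
      intro h0
      have hα := hf _ (smul_mem_roots (w : W)⁻¹ (simpleRoot_mem_roots i))
      refine notPole_of_mem_region w.2 h _ (Or.inr rfl) ?_
      rw [map_neg]
      rw [hr] at h0
      field_simp at h0
      linear_combination -h0
    have h2 : b ⟨simpleRefl i * (w : W), h⟩ =
        algebraMap ℂ (HeckeAlgebra c) (1 + r)⁻¹ • (heckeT c (simpleRefl i) • b w -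
          algebraMap ℂ (HeckeAlgebra c) r • b w) := by
      rw [h1, algebraMap_smul, algebraMap_smul, add_sub_cancel_left, smul_smul,
        inv_mul_cancel₀ hr0, one_smul]
    rw [h2]
    exact N.smul_mem _ (N.sub_mem (N.smul_mem _ hw) (N.smul_mem _ hw))
  rw [eq_top_iff]
  intro m _
  have := Fintype.ofFinite (regionOf c (formOf χ) J)
  rw [← b.sum_repr m]
  refine sum_mem fun w _ => ?_
  rw [← algebraMap_smul (HeckeAlgebra c)]
  exact N.smul_mem _ (hall w)

end Structure

/-! ### Linear forms with values in `ℤ[φ]` on the simple roots -/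

/-- The linear form with values `x` on the simple roots. -/
def formVec (x : GVec) : V₀ →ₗ[ℝ] ℝ :=
  ∑ i, ev (x.coord i) • dotProductBilin ℝ ℝ (fundWeight i)

lemma formVec_apply (x : GVec) (v : V₀) :
    formVec x v = ∑ i, ev (x.coord i) * (v ⬝ᵥ fundWeight i) := by
  simp [formVec, dotProduct_comm]

lemma formVec_simpleRoot (x : GVec) (i : Fin 4) : formVec x (simpleRoot i) = ev (x.coord i) := by
  simp [formVec_apply, simpleRoot_dot_fundWeight]

/-- The value of the form `x` at the vector with coordinates `y`. -/
def pair (x y : GVec) : GInt :=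
  ((x.x0.mul y.x0).add (x.x1.mul y.x1)).add ((x.x2.mul y.x2).add (x.x3.mul y.x3))

lemma formVec_toV (x y : GVec) : formVec x y.toV = ev (pair x y) := by
  simp only [formVec_apply, toV_dot_fundWeight, Fin.sum_univ_four, pair, ev_add, ev_mul]
  simp [GVec.coord]
  ring

/-- The action of `s_i` on linear forms. -/
def formReflect (i : Fin 4) (x : GVec) : GVec :=
  match i with
  | 0 => ⟨x.x0.neg, x.x1.add x.x0, x.x2, x.x3⟩
  | 1 => ⟨x.x0.add x.x1, x.x1.neg, x.x2.add x.x1, x.x3⟩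
  | 2 => ⟨x.x0, x.x1.add x.x2, x.x2.neg, x.x3.add x.x2.phi⟩
  | 3 => ⟨x.x0, x.x1, x.x2.add x.x3.phi, x.x3.neg⟩

lemma form_ext {ψ ψ' : V₀ →ₗ[ℝ] ℝ} (h : ∀ i, ψ (simpleRoot i) = ψ' (simpleRoot i)) : ψ = ψ' := by
  refine LinearMap.ext fun v => ?_
  rw [mem_span_simpleRoot v, map_sum, map_sum]
  exact Finset.sum_congr rfl fun i _ => by rw [map_smul, map_smul, h]

lemma formVec_formReflect (i : Fin 4) (x : GVec) (v : V₀) :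
    formVec (formReflect i x) v = formVec x (simpleRefl i • v) := by
  have : formVec (formReflect i x) =
      formVec x ∘ₗ ((simpleRefl i : W) : V₀ ≃ₗ[ℝ] V₀).toLinearMap := by
    refine form_ext fun k => ?_
    change _ = formVec x (simpleRefl i • simpleRoot k)
    rw [simpleRefl_smul, map_sub, map_smul, formVec_simpleRoot, formVec_simpleRoot,
      formVec_simpleRoot, simpleRoot_dot, smul_eq_mul]
    fin_cases i <;> fin_cases k <;> simp [formReflect, GVec.coord, cartanGInt] <;> ring
  rw [this]; rfl

/-- The product of a word in the simple reflections. -/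
def wordProd (l : List (Fin 4)) : W := (l.map simpleRefl).prod

lemma formVec_foldr (l : List (Fin 4)) (x : GVec) (v : V₀) :
    formVec (l.foldr formReflect x) v = formVec x ((wordProd l)⁻¹ • v) := by
  induction l generalizing v with
  | nil => simp [wordProd]
  | cons i l ih =>
    rw [List.foldr_cons, formVec_formReflect, ih, wordProd, wordProd, List.map_cons,
      List.prod_cons, mul_inv_rev, simpleRefl_inv, mul_smul]

lemma toV_foldr (l : List (Fin 4)) (y : GVec) :
    (l.foldr rootReflect y).toV = wordProd l • y.toV := by
  induction l with
  | nil => simp [wordProd]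
  | cons i l ih =>
    rw [List.foldr_cons, ← simpleRefl_toV, ih, wordProd, wordProd, List.map_cons, List.prod_cons,
      mul_smul]
    rfl

/-- The inner products of the fundamental weights. -/
lemma fundWeight_dot (x : GVec) :
    (formVec x (fundWeight 0) = ev (pair ⟨⟨2, 2⟩, ⟨3, 4⟩, ⟨4, 6⟩, ⟨3, 5⟩⟩ x) ∧
      formVec x (fundWeight 1) = ev (pair ⟨⟨3, 4⟩, ⟨6, 8⟩, ⟨8, 12⟩, ⟨6, 10⟩⟩ x)) ∧
    (formVec x (fundWeight 2) = ev (pair ⟨⟨4, 6⟩, ⟨8, 12⟩, ⟨12, 18⟩, ⟨9, 15⟩⟩ x) ∧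
      formVec x (fundWeight 3) = ev (pair ⟨⟨3, 5⟩, ⟨6, 10⟩, ⟨9, 15⟩, ⟨8, 12⟩⟩ x)) := by
  have h1 := ca_sq
  have h2 := sqrt_two_sq
  simp only [formVec_apply, Fin.sum_univ_four, pair, ev_add, ev_mul]
  refine ⟨⟨?_, ?_⟩, ?_, ?_⟩ <;>
    simp [GVec.coord, fundWeight, dotProduct, Fin.sum_univ_four] <;> ring_nf <;>
    simp only [h1, h2] <;> ring

/-- A sufficient criterion for `x < 0`, from two rational approximations of `φ`. -/
def GInt.isNeg (x : GInt) : Bool :=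
  Int.blt' (x.re * 5 + x.im * 8) 0 && Int.blt' (x.re * 8 + x.im * 13) 0

lemma GInt.ev_neg_of_isNeg {x : GInt} (h : x.isNeg = true) : ev x < 0 := by
  simp only [GInt.isNeg, Bool.and_eq_true, Int.blt'_eq_true] at h
  have h1 : (x.re : ℝ) * 5 + x.im * 8 < 0 := by exact_mod_cast h.1
  have h2 : (x.re : ℝ) * 8 + x.im * 13 < 0 := by exact_mod_cast h.2
  have hc := ca_sq
  have h0 := ca_pos
  have h3 : 0 < 13 - 16 * ca := by nlinarith
  have h4 : 0 < 10 * ca - 8 := by nlinarith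
  -- Linear interpolation in φ = 2 `ca` between 8/5 and 13/8; both weights are positive because 8/5
  -- < φ < 13/8.
  have : ev x = (13 - 16 * ca) * ((x.re : ℝ) * 5 + x.im * 8) +
      (10 * ca - 8) * ((x.re : ℝ) * 8 + x.im * 13) := by unfold ev; ring
  rw [this]
  nlinarith

/-- The criterion that the form `x` is negative on the fundamental weights. -/
def negOnWeights (x : GVec) : Bool :=
  (pair ⟨⟨2, 2⟩, ⟨3, 4⟩, ⟨4, 6⟩, ⟨3, 5⟩⟩ x).isNeg &&
    ((pair ⟨⟨3, 4⟩, ⟨6, 8⟩, ⟨8, 12⟩, ⟨6, 10⟩⟩ x).isNeg &&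
    ((pair ⟨⟨4, 6⟩, ⟨8, 12⟩, ⟨12, 18⟩, ⟨9, 15⟩⟩ x).isNeg &&
    (pair ⟨⟨3, 5⟩, ⟨6, 10⟩, ⟨9, 15⟩, ⟨8, 12⟩⟩ x).isNeg))

lemma formVec_fundWeight_neg {x : GVec} (h : negOnWeights x = true) (i : Fin 4) :
    formVec x (fundWeight i) < 0 := by
  simp only [negOnWeights, Bool.and_eq_true] at h
  obtain ⟨h0, h1, h2, h3⟩ := h
  obtain ⟨⟨e0, e1⟩, e2, e3⟩ := fundWeight_dot x
  fin_cases i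
  · exact e0 ▸ GInt.ev_neg_of_isNeg h0
  · exact e1 ▸ GInt.ev_neg_of_isNeg h1
  · exact e2 ▸ GInt.ev_neg_of_isNeg h2
  · exact e3 ▸ GInt.ev_neg_of_isNeg h3

/-! ### Enumeration of a tree given by its children -/

section Tree
variable {X : Type*} (ch : X → List X) (rank : X → ℕ)

/-- The vertices of depth less than `n` below `v`. -/
def subtree : ℕ → X → List X
  | 0, _ => []
  | n + 1, v => v :: (ch v).flatMap (subtree n)

variable {ch rank}

lemma mem_subtree_succ {n : ℕ} {u v : X} :
    u ∈ subtree ch (n + 1) v ↔ u = v ∨ ∃ w ∈ ch v, u ∈ subtree ch n w := by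
  simp [subtree]

lemma child_mem_subtree {u p : X} (h : u ∈ ch p) : ∀ {n : ℕ} {v : X}, p ∈ subtree ch n v →
    u ∈ subtree ch (n + 1) v
  | 0, _, hp => by simp [subtree] at hp
  | n + 1, v, hp => by
    rw [mem_subtree_succ]
    rcases mem_subtree_succ.1 hp with rfl | ⟨w, hw, hpw⟩
    · exact Or.inr ⟨u, h, by simp [subtree]⟩
    · exact Or.inr ⟨w, hw, child_mem_subtree h hpw⟩

lemma subtree_mono_succ {u : X} : ∀ {n : ℕ} {v : X}, u ∈ subtree ch n v →
    u ∈ subtree ch (n + 1) v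
  | 0, _, hp => by simp [subtree] at hp
  | n + 1, v, hp => by
    rw [mem_subtree_succ]
    rcases mem_subtree_succ.1 hp with rfl | ⟨w, hw, hpw⟩
    · exact Or.inl rfl
    · exact Or.inr ⟨w, hw, subtree_mono_succ hpw⟩

lemma subtree_mono {u v : X} {m n : ℕ} (h : m ≤ n) (hu : u ∈ subtree ch m v) :
    u ∈ subtree ch n v := by
  induction n, h using Nat.le_induction with
  | base => exact hu
  | succ n _ ih => exact subtree_mono_succ ih

lemma parent_mem_subtree {u : X} : ∀ {n : ℕ} {v : X}, u ∈ subtree ch n v →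
    u = v ∨ ∃ p, u ∈ ch p ∧ p ∈ subtree ch n v
  | 0, _, hp => by simp [subtree] at hp
  | n + 1, v, hp => by
    rcases mem_subtree_succ.1 hp with rfl | ⟨w, hw, hpw⟩
    · exact Or.inl rfl
    · right
      rcases parent_mem_subtree hpw with rfl | ⟨p, hup, hp⟩
      · exact ⟨v, hw, by simp [subtree]⟩
      · exact ⟨p, hup, mem_subtree_succ.2 (Or.inr ⟨w, hw, hp⟩)⟩

lemma rank_le_of_mem_subtree (hrank : ∀ v, ∀ u ∈ ch v, rank u = rank v + 1) {u : X} :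
    ∀ {n : ℕ} {v : X}, u ∈ subtree ch n v → rank v ≤ rank u
  | 0, _, hp => by simp [subtree] at hp
  | n + 1, v, hp => by
    rcases mem_subtree_succ.1 hp with rfl | ⟨w, hw, hpw⟩
    · exact le_rfl
    · have := rank_le_of_mem_subtree hrank hpw
      have := hrank v w hw
      omega

/-- Climb from the common descendant through unique parents; equal ranks make both climbs stop at
the same vertex. -/
lemma subtree_disjoint (hrank : ∀ v, ∀ u ∈ ch v, rank u = rank v + 1)
    (hpar : ∀ u v v', u ∈ ch v → u ∈ ch v' → v = v') : ∀ (k : ℕ) {n : ℕ} {u v v' : X}, rank u = k →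
      u ∈ subtree ch n v → u ∈ subtree ch n v' → rank v = rank v' → v = v' := by
  intro k
  induction k using Nat.strong_induction_on with
  | _ k ih =>
    intro n u v v' hk hu hu' hvv
    rcases parent_mem_subtree hu with rfl | ⟨p, hup, hp⟩
    · rcases parent_mem_subtree hu' with rfl | ⟨p', hup', hp'⟩
      · rfl
      · have := rank_le_of_mem_subtree hrank hp'
        have := hrank _ _ hup'
        omega
    · rcases parent_mem_subtree hu' with rfl | ⟨p', hup', hp'⟩
      · have := rank_le_of_mem_subtree hrank hp
        have := hrank _ _ hup
        omega
      · obtain rfl := hpar u p p' hup hup'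
        have := hrank _ _ hup
        exact ih (rank p) (by omega) rfl hp hp' hvv

lemma subtree_nodup (hrank : ∀ v, ∀ u ∈ ch v, rank u = rank v + 1)
    (hpar : ∀ u v v', u ∈ ch v → u ∈ ch v' → v = v') (hch : ∀ v, (ch v).Nodup) :
    ∀ (n : ℕ) (v : X), (subtree ch n v).Nodup
  | 0, _ => List.nodup_nil
  | n + 1, v => by
    rw [subtree, List.nodup_cons]
    refine ⟨fun h => ?_, ?_⟩
    · obtain ⟨w, hw, h⟩ := List.mem_flatMap.1 h
      have := rank_le_of_mem_subtree hrank h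
      have := hrank v w hw
      omega
    · rw [List.nodup_flatMap]
      refine ⟨fun w _ => subtree_nodup hrank hpar hch n w, ?_⟩
      refine List.Pairwise.imp_of_mem ?_ (hch v)
      intro w w' hw hw' hne u hu hu'
      refine hne (subtree_disjoint hrank hpar _ rfl hu hu' ?_)
      rw [hrank v w hw, hrank v w' hw']

end Tree

/-! ### The tree of a region -/

section RegionTree
variable {c : ℂ} {f : V₀ →ₗ[ℝ] ℂ} {J : Set V₀} {w₀ : W}

/-- Passing from u to s_i u changes only the signs of ±u⁻¹α_i, so membership is lost exactly when
one of these is a pole. -/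
lemma simpleRefl_mul_mem_region_iff {u : W} {i : Fin 4} (hu : u ∈ regionOf c f J)
    (hJ : ∀ β ∈ J, β ∈ roots ∧ f β = c) :
    simpleRefl i * u ∈ regionOf c f J ↔
      f (u⁻¹ • simpleRoot i) ≠ c ∧ f (u⁻¹ • simpleRoot i) ≠ -c := by
  constructor
  · refine fun h => ⟨notPole_of_mem_region hu h _ (Or.inl rfl), fun h' => ?_⟩
    exact notPole_of_mem_region hu h _ (Or.inr rfl) (by rw [map_neg, h', neg_neg])
  · rintro ⟨h1, h2⟩
    have key : ∀ β, (f β = c ∨ f β = -c) → u • β ∈ posRoots → (simpleRefl i * u) • β ∈ posRoots := by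
      intro β hβ hp
      rw [mul_smul]
      refine simpleRefl_pos hp i fun h => ?_
      rw [← h, inv_smul_smul] at h1 h2
      tauto
    refine ⟨fun β hβ => ?_, fun β hr hc hβ => key β (Or.inl hc) (hu.2 β hr hc hβ)⟩
    have := key (-β) (Or.inr (by rw [map_neg, (hJ β hβ).2]))
      (by rw [smul_neg]; exact hu.1 β hβ)
    rwa [smul_neg] at this

/-- `i` is a descent of `v`. -/
def IsDescent (v : W) (i : Fin 4) : Prop := -(v⁻¹ • simpleRoot i) ∈ posRoots

lemma isDescent_simpleRefl_mul {v : W} {i : Fin 4} :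
    IsDescent (simpleRefl i * v) i ↔ ¬ IsDescent v i := by
  rw [IsDescent, IsDescent, mul_inv_smul_simpleRoot, neg_neg]
  constructor
  · exact neg_notMem_posRoots
  · exact (pos_or_neg_smul v⁻¹ (simpleRoot_mem_roots i)).resolve_right

/-- The condition that `s_i v` is a child of `v`: its first descent is `i`. -/
def IsChildIndex (c : ℂ) (f : V₀ →ₗ[ℝ] ℂ) (J : Set V₀) (w₀ v : W) (i : Fin 4) : Prop :=
  ¬ IsDescent v i ∧ simpleRefl i * (v * w₀) ∈ regionOf c f J ∧
    ∀ k < i, ¬ IsDescent (simpleRefl i * v) k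

open Classical in
/-- The children of `v` in the spanning tree of the region. -/
def children (c : ℂ) (f : V₀ →ₗ[ℝ] ℂ) (J : Set V₀) (w₀ v : W) : List W :=
  ([0, 1, 2, 3].filter (IsChildIndex c f J w₀ v)).map (simpleRefl · * v)

lemma mem_children {u v : W} : u ∈ children c f J w₀ v ↔
    ∃ i, IsChildIndex c f J w₀ v i ∧ u = simpleRefl i * v := by
  simp only [children, List.mem_map, List.mem_filter, decide_eq_true_eq]
  constructor
  · rintro ⟨i, ⟨-, h⟩, rfl⟩; exact ⟨i, h, rfl⟩
  · rintro ⟨i, h, rfl⟩; exact ⟨i, ⟨by fin_cases i <;> simp, h⟩, rfl⟩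

lemma len_of_mem_children (v : W) : ∀ u ∈ children c f J w₀ v, len u = len v + 1 := by
  intro u hu
  obtain ⟨i, h, rfl⟩ := mem_children.1 hu
  exact len_up ((pos_or_neg_smul v⁻¹ (simpleRoot_mem_roots i)).resolve_right h.1)

lemma simpleRoot_injective : Function.Injective simpleRoot := by
  intro i k h
  by_contra hne
  have h1 := simpleRoot_dot_fundWeight i i
  have h2 := simpleRoot_dot_fundWeight i k
  rw [← h, h1, if_pos rfl, if_neg hne] at h2
  exact one_ne_zero h2

lemma simpleRefl_injective : Function.Injective simpleRefl := by
  intro i k h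
  have h1 : simpleRefl i • simpleRoot i = simpleRefl k • simpleRoot i := by rw [h]
  by_contra hne
  have h2 := simpleRefl_pos (simpleRoot_mem_posRoots i) k fun h' => hne (simpleRoot_injective h')
  rw [smul_eq_apply, ← h1, simpleRefl_smul_simpleRoot] at h2
  exact neg_notMem_posRoots (simpleRoot_mem_posRoots i) h2

lemma children_nodup (v : W) : (children c f J w₀ v).Nodup := by
  refine List.Nodup.map (fun i k h => simpleRefl_injective (mul_right_cancel h)) ?_
  exact List.Nodup.filter _ (by decide)

/-- The edge label is the first descent of u, hence determined by u. -/
lemma parent_unique (u v v' : W) (h : u ∈ children c f J w₀ v) (h' : u ∈ children c f J w₀ v') :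
    v = v' := by
  obtain ⟨i, hi, rfl⟩ := mem_children.1 h
  obtain ⟨k, hk, e⟩ := mem_children.1 h'
  have hik : i = k := by
    rcases lt_trichotomy i k with hlt | rfl | hlt
    · exact absurd (isDescent_simpleRefl_mul.2 hi.1) (e ▸ hk.2.2 i hlt)
    · rfl
    · exact absurd (isDescent_simpleRefl_mul.2 hk.1) (e ▸ hi.2.2 k hlt)
  subst hik
  exact mul_left_cancel e

/-- Removing the first descent i stays in the region: a root positive at w₀ and u w₀ but negative at
s_i u w₀ would satisfy u w₀ β = α_i, so w₀ β = u⁻¹α_i would be negative. -/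
lemma exists_parent (hw₀ : w₀ ∈ regionOf c f J) {u : W} (hu : u * w₀ ∈ regionOf c f J)
    (h1 : u ≠ 1) : ∃ v, v * w₀ ∈ regionOf c f J ∧ u ∈ children c f J w₀ v := by
  classical
  have hex : ∃ i, IsDescent u i := exists_down h1
  obtain ⟨i, hi, hmin⟩ := WellFounded.has_min (wellFounded_lt (α := Fin 4)) {i | IsDescent u i} hex
  have hi' : -(u⁻¹ • simpleRoot i) ∈ posRoots := hi
  have key : ∀ β, w₀ • β ∈ posRoots → (u * w₀) • β ∈ posRoots →
      (simpleRefl i * u * w₀) • β ∈ posRoots := by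
    intro β hβ hβ'
    rw [mul_assoc, mul_smul]
    refine simpleRefl_pos hβ' i fun h => ?_
    rw [mul_smul] at h
    rw [← h, inv_smul_smul] at hi'
    exact neg_notMem_posRoots hβ hi'
  refine ⟨simpleRefl i * u, ⟨fun β hβ => ?_, fun β h1 h2 h3 => key β (hw₀.2 β h1 h2 h3)
    (hu.2 β h1 h2 h3)⟩, mem_children.2 ⟨i, ⟨?_, ?_, ?_⟩, (simpleRefl_mul_cancel i u).symm⟩⟩
  · have := key (-β) (by rw [smul_neg]; exact hw₀.1 β hβ) (by rw [smul_neg]; exact hu.1 β hβ)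
    rwa [smul_neg] at this
  · rw [isDescent_simpleRefl_mul, not_not]; exact hi
  · rwa [mul_assoc, simpleRefl_mul_cancel]
  · intro k hk
    rw [simpleRefl_mul_cancel]
    exact fun h => hmin k h hk

lemma mem_subtree_of_mem_region (hw₀ : w₀ ∈ regionOf c f J) : ∀ (n : ℕ) (u : W), len u = n →
    u * w₀ ∈ regionOf c f J → u ∈ subtree (children c f J w₀) (n + 1) 1 := by
  intro n
  induction n with
  | zero => intro u hn _; rw [len_eq_zero hn]; simp [subtree]
  | succ n ih =>
    intro u hn hu
    obtain ⟨v, hv, huv⟩ := exists_parent hw₀ hu (by rintro rfl; simp [len_one] at hn)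
    have := len_of_mem_children v u huv
    exact child_mem_subtree huv (ih v (by omega) hv)

lemma mem_region_of_mem_subtree : ∀ (n : ℕ) (u v : W), v * w₀ ∈ regionOf c f J →
    u ∈ subtree (children c f J w₀) n v → u * w₀ ∈ regionOf c f J
  | 0, _, _, _, h => by simp [subtree] at h
  | n + 1, u, v, hv, h => by
    rcases mem_subtree_succ.1 h with rfl | ⟨w, hw, h⟩
    · exact hv
    · obtain ⟨i, hi, rfl⟩ := mem_children.1 hw
      exact mem_region_of_mem_subtree n u _ (by rw [mul_assoc]; exact hi.2.1) h

/-- Bounds the depth of the tree: 61 levels, for the lengths 0 to 60. -/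
lemma len_le (u : W) : len u ≤ 60 := by
  have h1 : posRoots = toV '' {x | x ∈ posList} := by
    ext v; rw [posRoots_iff]; exact ⟨fun ⟨x, h, e⟩ => ⟨x, h, e.symm⟩, fun ⟨x, h, e⟩ => ⟨x, h, e.symm⟩⟩
  have hfin : {x | x ∈ posList}.Finite := posList.finite_toSet
  have h2 : inversionSet u ⊆ posRoots := fun _ h => h.1
  have h3 : posRoots.Finite := roots_finite.subset fun _ h => h.1
  have h4 : {x | x ∈ posList}.ncard ≤ posList.length := by
    classical
    have : ({x | x ∈ posList} : Set GVec) = (posList.toFinset : Set GVec) := by ext; simp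
    rw [this, Set.ncard_coe_finset]
    exact posList.toFinset_card_le
  calc len u ≤ posRoots.ncard := Set.ncard_le_ncard h2 h3
    _ ≤ {x | x ∈ posList}.ncard := by rw [h1]; exact Set.ncard_image_le hfin
    _ ≤ 60 := h4

/-- The spanning tree enumerates the region. -/
lemma mem_subtree_iff (hw₀ : w₀ ∈ regionOf c f J) (u : W) :
    u ∈ subtree (children c f J w₀) 61 1 ↔ u * w₀ ∈ regionOf c f J := by
  constructor
  · exact mem_region_of_mem_subtree 61 u 1 (by rwa [one_mul])
  · intro h
    exact subtree_mono (Nat.succ_le_succ (len_le u)) (mem_subtree_of_mem_region hw₀ _ u rfl h)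

lemma card_region (hw₀ : w₀ ∈ regionOf c f J) :
    Nat.card (regionOf c f J) = (subtree (children c f J w₀) 61 1).length := by
  classical
  have hnd := subtree_nodup (rank := len) (ch := children c f J w₀) len_of_mem_children
    parent_unique children_nodup 61 1
  rw [← List.toFinset_card_of_nodup hnd, Nat.card_coe_set_eq, ← Set.ncard_coe_finset]
  refine (Set.ncard_congr (fun u _ => u * w₀) ?_ ?_ ?_).symm
  · intro u hu
    rw [List.coe_toFinset] at hu
    exact (mem_subtree_iff hw₀ u).1 hu
  · intro u v _ _ h
    exact mul_right_cancel h
  · intro w hw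
    refine ⟨w * w₀⁻¹, ?_, inv_mul_cancel_right w w₀⟩
    rw [List.coe_toFinset]
    refine (mem_subtree_iff hw₀ _).2 ?_
    rwa [inv_mul_cancel_right]

end RegionTree

/-! ### Counting a region by kernel computation

The `force` functions make the kernel evaluate their first argument before passing it on. -/

def forceNat {α : Type} (n : ℕ) (k : ℕ → α) : α := Nat.rec (k 0) (fun n _ => k (Nat.succ n)) n

def forceInt {α : Type} (n : ℤ) (k : ℤ → α) : α :=
  Int.rec (fun m => forceNat m fun m => k (.ofNat m)) (fun m => forceNat m fun m => k (.negSucc m)) n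

def forceGInt {α : Type} (x : GInt) (k : GInt → α) : α :=
  forceInt x.re fun a => forceInt x.im fun b => k ⟨a, b⟩

def forceGVec {α : Type} (x : GVec) (k : GVec → α) : α :=
  forceGInt x.x0 fun a => forceGInt x.x1 fun b => forceGInt x.x2 fun c => forceGInt x.x3 fun d =>
    k ⟨a, b, c, d⟩

lemma forceNat_eq {α : Type} (n : ℕ) (k : ℕ → α) : forceNat n k = k n := by cases n <;> rfl

lemma forceInt_eq {α : Type} (n : ℤ) (k : ℤ → α) : forceInt n k = k n := by
  cases n with
  | ofNat m => exact forceNat_eq m fun m => k (.ofNat m)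
  | negSucc m => exact forceNat_eq m fun m => k (.negSucc m)

lemma forceGVec_eq {α : Type} (x : GVec) (k : GVec → α) : forceGVec x k = k x := by
  simp only [forceGVec, forceGInt, forceInt_eq]

/-- The values `±2` of `4 χ` on simple roots, at which one leaves a region. -/
def onWall (x : GInt) : Bool := x.im.beq' 0 && (x.re.beq' 2 || x.re.beq' (-2))

lemma onWall_iff {x : GInt} : onWall x = true ↔ x = ⟨2, 0⟩ ∨ x = ⟨-2, 0⟩ := by
  simp only [onWall, Bool.and_eq_true, Bool.or_eq_true, Int.beq'_eq, GInt.ext_iff]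
  tauto

/-- Whether `s_i` leads to a child, where `x` holds the values of the character on the simple
roots and `z` those of a form detecting descents. -/
def childTest (i : Fin 4) (x z : GVec) : Bool :=
  match i with
  | 0 => !z.x0.isNonneg && !onWall x.x0
  | 1 => !z.x1.isNonneg && (!onWall x.x1 && !(z.x0.add z.x1).isNonneg)
  | 2 => !z.x2.isNonneg && (!onWall x.x2 && (!z.x0.isNonneg && !(z.x1.add z.x2).isNonneg))
  | 3 => !z.x3.isNonneg && (!onWall x.x3 && (!z.x0.isNonneg && (!z.x1.isNonneg &&
      !(z.x2.add z.x3.phi).isNonneg)))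

/-- The sums in `childTest` are the coordinates k < i of the reflected form, computed without
reflecting. -/
lemma childTest_iff (i : Fin 4) (x z : GVec) : childTest i x z = true ↔
    ¬ (z.coord i).isNonneg = true ∧ ¬ onWall (x.coord i) = true ∧
      ∀ k < i, ¬ ((formReflect i z).coord k).isNonneg = true := by
  fin_cases i <;> simp [childTest, formReflect, GVec.coord, Fin.forall_fin_succ]

/-- The size of the tree below the vertex given by `x` and `z`; it is at least `1000` if the form
`x` fails to be negative on the fundamental weights at some vertex. -/
def treeCount (n : ℕ) : GVec → GVec → ℕ :=
  n.rec (fun _ _ => 0) fun _ ih x z => forceGVec x fun x => forceGVec z fun z =>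
    bif negOnWeights x then
      1 + (bif childTest 0 x z then ih (formReflect 0 x) (formReflect 0 z) else 0) +
        (bif childTest 1 x z then ih (formReflect 1 x) (formReflect 1 z) else 0) +
        (bif childTest 2 x z then ih (formReflect 2 x) (formReflect 2 z) else 0) +
        (bif childTest 3 x z then ih (formReflect 3 x) (formReflect 3 z) else 0)
    else 1000

lemma treeCount_succ (n : ℕ) (x z : GVec) : treeCount (n + 1) x z =
    bif negOnWeights x then
      1 + ([0, 1, 2, 3].map fun i => bif childTest i x z then
        treeCount n (formReflect i x) (formReflect i z) else 0).sum
    else 1000 := by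
  have : treeCount (n + 1) x z = forceGVec x fun x => forceGVec z fun z =>
    bif negOnWeights x then
      1 + (bif childTest 0 x z then treeCount n (formReflect 0 x) (formReflect 0 z) else 0) +
        (bif childTest 1 x z then treeCount n (formReflect 1 x) (formReflect 1 z) else 0) +
        (bif childTest 2 x z then treeCount n (formReflect 2 x) (formReflect 2 z) else 0) +
        (bif childTest 3 x z then treeCount n (formReflect 3 x) (formReflect 3 z) else 0)
    else 1000 := rfl
  rw [this, forceGVec_eq, forceGVec_eq]
  simp only [List.map_cons, List.map_nil, List.sum_cons, List.sum_nil, add_zero, ← add_assoc]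

lemma exists_eq_of_mem_roots {v : V₀} (h : v ∈ posRoots) :
    ∃ y : GVec, v = y.toV ∧ (∀ k, 0 ≤ (y.coord k).re ∧ 0 ≤ (y.coord k).im) ∧
      (0 < (y.x0.add (y.x1.add (y.x2.add y.x3))).re ∨
        0 < (y.x0.add (y.x1.add (y.x2.add y.x3))).im) := by
  obtain ⟨y, hy, rfl⟩ := (posRoots_iff _).1 h
  refine ⟨y, rfl, coord_nonneg_of_mem hy, ?_⟩
  have := posList_nonneg
  simp only [List.all_eq_true, Bool.and_eq_true, Int.blt'_eq_true] at this
  have := (this y hy).2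
  simp only [GInt.add]
  omega

lemma toV_dot_rho (y : GVec) :
    y.toV ⬝ᵥ rho = ev (y.x0.add (y.x1.add (y.x2.add y.x3))) := by
  simp [toV, add_dotProduct, smul_dotProduct, simpleRoot_dot_rho]
  ring

/-- The height of a positive root has nonnegative integer parts, not both zero, so integer signs
separate positive from negative roots. -/
lemma isDescent_iff {v : W} {x : GInt} {i : Fin 4}
    (h : ev x = -((v⁻¹ • simpleRoot i) ⬝ᵥ rho)) : IsDescent v i ↔ x.isNonneg = true := by
  rw [GInt.isNonneg_iff]
  constructor
  · intro hd
    obtain ⟨y, e, hn, -⟩ := exists_eq_of_mem_roots hd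
    rw [← neg_dotProduct, e, toV_dot_rho] at h
    rw [ev_injective h]
    have := hn 0; have := hn 1; have := hn 2; have := hn 3
    simp [GVec.coord, GInt.add] at *
    omega
  · intro hx
    refine (pos_or_neg_smul v⁻¹ (simpleRoot_mem_roots i)).resolve_left fun hp => ?_
    obtain ⟨y, e, hn, hpos⟩ := exists_eq_of_mem_roots hp
    rw [e, toV_dot_rho, ← ev_neg] at h
    rw [ev_injective h] at hx
    simp only [GInt.neg] at hx
    omega

lemma quarter_ev_eq_iff (x : GInt) {g : GInt} {r : ℝ} (hg : ev g = 4 * r) :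
    ((ev x / 4 : ℝ) : ℂ) = (r : ℂ) ↔ x = g := by
  rw [Complex.ofReal_inj, ← ev_injective.eq_iff, hg]
  constructor <;> intro h <;> linarith

section Count
variable {c : ℂ} {f : V₀ →ₗ[ℝ] ℂ} {J : Set V₀} {w₀ : W} {ψ : V₀ →ₗ[ℝ] ℝ}

/-- `x` and `z` describe the vertex `v`. -/
structure Tracks (ψ : V₀ →ₗ[ℝ] ℝ) (w₀ v : W) (x z : GVec) : Prop where
  form : ∀ u, formVec x u = ψ ((v * w₀)⁻¹ • u)
  height : ∀ u, formVec z u = -((v⁻¹ • u) ⬝ᵥ rho)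

lemma Tracks.formReflect {v : W} {x z : GVec} (h : Tracks ψ w₀ v x z) (i : Fin 4) :
    Tracks ψ w₀ (simpleRefl i * v) (formReflect i x) (formReflect i z) := by
  constructor <;> intro u
  · rw [formVec_formReflect, h.form, mul_assoc, mul_inv_rev (simpleRefl i), mul_smul, simpleRefl_inv]
  · rw [formVec_formReflect, h.height, mul_inv_rev, mul_smul, simpleRefl_inv]

lemma Tracks.isDescent_iff {v : W} {x z : GVec} (h : Tracks ψ w₀ v x z) (i : Fin 4) :
    IsDescent v i ↔ (z.coord i).isNonneg = true :=
  HeckeH4.isDescent_iff (by rw [← formVec_simpleRoot, h.height])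

lemma Tracks.isChildIndex_iff {v : W} {x z : GVec} (h : Tracks ψ w₀ v x z)
    (hv : v * w₀ ∈ regionOf (1 / 2) f J) (hJ : ∀ β ∈ J, β ∈ roots ∧ f β = 1 / 2)
    (hf : ∀ u, f u = ((ψ u / 4 : ℝ) : ℂ)) (i : Fin 4) :
    IsChildIndex (1 / 2) f J w₀ v i ↔ childTest i x z = true := by
  have hwall : simpleRefl i * (v * w₀) ∈ regionOf (1 / 2) f J ↔ ¬ onWall (x.coord i) = true := by
    rw [simpleRefl_mul_mem_region_iff hv hJ, hf, ← h.form, formVec_simpleRoot, onWall_iff, not_or]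
    -- As f = ψ/4 and c = 1/2, the walls are at ψ = ±2.
    have e1 := quarter_ev_eq_iff (x.coord i) (g := ⟨2, 0⟩) (r := 1 / 2) (by norm_num [ev])
    have e2 := quarter_ev_eq_iff (x.coord i) (g := ⟨-2, 0⟩) (r := -(1 / 2)) (by norm_num [ev])
    push_cast at e1 e2
    push_cast
    rw [Ne, Ne, e1, e2]
  rw [IsChildIndex, childTest_iff, hwall, h.isDescent_iff]
  simp only [(h.formReflect i).isDescent_iff]

lemma length_flatMap_filter {X Y : Type*} (p : X → Bool) (g : X → List Y) (l : List X) :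
    ((l.filter p).flatMap g).length = (l.map fun i => bif p i then (g i).length else 0).sum := by
  induction l with
  | nil => rfl
  | cons a l ih => cases h : p a <;> simp [h] <;> simpa using ih

/-- The kernel computation `treeCount` counts the vertices of the tree of a region, and certifies
a negativity property at each of them. -/
lemma treeCount_spec (hJ : ∀ β ∈ J, β ∈ roots ∧ f β = 1 / 2)
    (hf : ∀ u, f u = ((ψ u / 4 : ℝ) : ℂ)) : ∀ (n : ℕ) (v : W) (x z : GVec), Tracks ψ w₀ v x z →
      v * w₀ ∈ regionOf (1 / 2) f J → treeCount n x z < 1000 →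
      (subtree (children (1 / 2) f J w₀) n v).length = treeCount n x z ∧
        ∀ u ∈ subtree (children (1 / 2) f J w₀) n v, ∀ i, ψ ((u * w₀)⁻¹ • fundWeight i) < 0 := by
  classical
  intro n
  induction n with
  | zero => intro v x z _ _ _; exact ⟨rfl, fun u hu => by simp [subtree] at hu⟩
  | succ n ih =>
    intro v x z h hv hlt
    rw [treeCount_succ] at hlt ⊢
    cases hneg : negOnWeights x with
    | false => rw [hneg] at hlt; simp at hlt
    | true =>
      rw [hneg, cond_true] at hlt
      have hch : children (1 / 2) f J w₀ v =
          ([0, 1, 2, 3].filter fun i => childTest i x z).map (simpleRefl · * v) := by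
        rw [children]
        congr 1
        refine List.filter_congr fun i _ => ?_
        rw [Bool.eq_iff_iff, decide_eq_true_iff]
        exact h.isChildIndex_iff hv hJ hf i
      have hi : ∀ i, childTest i x z = true →
          (subtree (children (1 / 2) f J w₀) n (simpleRefl i * v)).length =
            treeCount n (formReflect i x) (formReflect i z) ∧
          ∀ u ∈ subtree (children (1 / 2) f J w₀) n (simpleRefl i * v), ∀ k,
            ψ ((u * w₀)⁻¹ • fundWeight k) < 0 := by
        intro i hi
        refine ih _ _ _ (h.formReflect i) ?_ ?_
        · rw [mul_assoc]; exact ((h.isChildIndex_iff hv hJ hf i).2 hi).2.1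
        · refine lt_of_le_of_lt ?_ hlt
          refine le_trans ?_ (Nat.le_add_left _ _)
          refine List.single_le_sum (fun _ _ => Nat.zero_le _) _ (List.mem_map.2 ⟨i, ?_, by simp [hi]⟩)
          fin_cases i <;> simp
      constructor
      · rw [cond_true, subtree, List.length_cons, hch, List.flatMap_map, length_flatMap_filter,
          add_comm]
        congr 2
        refine List.map_congr_left fun i _ => ?_
        cases hc : childTest i x z with
        | false => rfl
        | true => exact (hi i hc).1
      · intro u hu
        rcases mem_subtree_succ.1 hu with rfl | ⟨w, hw, hu⟩
        · intro i
          rw [← h.form]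
          exact formVec_fundWeight_neg hneg i
        · rw [hch, List.mem_map] at hw
          obtain ⟨i, hi', rfl⟩ := hw
          exact (hi i (List.mem_filter.1 hi').2).2 u hu

end Count

/-! ### The rows of the table -/

def gvec (a b c d e f g h : ℤ) : GVec := ⟨⟨a, b⟩, ⟨c, d⟩, ⟨e, f⟩, ⟨g, h⟩⟩

/-- The values of `4 χ_j` on the simple roots. -/
def charVec : Fin 12 → GVec :=
  ![gvec 2 0 2 0 2 0 2 0, gvec 4 (-2) (-2) 2 4 (-2) 4 (-2), gvec 2 0 (-2) 2 4 (-2) 4 (-2),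
    gvec 2 0 2 0 4 (-2) 4 (-2), gvec (-2) 2 10 (-6) (-6) 4 4 (-2),
    gvec (-8) 6 10 (-6) (-6) 4 4 (-2), gvec 2 0 10 (-6) (-6) 4 4 (-2),
    gvec 10 (-6) 10 (-6) (-16) 10 4 (-2), gvec (-3) 2 2 (-1) 2 (-1) (-3) 2,
    gvec 10 (-6) (-6) 4 10 (-6) 10 (-6), gvec 10 (-6) (-16) 10 10 (-6) 10 (-6),
    gvec (-16) 10 26 (-16) (-6) 4 26 (-16)]

def eps1Vec : GVec := gvec 0 0 1 0 1 0 0 1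
def eps2Vec : GVec := gvec 0 0 0 1 1 1 0 1
def eps3Vec : GVec := gvec 0 0 0 0 0 1 0 1

/-- The coordinates of the roots in the table. -/
def rowVec : Fin 12 → Fin 4 → GVec :=
  ![![gvec 1 0 0 0 0 0 0 0, gvec 0 0 1 0 0 0 0 0, gvec 0 0 0 0 1 0 0 0, gvec 0 0 0 0 0 0 1 0],
    ![gvec 1 0 1 0 0 0 0 0, gvec 0 0 1 0 1 0 0 0, gvec 0 0 0 0 1 0 0 1, gvec 0 0 0 0 0 1 1 0],
    ![gvec 1 0 0 0 0 0 0 0, gvec 0 0 1 0 1 0 0 0, gvec 0 0 0 0 1 0 0 1, gvec 0 0 0 0 0 1 1 0],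
    ![gvec 1 0 0 0 0 0 0 0, gvec 0 0 1 0 0 0 0 0, gvec 0 0 0 0 1 0 0 1, gvec 0 0 0 0 0 1 1 0],
    ![gvec 1 0 1 0 1 0 0 0, eps1Vec, gvec 0 0 0 1 0 1 1 0, eps3Vec],
    ![gvec 1 0 1 0 0 0 0 0, eps1Vec, gvec 0 0 0 1 0 1 1 0, eps3Vec],
    ![gvec 1 0 0 0 0 0 0 0, eps1Vec, gvec 0 0 0 1 0 1 1 0, eps3Vec],
    ![gvec 1 0 1 0 1 0 0 1, gvec 0 0 0 1 0 1 0 1, gvec 0 1 0 1 0 1 1 0, gvec 0 0 1 0 1 1 0 1],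
    ![gvec 0 1 0 1 0 1 0 1, gvec 1 0 1 0 1 1 0 1, gvec 0 0 1 0 1 1 1 1, eps2Vec],
    ![gvec 0 1 0 1 0 1 1 0, gvec 0 0 1 0 1 1 1 1, eps2Vec, gvec 1 0 1 0 1 1 0 1],
    ![gvec 0 1 0 1 1 1 0 1, gvec 1 0 1 1 1 1 0 1, gvec 1 0 1 0 1 1 1 1, gvec 0 0 0 1 0 2 1 1],
    ![gvec 0 1 1 1 1 1 0 1, gvec 0 1 0 1 1 1 1 1, gvec 1 0 1 1 1 1 1 1, gvec 0 0 0 1 0 2 1 1]]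

lemma toV_gvec (a b c d e f g h : ℤ) : (gvec a b c d e f g h).toV =
    comb (a + b * (2 * ca)) (c + d * (2 * ca)) (e + f * (2 * ca)) (g + h * (2 * ca)) := rfl

lemma toV_eps1Vec : eps1Vec.toV = eps1 := by
  ext i
  rw [toV_apply]
  fin_cases i <;> simp [eps1Vec, eps1, gvec, std, GVec.coord, GInt.ev, GInt.add, GInt.neg, GInt.phi,
    GInt.phiInv]

lemma toV_eps2Vec : eps2Vec.toV = eps2 := by
  ext i
  rw [toV_apply]
  fin_cases i <;> simp [eps2Vec, eps2, gvec, std, GVec.coord, GInt.ev, GInt.add, GInt.neg, GInt.phi,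
    GInt.phiInv]

lemma toV_eps3Vec : eps3Vec.toV = eps3 := by
  ext i
  rw [toV_apply]
  fin_cases i <;> simp [eps3Vec, eps3, gvec, std, GVec.coord, GInt.ev, GInt.add, GInt.neg, GInt.phi,
    GInt.phiInv]

lemma toV_rowVec (j : Fin 12) (k : Fin 4) : (rowVec j k).toV = tableRoots j k := by
  have e1 : ∀ x : ℝ, 2 * (2 * x) = 4 * x := fun x => by ring
  fin_cases j <;> fin_cases k <;>
    simp [rowVec, tableRoots, toV_gvec, toV_eps1Vec, toV_eps2Vec, toV_eps3Vec, add_comm, e1]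

/-- A word for a base point of the region of row `j`. -/
def baseWord (j : Fin 12) : List (Fin 4) :=
  -- The Coxeter number is 30, so the 15th power of the Coxeter element is the longest element -1,
  -- which serves the rows with all signs negative. In the other rows the prefix, acting after it,
  -- makes the one required root positive again.
  (![[], [], [3, 2], [], [], [2, 3, 1], [], [], [], [2, 3, 1, 2, 0], [2, 3, 1, 2, 1, 0], []] :
    Fin 12 → List (Fin 4)) j ++ (List.replicate 15 [0, 1, 2, 3]).flatten

/-- Two by two minors. -/
def minor (a b c d : GInt) : GInt := (a.mul d).add (b.mul c).neg

/-- The determinant of the matrix with rows `x`, `y`, `z`, `t`. -/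
def detVec (x y z t : GVec) : GInt :=
  ((((minor x.x0 x.x1 y.x0 y.x1).mul (minor z.x2 z.x3 t.x2 t.x3)).add
    ((minor x.x0 x.x2 y.x0 y.x2).mul (minor z.x1 z.x3 t.x1 t.x3)).neg).add
  (((minor x.x0 x.x3 y.x0 y.x3).mul (minor z.x1 z.x2 t.x1 t.x2)).add
    ((minor x.x1 x.x2 y.x1 y.x2).mul (minor z.x0 z.x3 t.x0 t.x3)))).add
  (((minor x.x1 x.x3 y.x1 y.x3).mul (minor z.x0 z.x2 t.x0 t.x2)).neg.add
    ((minor x.x2 x.x3 y.x2 y.x3).mul (minor z.x0 z.x1 t.x0 t.x1)))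

lemma ev_detVec (r : Fin 4 → GVec) : ev (detVec (r 0) (r 1) (r 2) (r 3)) =
    Matrix.det (Matrix.of fun k i => ev ((r k).coord i)) := by
  simp [detVec, minor, Matrix.det_succ_row_zero, Fin.sum_univ_succ, Fin.succAbove, GVec.coord]
  ring

/-- The values of `4 χ_j` at the positive roots: never `0` or `-2`, and `2` exactly at the roots
in row `j`. -/
lemma pair_charVec : ∀ j, (posList.all fun y =>
    !(pair (charVec j) y).beq ⟨0, 0⟩ && (!(pair (charVec j) y).beq ⟨-2, 0⟩ &&
      (pair (charVec j) y).beq ⟨2, 0⟩ == [0, 1, 2, 3].any fun k => y.beq (rowVec j k))) = true := by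
  decide +kernel

lemma rowVec_mem : ∀ j k, (rowVec j k).mem posList = true := by
  decide +kernel

lemma rowVec_beq : ∀ j k k', (rowVec j k).beq (rowVec j k') = decide (k = k') := by
  decide +kernel

lemma foldr_rowVec : ∀ j k,
    (tableSigns j k = 1 ∧ ((baseWord j).foldr rootReflect (rowVec j k)).mem posList = true) ∨
    (tableSigns j k = -1 ∧
      ((baseWord j).foldr rootReflect (rowVec j k)).neg.mem posList = true) := by
  decide +kernel

lemma detVec_rowVec : ∀ j,
    (detVec (rowVec j 0) (rowVec j 1) (rowVec j 2) (rowVec j 3)).beq ⟨0, 0⟩ = false := by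
  decide +kernel

/-- The main computation. It gives the dimensions, and since these are below 1000 it also certifies
that every weight met passed the negativity test. -/
lemma treeCount_charVec : ∀ j, treeCount 61 ((baseWord j).foldr formReflect (charVec j))
    (gvec (-1) 0 (-1) 0 (-1) 0 (-1) 0) = tableDims j := by
  decide +kernel


/-! ### The characters and regions of the table -/

/-- The character `χ_j`. -/
def tableChar (j : Fin 12) : Module.Dual ℂ V :=
  Module.Dual.baseChange ℂ ((1 / 4 : ℝ) • formVec (charVec j))

lemma formOf_tableChar (j : Fin 12) (v : V₀) :
    formOf (tableChar j) v = ((formVec (charVec j) v / 4 : ℝ) : ℂ) := by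
  simp [formOf_apply, tableChar, incl, Module.Dual.baseChange_apply_tmul]
  ring

lemma mem_any_rowVec {j : Fin 12} {y : GVec} :
    ([0, 1, 2, 3].any fun k => y.beq (rowVec j k)) = true ↔ y.toV ∈ Set.range (tableRoots j) := by
  simp only [List.any_eq_true, GVec.beq_iff]
  constructor
  · rintro ⟨k, -, rfl⟩
    exact ⟨k, (toV_rowVec j k).symm⟩
  · rintro ⟨k, h⟩
    refine ⟨k, by fin_cases k <;> simp, ?_⟩
    rw [← toV_rowVec] at h
    have e : ∀ i, y.coord i = (rowVec j k).coord i := fun i => ev_injective (by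
      rw [← toV_dot_fundWeight, ← toV_dot_fundWeight, h])
    exact GVec.ext (e 0) (e 1) (e 2) (e 3)

lemma formVec_charVec (j : Fin 12) {γ : V₀} (hγ : γ ∈ posRoots) :
    formVec (charVec j) γ ≠ 0 ∧ formVec (charVec j) γ ≠ -2 ∧
      (formVec (charVec j) γ = 2 ↔ γ ∈ Set.range (tableRoots j)) := by
  obtain ⟨y, hy, rfl⟩ := (posRoots_iff _).1 hγ
  have h := List.all_eq_true.1 (pair_charVec j) y hy
  rw [Bool.and_eq_true, Bool.and_eq_true, Bool.not_eq_true', Bool.not_eq_true', beq_iff_eq,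
    ← Bool.not_eq_true, ← Bool.not_eq_true, GInt.beq_iff, GInt.beq_iff] at h
  have h2 := Bool.eq_iff_iff.1 h.2.2
  rw [GInt.beq_iff, mem_any_rowVec] at h2
  rw [formVec_toV]
  have e0 : (0 : ℝ) = ev ⟨0, 0⟩ := by simp
  have e1 : (-2 : ℝ) = ev ⟨-2, 0⟩ := by simp
  have e2 : (2 : ℝ) = ev ⟨2, 0⟩ := by simp
  rw [e2, ev_injective.eq_iff, ← e2, e1, ev_injective.ne_iff, e0, ev_injective.ne_iff]
  exact ⟨h.1, h.2.1, h2⟩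

lemma formVec_charVec_ne_zero (j : Fin 12) : ∀ γ ∈ roots, formVec (charVec j) γ ≠ 0 := by
  intro γ hγ
  rcases pos_or_neg hγ with h | h
  · exact (formVec_charVec j h).1
  · simpa using (formVec_charVec j h).1

lemma formVec_charVec_eq_two (j : Fin 12) {γ : V₀} (hγ : γ ∈ roots) :
    formVec (charVec j) γ = 2 ↔ γ ∈ Set.range (tableRoots j) := by
  rcases pos_or_neg hγ with h | h
  · exact (formVec_charVec j h).2.2
  · refine iff_of_false (fun h' => (formVec_charVec j h).2.1 (by rw [map_neg, h'])) ?_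
    rintro ⟨k, rfl⟩
    refine neg_notMem_posRoots ((posRoots_iff _).2 ⟨_, mem_iff.1 (rowVec_mem j k), ?_⟩) h
    exact (toV_rowVec j k).symm

lemma tableRoots_mem (j : Fin 12) (k : Fin 4) : tableRoots j k ∈ posRoots :=
  (posRoots_iff _).2 ⟨_, mem_iff.1 (rowVec_mem j k), (toV_rowVec j k).symm⟩

lemma formOf_tableChar_ne_zero (j : Fin 12) : ∀ γ ∈ roots, formOf (tableChar j) γ ≠ 0 := by
  intro γ hγ h
  rw [formOf_tableChar, Complex.ofReal_eq_zero] at h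
  exact formVec_charVec_ne_zero j γ hγ (by linarith)

lemma formOf_tableChar_eq_half (j : Fin 12) {γ : V₀} (hγ : γ ∈ roots) :
    formOf (tableChar j) γ = 1 / 2 ↔ γ ∈ Set.range (tableRoots j) := by
  rw [← formVec_charVec_eq_two j hγ, formOf_tableChar]
  have : (1 / 2 : ℂ) = ((1 / 2 : ℝ) : ℂ) := by push_cast; rfl
  rw [this, Complex.ofReal_inj]
  constructor <;> intro h <;> linarith

lemma poleSet_tableChar (j : Fin 12) : poleSet (1 / 2) (tableChar j) = Set.range (tableRoots j) := by
  ext γ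
  constructor
  · rintro ⟨h, h'⟩
    exact (formOf_tableChar_eq_half j h).1 h'
  · intro h
    have hr : γ ∈ roots := by
      obtain ⟨k, rfl⟩ := h
      exact posRoots_subset_roots (tableRoots_mem j k)
    exact ⟨hr, (formOf_tableChar_eq_half j hr).2 h⟩

lemma formOf_toV (χ : Module.Dual ℂ V) (y : GVec) :
    formOf χ y.toV = ∑ i, (ev (y.coord i) : ℂ) * formOf χ (simpleRoot i) := by
  simp [toV, Fin.sum_univ_four, GVec.coord]

/-- The roots of a row determine a character. -/
lemma eq_of_eq_on_row (j : Fin 12) {χ χ' : Module.Dual ℂ V}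
    (h : ∀ k, formOf χ (tableRoots j k) = formOf χ' (tableRoots j k)) : χ = χ' := by
  have hdet : ((Matrix.of fun k i => ev ((rowVec j k).coord i)).map Complex.ofRealHom).det ≠ 0 := by
    rw [← RingHom.mapMatrix_apply, ← RingHom.map_det, ← ev_detVec]
    have h1 := detVec_rowVec j
    rw [← Bool.not_eq_true, GInt.beq_iff] at h1
    have h2 : ev (detVec (rowVec j 0) (rowVec j 1) (rowVec j 2) (rowVec j 3)) ≠ 0 := fun h0 =>
      h1 (ev_injective (h0.trans (by simp)))
    simpa using h2
  have hz := Matrix.eq_zero_of_mulVec_eq_zero hdet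
    (v := fun i => formOf χ (simpleRoot i) - formOf χ' (simpleRoot i)) (by
      ext k
      have := h k
      rw [← toV_rowVec, formOf_toV, formOf_toV, ← sub_eq_zero, ← Finset.sum_sub_distrib] at this
      simpa [Matrix.mulVec, dotProduct, mul_sub] using this)
  refine V_hom_ext fun v => ?_
  rw [← formOf_apply, ← formOf_apply, mem_span_simpleRoot v, map_sum, map_sum]
  refine Finset.sum_congr rfl fun i _ => ?_
  rw [map_smul, map_smul, sub_eq_zero.1 (congrFun hz i)]

lemma poleSet_eq_iff (j : Fin 12) (χ : Module.Dual ℂ V) :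
    poleSet (1 / 2) χ = Set.range (tableRoots j) ↔ χ = tableChar j := by
  constructor
  · intro h
    refine eq_of_eq_on_row j fun k => ?_
    have h1 : tableRoots j k ∈ poleSet (1 / 2) χ := h ▸ ⟨k, rfl⟩
    have h2 : tableRoots j k ∈ poleSet (1 / 2) (tableChar j) := poleSet_tableChar j ▸ ⟨k, rfl⟩
    exact h1.2.trans h2.2.symm
  · rintro rfl
    exact poleSet_tableChar j

lemma isRegularForm_tableChar (j : Fin 12) : IsRegularForm (formOf (tableChar j)) := by
  intro w hw
  refine eq_one_of_form_fixed (formVec_charVec_ne_zero j) fun v => ?_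
  have := hw v
  rw [formOf_tableChar, formOf_tableChar, Complex.ofReal_inj] at this
  linarith

lemma isRegularChar_tableChar (j : Fin 12) : IsRegularChar (tableChar j) := by
  intro w hw
  refine inv_eq_one.1 (isRegularForm_tableChar j w⁻¹ fun v => ?_)
  rw [← formOf_actChar, hw, formOf_apply]

/-- The set `J_j`. -/
def tableSet (j : Fin 12) : Set V₀ := {β | ∃ k, β = tableRoots j k ∧ tableSigns j k = -1}

lemma tableSet_subset (j : Fin 12) :
    ∀ β ∈ tableSet j, β ∈ roots ∧ formOf (tableChar j) β = 1 / 2 := by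
  rintro _ ⟨k, rfl, -⟩
  have hr := posRoots_subset_roots (tableRoots_mem j k)
  exact ⟨hr, (formOf_tableChar_eq_half j hr).2 ⟨k, rfl⟩⟩

lemma tableRoots_injective (j : Fin 12) : Function.Injective (tableRoots j) := by
  intro k k' h
  rw [← toV_rowVec, ← toV_rowVec] at h
  have e : ∀ i, (rowVec j k).coord i = (rowVec j k').coord i := fun i => ev_injective (by
    rw [← toV_dot_fundWeight, ← toV_dot_fundWeight, h])
  have := rowVec_beq j k k'
  rw [GVec.beq_iff.2 (GVec.ext (e 0) (e 1) (e 2) (e 3))] at this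
  exact of_decide_eq_true this.symm

lemma mem_tableSet_iff (j : Fin 12) (k : Fin 4) :
    tableRoots j k ∈ tableSet j ↔ tableSigns j k = -1 := by
  constructor
  · rintro ⟨k', h, h'⟩
    rwa [tableRoots_injective j h]
  · exact fun h => ⟨k, rfl, h⟩

lemma mem_region_iff (j : Fin 12) (w : W) :
    w ∈ regionOf (1 / 2) (formOf (tableChar j)) (tableSet j) ↔
      ∀ k, (tableSigns j k = 1 ∧ w • tableRoots j k ∈ posRoots) ∨
        (tableSigns j k = -1 ∧ -(w • tableRoots j k) ∈ posRoots) := by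
  have hr := fun k => posRoots_subset_roots (tableRoots_mem j k)
  constructor
  · intro h k
    rcases foldr_rowVec j k with ⟨h1, -⟩ | ⟨h1, -⟩
    · refine Or.inl ⟨h1, h.2 _ (hr k) ((formOf_tableChar_eq_half j (hr k)).2 ⟨k, rfl⟩) ?_⟩
      rw [mem_tableSet_iff, h1]
      decide
    · exact Or.inr ⟨h1, h.1 _ ((mem_tableSet_iff j k).2 h1)⟩
  · intro h
    constructor
    · rintro _ ⟨k, rfl, hk⟩
      rcases h k with h | h
      · rw [h.1] at hk; exact absurd hk (by decide)
      · exact h.2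
    · intro β hβ hc hβJ
      obtain ⟨k, rfl⟩ := (formOf_tableChar_eq_half j hβ).1 hc
      rw [mem_tableSet_iff] at hβJ
      exact ((h k).resolve_right fun h => hβJ h.1).2

lemma baseWord_mem_region (j : Fin 12) :
    wordProd (baseWord j) ∈ regionOf (1 / 2) (formOf (tableChar j)) (tableSet j) := by
  rw [mem_region_iff]
  intro k
  rw [← toV_rowVec, ← toV_foldr, ← toV_neg]
  simp only [posRoots_iff]
  exact (foldr_rowVec j k).imp (fun h => ⟨h.1, _, mem_iff.1 h.2, rfl⟩)
    fun h => ⟨h.1, _, mem_iff.1 h.2, rfl⟩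

/-- At the root of the tree the height form is minus the pairing with ρ, with value -1 on each
simple root. -/
lemma tracks_base (ψ : GVec) (l : List (Fin 4)) :
    Tracks (formVec ψ) (wordProd l) 1 (l.foldr formReflect ψ)
      (gvec (-1) 0 (-1) 0 (-1) 0 (-1) 0) := by
  constructor <;> intro u
  · rw [formVec_foldr, one_mul]
  · simp [formVec_apply, rho, gvec, GVec.coord, Fin.sum_univ_four, ev]
    ring

lemma region_spec (j : Fin 12) :
    Nat.card (regionOf (1 / 2) (formOf (tableChar j)) (tableSet j)) = tableDims j ∧
      ∀ w ∈ regionOf (1 / 2) (formOf (tableChar j)) (tableSet j), ∀ i,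
        formVec (charVec j) (w⁻¹ • fundWeight i) < 0 := by
  have hlt : ∀ j, tableDims j < 1000 := by decide
  have hw₀ := baseWord_mem_region j
  have h := treeCount_spec (tableSet_subset j) (formOf_tableChar j) 61 1 _ _
    (tracks_base (charVec j) (baseWord j)) (by rwa [one_mul]) (by rw [treeCount_charVec]; exact hlt j)
  refine ⟨by rw [card_region hw₀, h.1, treeCount_charVec], fun w hw i => ?_⟩
  have := h.2 (w * (wordProd (baseWord j))⁻¹)
    ((mem_subtree_iff hw₀ _).2 (by rwa [inv_mul_cancel_right])) i
  rwa [inv_mul_cancel_right] at this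

/-- No conjugate of χ_j vanishes on a root, so the rank two condition holds vacuously. -/
lemma isSkewLocalRegion_table (j : Fin 12) :
    IsSkewLocalRegion (1 / 2) (tableChar j) (tableSet j) := by
  have hf := formOf_tableChar_ne_zero j
  have hne : ∀ w : W, ∀ γ ∈ roots, actChar w (tableChar j) (incl γ) ≠ 0 := fun w γ hγ => by
    rw [formOf_actChar]
    exact hf _ (smul_mem_roots _ hγ)
  refine ⟨⟨fun β hβ => tableSet_subset j β hβ, _, by rw [regionSet_eq hf]; exact baseWord_mem_region j⟩,
    fun w _ i => hne w _ (simpleRoot_mem_roots i), fun w _ i k _ h => ?_⟩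
  obtain ⟨γ, hγ, h0⟩ := h
  exact absurd h0 (hne w γ hγ.1)

lemma hasSign_table (j : Fin 12) :
    HasSign (1 / 2) (tableChar j) (tableSet j) (tableRoots j) (tableSigns j) := by
  intro w hw k
  rw [regionSet_eq (formOf_tableChar_ne_zero j), mem_region_iff] at hw
  rw [smul_eq_apply, rootSign]
  rcases hw k with ⟨h1, h2⟩ | ⟨h1, h2⟩
  · rw [if_pos h2, h1]
  · rw [if_neg fun h => neg_notMem_posRoots h h2, if_pos ((negRoots_iff _).2 h2), h1]

theorem exists_module_table (j : Fin 12) :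
    ∃ (M : Type) (_ : AddCommGroup M) (_ : Module ℂ M) (_ : Module (HeckeAlgebra (1 / 2)) M)
      (_ : IsScalarTower ℂ (HeckeAlgebra (1 / 2)) M),
      IsCalibratedModule (1 / 2) (tableChar j) (tableSet j) M := by
  refine exists_calibratedModule (formOf_tableChar_ne_zero j) (fun γ hγ h => ?_)
    (isRegularForm_tableChar j) (tableSet_subset j)
  obtain ⟨k, rfl⟩ := (formOf_tableChar_eq_half j hγ).1 h
  exact tableRoots_mem j k

theorem isDiscreteSeries_table (j : Fin 12) (M : Type) [AddCommGroup M] [Module ℂ M]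
    [Module (HeckeAlgebra (1 / 2)) M] [IsScalarTower ℂ (HeckeAlgebra (1 / 2)) M]
    (hM : IsCalibratedModule (1 / 2) (tableChar j) (tableSet j) M) :
    IsDiscreteSeries (1 / 2) M ∧ Module.finrank ℂ M = tableDims j := by
  have hf := formOf_tableChar_ne_zero j
  obtain ⟨b, hb⟩ := hM.exists_basis hf
  obtain ⟨hcard, hneg⟩ := region_spec j
  refine ⟨⟨hb.isSimpleModule hf (isRegularForm_tableChar j) ⟨_, baseWord_mem_region j⟩, ?_⟩, ?_⟩
  · intro θ hθ i
    obtain ⟨w, hw, rfl⟩ := hb.weight_eq hθ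
    rw [formOf_actChar, formOf_tableChar, Complex.ofReal_re]
    have := hneg w hw i
    linarith
  · rw [Module.finrank_eq_nat_card_basis b, hcard]

end
end HeckeH4

open HeckeH4

theorem theorem5p2 (j : Fin 12) :
    ∃ χ : Module.Dual ℂ V,
      (∀ χ' : Module.Dual ℂ V, poleSet (1 / 2) χ' = Set.range (tableRoots j) ↔ χ' = χ) ∧
      IsRegularChar χ ∧
      ∃ J : Set V₀,
        IsSkewLocalRegion (1 / 2) χ J ∧
        HasSign (1 / 2) χ J (tableRoots j) (tableSigns j) ∧
        (∃ (M : Type) (_ : AddCommGroup M) (_ : Module ℂ M) (_ : Module (HeckeAlgebra (1 / 2)) M)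
          (_ : IsScalarTower ℂ (HeckeAlgebra (1 / 2)) M),
          IsCalibratedModule (1 / 2) χ J M) ∧
        ∀ (M : Type) [AddCommGroup M] [Module ℂ M] [Module (HeckeAlgebra (1 / 2)) M]
          [IsScalarTower ℂ (HeckeAlgebra (1 / 2)) M],
          IsCalibratedModule (1 / 2) χ J M →
            IsDiscreteSeries (1 / 2) M ∧ Module.finrank ℂ M = tableDims j := by
  refine ⟨tableChar j, poleSet_eq_iff j, isRegularChar_tableChar j, tableSet j,
    isSkewLocalRegion_table j, hasSign_table j, exists_module_table j, ?_⟩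
  intro M _ _ _ _ hM
  exact isDiscreteSeries_table j M hM
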